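/- Let $\mathbb K$ be a field of characteristic $0$, let $\mathfrak g$ be a bounded, degree-wise finite-dimensional cochain complex over $\mathbb K$, let $\mathfrak g^\ast=\underline{\hom}(\mathfrak g,\mathbb K)$, with pairing $\langle\theta,x\rangle$, and let $n\in\mathbb Z$. Shifts are $V[p]^i=V^{i+p}$ with differential $(-1)^p\mathrm d$ and elements $s^{-p}v$. $\underline{\hom}(V,W)$ has differential $\partial L=\mathrm d L-(-1)^{|L|}L\,\mathrm d$. **Shifted Poisson structures.** For a CDGA $A$ with derivations $\mathbb T_A$ let $\mathrm{Pol}(A,n)=\mathrm{Sym}_A(\mathbb T_A[-n-1])=\bigoplus_{m\ge0}\mathrm{Sym}^m_A(\mathbb T_A[-n-1])$ ($m$ is the weight), and let $\{\cdot,\cdot\}$ be the Schouten–Nijenhuis bracket on $\mathrm{Pol}(A,n)[n+1]$, i.e. the degree $0$ bracket with $\{s^{-n-1}P,s^{-n-1}Q\}=-(-1)^{(|P|-n-1)(|Q|-n-1)}\{s^{-n-1}Q,s^{-n-1}P\}$, $\{s^{-n-1}P,s^{-n-1}QR\}=\{s^{-n-1}P,s^{-n-1}Q\}R+(-1)^{|P||Q|}Q\{s^{-n-1}P,s^{-n-1}R\}$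 and $\{s^{-n-1}a,s^{-n-1}a'\}=0$, $\{s^{-n-1}s^{n+1}D,s^{-n-1}a\}=(-1)^{|D|(n+1)}s^{-n-1}D(a)$, $\{s^{-n-1}s^{n+1}D,s^{-n-1}s^{n+1}D'\}=s^{-n-1}s^{n+1}[D,D']$ for $a,a'\in A$, $D,D'\in\mathbb T_A$. An $n$-shifted Poisson structure on $A$ is an element $\pi=(\pi^{(m)})_{m\ge2}$ of $\prod_{m\ge2}\mathrm{Sym}^m_A(\mathbb T_A[-n-1])^{n+2}$ with $\partial(s^{-n-1}\pi)+\tfrac12\{s^{-n-1}\pi,s^{-n-1}\pi\}=0$, that is, in every weight $m$, $$\partial(s^{-n-1}\pi^{(m)})+\tfrac12\sum_{p+q=m+1}\{s^{-n-1}\pi^{(p)},s^{-n-1}\pi^{(q)}\}=0 .$$ **Maps.** For $\sigma\in S_l$ and homogeneous $y_i\in\mathfrak g$ let $\gamma_\sigma(y_1\otimes\cdots\otimes y_l)=\pm\,y_{\sigma(1)}\otimes\cdots\otimes y_{\sigma(l)}$ with $\pm$ the Koszul sign. Let $\underline{\hom}^-_\pm(\mathfrak g^{\otimes l},\mathfrak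 g^{\otimes m})$ be the complex of all $L$ with $(-1)^{|\sigma|}L\gamma_\sigma=L=(-1)^{|\rho|n}\gamma_\rho L$ for all $\sigma\in S_l$, $\rho\in S_m$. Let $\mathrm{Sh}(p,q)\subseteq S_{p+q}$ be the permutations which are increasing on the first $p$ and on the last $q$ elements. For $L:\mathfrak g^{\otimes l_1}\to\mathfrak g^{\otimes m_1}$ and $L':\mathfrak g^{\otimes l_2}\to\mathfrak g^{\otimes m_2}$ with $l_1,m_2\ge1$ put $$L\diamond L'=\sum_{\sigma\in\mathrm{Sh}(l_1-1,l_2)}\ \sum_{\rho\in\mathrm{Sh}(m_1,m_2-1)}(-1)^{|\sigma|}(-1)^{|\rho|n}\ \gamma_{\rho^{-1}}\circ(L\otimes\mathrm{id}^{\otimes(m_2-1)})\circ(\mathrm{id}^{\otimes(l_1-1)}\otimes L')\circ\gamma_\sigma$$ (with the Koszul sign $(-1)^{|L'|(|y_1|+\cdots+|y_{l_1-1}|)}$ in $\mathrm{id}^{\otimes(l_1-1)}\otimes L'$; $\gamma_{\rho^{-1}}$ moves the $i$-th output to the position $\rho(i)$). **Statement.** For $A=\mathrm{Sym}(\mathfrak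 g^\ast[-1])$ and $x\in\mathfrak g$ let $s^nx=s^{n+1}(s^{-1}x)$, where $s^{-1}x$ is the derivation of degree $|x|-1$ with $(s^{-1}x)(s\theta)=\langle\theta,x\rangle$. There are linear isomorphisms $$\Phi_m:\ \mathrm{Sym}^m_A(\mathbb T_A[-n-1])^{n+2}\ \xrightarrow{\ \cong\ }\ \bigoplus_{l\ge0}\underline{\hom}^-_\pm(\mathfrak g^{\otimes l},\mathfrak g^{\otimes m})^{(1-m)n+2-l}\qquad(m\ge0),$$ given on homogeneous $x_k\in\mathfrak g$, $\theta_j\in\mathfrak g^\ast$ by $$s^nx_1\cdots s^nx_m\,s\theta_1\cdots s\theta_l\ \longmapsto\ (-1)^{\sum_k|x_k|((m-k)n+l)}\,(-1)^{\sum_j|\theta_j|(l-j)}\,L_B$$ in the summand $l$, where $$L_B(y_1,\dots,y_l)=\sum_{\sigma\in S_l}\sum_{\rho\in S_m}(-1)^{|\rho|n}\epsilon_\rho(x)\,(-1)^{|\sigma|}\epsilon_\sigma(\theta)\,\epsilon_{\mathrm{rev}}(y)\ x_{\rho(1)}\otimes\cdots\otimes x_{\rho(m)}\prod_{j=1}^l\langle\theta_{\sigma(j)},y_j\rangle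 ;$$ here $\epsilon_\tau(v)$ is the Koszul sign in $v_1\cdots v_r=\epsilon_\tau(v)\,v_{\tau(1)}\cdots v_{\tau(r)}$ and $\mathrm{rev}$ reverses the order. Moreover, $\pi\mapsto(\pi^{(m,l)})_{m\ge 2,\,l\ge 0}$, where $\pi^{(m,l)}$ is the component of $\Phi_m(\pi^{(m)})$ in the summand $l$, is a bijection from the $n$-shifted Poisson structures on $\mathrm{Sym}(\mathfrak g^\ast[-1])$ onto the families of maps $$\pi^{(m,l)}\in\underline{\hom}^-_\pm(\mathfrak g^{\otimes l},\mathfrak g^{\otimes m})^{(1-m)n+2-l}\qquad(m\ge2,\ l\ge0)$$ which for every fixed $m$ vanish for all but finitely many $l$ and which satisfy, for all $m\ge2$ and $l\ge0$, $$(-1)^{(m-1)n+l-1}\,\partial\pi^{(m,l)}+\sum_{\substack{m_1,m_2\ge2\\ m_1+m_2-1=m}}\ \sum_{\substack{l_1\ge1,\ l_2\ge0\\ l_1+l_2-1=l}}(-1)^{((1-m_1)n+2-l_1)((m_2-1)n+l_2-1)}\,(-1)^{n(m_2-1)(l_1-1)}\ \pi^{(m_1,l_1)}\diamond\pi^{(m_2,l_2)}=0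 .$$ -/

import Mathlib

open scoped DirectSum TensorProduct
namespace ShiftedPoisson
noncomputable section

/-- The sign `(-1)^k` as a scalar. -/
def sgn (K : Type*) [Field K] (k : ℤ) : K := ((k.negOnePow : ℤ) : K)

section Sgn
variable {K : Type*} [Field K]

theorem sgn_zero : sgn K 0 = 1 := by simp [sgn]

theorem sgn_add (a b : ℤ) : sgn K (a + b) = sgn K a * sgn K b := by
  simp [sgn, Int.negOnePow_add]

theorem sgn_eq {a b : ℤ} (h : Even (a - b)) : sgn K a = sgn K b := by
  simp only [sgn, (Int.negOnePow_eq_iff a b).2 h]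

theorem sgn_cases (a : ℤ) : sgn K a = 1 ∨ sgn K a = -1 := by
  rcases Int.units_eq_one_or a.negOnePow with h | h <;> simp [sgn, h]

end Sgn

section Graded
variable {K V : Type*} [Field K] [AddCommGroup V] [Module K V]

/-- The linear map on an internally graded vector space given by `f i` in degree `i`. -/
def gradedMap {𝒱 : ℤ → Submodule K V} (h : DirectSum.IsInternal 𝒱) {X : Type*} [AddCommMonoid X]
    [Module K X] (f : ∀ i, 𝒱 i →ₗ[K] X) : V →ₗ[K] X :=
  letI := h.chooseDecomposition
  DirectSum.toModule K ℤ X f ∘ₗ (DirectSum.decomposeLinearEquiv 𝒱).toLinearMap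

/-- The operator `v ↦ (-1)^(k |v|) v`. -/
def signOp {𝒱 : ℤ → Submodule K V} (h : DirectSum.IsInternal 𝒱) (k : ℤ) : V →ₗ[K] V :=
  gradedMap h fun i => sgn K (k * i) • (𝒱 i).subtype

/-- The projection onto the sum of the homogeneous components of parity `c`. -/
def parityProj {𝒱 : ℤ → Submodule K V} (h : DirectSum.IsInternal 𝒱) (c : Fin 2) : V →ₗ[K] V :=
  gradedMap h fun i => if i % 2 = ((c : ℕ) : ℤ) then (𝒱 i).subtype else 0

theorem gradedMap_of_mem {𝒱 : ℤ → Submodule K V} (h : DirectSum.IsInternal 𝒱) {X : Type*}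
    [AddCommMonoid X] [Module K X] (f : ∀ i, 𝒱 i →ₗ[K] X) {i : ℤ} {v : V} (hv : v ∈ 𝒱 i) :
    gradedMap h f v = f i ⟨v, hv⟩ := by
  let := h.chooseDecomposition
  simp only [gradedMap, LinearMap.comp_apply, LinearEquiv.coe_coe,
    DirectSum.decomposeLinearEquiv_apply]
  rw [DirectSum.decompose_of_mem 𝒱 hv]
  exact DirectSum.toModule_lof K i _

theorem signOp_of_mem {𝒱 : ℤ → Submodule K V} (h : DirectSum.IsInternal 𝒱) (k : ℤ) {i : ℤ}
    {v : V} (hv : v ∈ 𝒱 i) : signOp h k v = sgn K (k * i) • v :=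
  gradedMap_of_mem h _ hv

theorem hom_ext_of_internal {X : Type*} [AddCommMonoid X] [Module K X]
    {𝒱 : ℤ → Submodule K V} (h : DirectSum.IsInternal 𝒱)
    {f g : V →ₗ[K] X} (hfg : ∀ i, ∀ v ∈ 𝒱 i, f v = g v) : f = g := by
  refine LinearMap.ext fun v => ?_
  have hv : v ∈ ⨆ i, 𝒱 i := by rw [h.submodule_iSup_eq_top]; trivial
  induction hv using Submodule.iSup_induction' with
  | mem i x hx => exact hfg i x hx
  | zero => simp
  | add x y _ _ hx hy => simp [hx, hy]

end Graded

section Presented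
variable {K M : Type*} [Field K] [AddCommMonoid M] [Module K M]
  (r : TensorAlgebra K M → TensorAlgebra K M → Prop)

/-- The `K`-algebra with generators `M` and relations `r`. -/
def Presented : Type _ := RingQuot r

instance : Ring (Presented r) := inferInstanceAs (Ring (RingQuot r))

instance : Algebra K (Presented r) := inferInstanceAs (Algebra K (RingQuot r))

namespace Presented

/-- The quotient map. -/
def mk : TensorAlgebra K M →ₐ[K] Presented r := RingQuot.mkAlgHom K r

variable {r}

theorem mk_rel {x y : TensorAlgebra K M} (h : r x y) : mk r x = mk r y :=
  RingQuot.mkAlgHom_rel K h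

/-- The universal property. -/
def lift {B : Type*} [Semiring B] [Algebra K B] (f : TensorAlgebra K M →ₐ[K] B)
    (h : ∀ ⦃x y⦄, r x y → f x = f y) : Presented r →ₐ[K] B :=
  RingQuot.liftAlgHom K ⟨f, h⟩

theorem lift_mk {B : Type*} [Semiring B] [Algebra K B] (f : TensorAlgebra K M →ₐ[K] B)
    (h : ∀ ⦃x y⦄, r x y → f x = f y) (x : TensorAlgebra K M) : lift f h (mk r x) = f x :=
  RingQuot.liftAlgHom_mkAlgHom_apply K f h x

theorem mk_surjective : Function.Surjective (mk r) := RingQuot.mkAlgHom_surjective K r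

end Presented

/-- The inclusion of generators in a presented algebra. -/
def gen : M →ₗ[K] Presented r := (Presented.mk r).toLinearMap ∘ₗ TensorAlgebra.ι K

theorem mk_ι (m : M) : Presented.mk r (TensorAlgebra.ι K m) = gen r m := rfl

variable {r}

theorem presented_induction {C : Presented r → Prop} (h1 : C 1)
    (hadd : ∀ x y, C x → C y → C (x + y)) (hsmul : ∀ (c : K) x, C x → C (c • x))
    (hmul : ∀ m x, C x → C (gen r m * x)) (x : Presented r) : C x := by
  obtain ⟨t, rfl⟩ := Presented.mk_surjective x
  have key : ∀ t : TensorAlgebra K M, ∀ y, C y → C (Presented.mk r t * y) := by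
    intro t
    induction t using TensorAlgebra.induction with
    | algebraMap c =>
      intro y hy
      rw [AlgHom.commutes, ← Algebra.smul_def]
      exact hsmul c y hy
    | ι m => intro y hy; exact hmul m y hy
    | mul a b ha hb => intro y hy; rw [map_mul, mul_assoc]; exact ha _ (hb _ hy)
    | add a b ha hb => intro y hy; rw [map_add, add_mul]; exact hadd _ _ (ha _ hy) (hb _ hy)
  simpa using key t 1 h1

/-- The morphism to upper triangular matrices which encodes a twisted derivation. -/
def twistedMat (α : M →ₗ[K] Presented r) (f : M →ₗ[K] Presented r) :
    TensorAlgebra K M →ₐ[K] Matrix (Fin 2) (Fin 2) (Presented r) :=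
  TensorAlgebra.lift K
    { toFun := fun m => !![α m, f m; 0, gen r m]
      map_add' := fun x y => by ext i j; fin_cases i <;> fin_cases j <;> simp
      map_smul' := fun c x => by ext i j; fin_cases i <;> fin_cases j <;> simp }

theorem twistedMat_ι (α : M →ₗ[K] Presented r) (f : M →ₗ[K] Presented r) (m : M) :
    twistedMat α f (TensorAlgebra.ι K m) = !![α m, f m; 0, gen r m] := by
  simp [twistedMat]

/-- The linear endomorphism `D` of a presented algebra with `D m = f m` on generators and
`D (x y) = D x y + α x D y`, where the twist `α` is an algebra morphism given on generators. -/
def twistedDer (α f : M →ₗ[K] Presented r)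
    (h : ∀ ⦃x y⦄, r x y → twistedMat α f x = twistedMat α f y) : Presented r →ₗ[K] Presented r where
  toFun x := Presented.lift (twistedMat α f) h x 0 1
  map_add' x y := by simp
  map_smul' c x := by simp

theorem twistedDer_gen (α f : M →ₗ[K] Presented r) (h) (m : M) :
    twistedDer α f h (gen r m) = f m := by
  rw [← mk_ι]
  simp [twistedDer, Presented.lift_mk, twistedMat_ι]

theorem twistedDer_one (α f : M →ₗ[K] Presented r) (h) : twistedDer α f h 1 = 0 := by
  simp [twistedDer]

theorem twistedMat_lift_gen (α f : M →ₗ[K] Presented r)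
    (h : ∀ ⦃x y⦄, r x y → twistedMat α f x = twistedMat α f y) (m : M) :
    Presented.lift (twistedMat α f) h (gen r m) = !![α m, f m; 0, gen r m] := by
  rw [← mk_ι, Presented.lift_mk, twistedMat_ι, mk_ι]

theorem twistedDer_gen_mul (α f : M →ₗ[K] Presented r) (h) (m : M) (x : Presented r) :
    twistedDer α f h (gen r m * x) = f m * x + α m * twistedDer α f h x := by
  have h11 : ∀ x, Presented.lift (twistedMat α f) h x 1 1 = x ∧
      Presented.lift (twistedMat α f) h x 1 0 = 0 := by
    intro x
    induction x using presented_induction with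
    | h1 => simp
    | hadd x y hx hy => simp [hx, hy]
    | hsmul c x hx => simp [hx]
    | hmul m x hx =>
      simp [twistedMat_lift_gen, Matrix.mul_apply, hx, Fin.sum_univ_two]
  simp [twistedDer, twistedMat_lift_gen, Matrix.mul_apply, Fin.sum_univ_two, h11]
  abel

end Presented

/-- A cochain complex over `K`, presented by its total space with its internal grading. -/
structure Cochain (K : Type*) [Field K] where
  carrier : Type*
  [addCommGroup : AddCommGroup carrier]
  [module : Module K carrier]
  gr : ℤ → Submodule K carrier
  isInternal : DirectSum.IsInternal gr
  d : carrier →ₗ[K] carrier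
  d_mem : ∀ {i v}, v ∈ gr i → d v ∈ gr (i + 1)
  d_d : ∀ v, d (d v) = 0

attribute [instance] Cochain.addCommGroup Cochain.module

namespace Cochain
variable {K : Type*} [Field K]

/-- The shift `C[n]`, with `C[n]^i = C^(i+n)` and differential `(-1)^n d`. -/
def shift (C : Cochain K) (n : ℤ) : Cochain K where
  carrier := C.carrier
  gr i := C.gr (i + n)
  isInternal := by
    have h := (DirectSum.isInternal_submodule_iff_iSupIndep_and_iSup_eq_top C.gr).1 C.isInternal
    rw [DirectSum.isInternal_submodule_iff_iSupIndep_and_iSup_eq_top]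
    refine ⟨h.1.comp (add_left_injective n), ?_⟩
    rw [← h.2]
    exact (Equiv.addRight n).iSup_comp (g := C.gr)
  d := sgn K n • C.d
  d_mem {i v} hv := by
    have := C.d_mem hv
    rw [show i + n + 1 = i + 1 + n by ring] at this
    rcases sgn_cases (K := K) n with h | h <;> simpa [h] using this
  d_d v := by simp [C.d_d]

/-- The degree `i` part of the dual: functionals vanishing on all components but `C^(-i)`. -/
def dualGr (C : Cochain K) (i : ℤ) : Submodule K (Module.Dual K C.carrier) where
  carrier := {θ | ∀ j, j ≠ -i → ∀ v ∈ C.gr j, θ v = 0}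
  add_mem' ha hb j hj v hv := by simp [ha j hj v hv, hb j hj v hv]
  zero_mem' := by simp
  smul_mem' c x hx j hj v hv := by simp [hx j hj v hv]

theorem dualGr_isInternal (C : Cochain K) [Module.Finite K C.carrier] :
    DirectSum.IsInternal C.dualGr := by
  have hcoe : ∀ (x : ⨁ i, C.dualGr i) (i : ℤ) (v : C.carrier), v ∈ C.gr (-i) →
      DirectSum.coeAddMonoidHom C.dualGr x v = (x i : Module.Dual K C.carrier) v := by
    intro x i v hv
    induction x using DirectSum.induction_on with
    | zero => simp
    | of j θ =>
      rw [DirectSum.coeAddMonoidHom_of]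
      by_cases h : j = i
      · subst h; simp
      · rw [DirectSum.of_eq_of_ne _ _ _ (Ne.symm h)]
        simpa using θ.2 (-i) (by omega) v hv
    | add x y hx hy => simp [hx, hy]
  constructor
  · intro x y hxy
    refine DFinsupp.ext fun i => Subtype.ext ?_
    refine hom_ext_of_internal C.isInternal fun j v hv => ?_
    by_cases h : j = -i
    · subst h
      rw [← hcoe x i v hv, ← hcoe y i v hv, hxy]
    · rw [(x i).2 j h v hv, (y i).2 j h v hv]
  · intro θ
    have hfin : {j | C.gr j ≠ ⊥}.Finite :=
      WellFoundedGT.finite_ne_bot_of_iSupIndep C.isInternal.submodule_iSupIndep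
    let p (j : ℤ) : C.carrier →ₗ[K] C.carrier :=
      gradedMap C.isInternal fun i => if i = j then (C.gr i).subtype else 0
    have hp (j i : ℤ) (v) (hv : v ∈ C.gr i) : p j v = if i = j then v else 0 := by
      simp only [p, gradedMap_of_mem C.isInternal _ hv]
      split_ifs <;> simp
    have hmem (j : ℤ) : θ ∘ₗ p j ∈ C.dualGr (-j) := by
      intro i hi v hv
      simp [hp j i v hv, show i ≠ j by omega]
    refine ⟨∑ j ∈ hfin.toFinset, DirectSum.of (fun i => C.dualGr i) (-j) ⟨_, hmem j⟩, ?_⟩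
    refine hom_ext_of_internal C.isInternal fun i v hv => ?_
    simp only [map_sum, DirectSum.coeAddMonoidHom_of, LinearMap.sum_apply, LinearMap.comp_apply,
      hp _ i v hv]
    by_cases hv0 : v = 0
    · simp [hv0]
    · have hi : i ∈ hfin.toFinset := by
        simp only [Set.Finite.mem_toFinset, Set.mem_ofPred_eq]
        rintro h
        rw [h] at hv
        exact hv0 (by simpa using hv)
      rw [Finset.sum_eq_single i]
      · simp
      · intro b _ hb; simp [Ne.symm hb]
      · exact fun h => absurd hi h

/-- The dual complex `C* = hom(C, K)` of a bounded degree-wise finite-dimensional complex, with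
differential `d θ = -(-1)^|θ| θ ∘ d`. -/
def dual (C : Cochain K) [Module.Finite K C.carrier] : Cochain K where
  carrier := Module.Dual K C.carrier
  gr := C.dualGr
  isInternal := C.dualGr_isInternal
  d := - (C.d.dualMap ∘ₗ signOp C.dualGr_isInternal 1)
  d_mem {i θ} hθ := by
    intro j hj v hv
    have := hθ (j + 1) (by omega) _ (C.d_mem hv)
    simp [signOp_of_mem _ _ hθ, this]
  d_d θ := by
    have : ∀ ψ : Module.Dual K C.carrier, C.d.dualMap (signOp C.dualGr_isInternal 1
        (C.d.dualMap ψ)) = 0 := by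
      intro ψ
      suffices h : C.d.dualMap ∘ₗ signOp C.dualGr_isInternal 1 ∘ₗ C.d.dualMap = 0 from
        LinearMap.congr_fun h ψ
      refine hom_ext_of_internal C.dualGr_isInternal fun i θ hθ => ?_
      have hm : C.d.dualMap θ ∈ C.dualGr (i + 1) := by
        intro j hj v hv
        exact hθ (j + 1) (by omega) _ (C.d_mem hv)
      ext v
      simp [signOp_of_mem _ _ hm, C.d_d]
    simp [this]

end Cochain

/-- A commutative differential graded algebra over `K`. -/
structure CDGA (K : Type*) [Field K] where
  carrier : Type*
  [ring : Ring carrier]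
  [algebra : Algebra K carrier]
  gr : ℤ → Submodule K carrier
  isInternal : DirectSum.IsInternal gr
  one_mem : 1 ∈ gr 0
  mul_mem : ∀ {i j a b}, a ∈ gr i → b ∈ gr j → a * b ∈ gr (i + j)
  comm : ∀ {i j a b}, a ∈ gr i → b ∈ gr j → a * b = sgn K (i * j) • (b * a)
  d : carrier →ₗ[K] carrier
  d_mem : ∀ {i a}, a ∈ gr i → d a ∈ gr (i + 1)
  d_d : ∀ a, d (d a) = 0
  leibniz : ∀ {i a}, a ∈ gr i → ∀ b, d (a * b) = d a * b + sgn K i • (a * d b)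

attribute [instance] CDGA.ring CDGA.algebra

section Sym
variable {K : Type*} [Field K]

/-- The relations `v w = (-1)^(|v||w|) w v` of the symmetric algebra. -/
inductive SymRel (W : Cochain K) :
    TensorAlgebra K W.carrier → TensorAlgebra K W.carrier → Prop
  | comm {i j : ℤ} {v w : W.carrier} (hv : v ∈ W.gr i) (hw : w ∈ W.gr j) :
      SymRel W (TensorAlgebra.ι K v * TensorAlgebra.ι K w)
        (sgn K (i * j) • (TensorAlgebra.ι K w * TensorAlgebra.ι K v))

/-- The underlying algebra of the symmetric algebra of a cochain complex. -/
abbrev Sym (W : Cochain K) : Type _ := Presented (SymRel W)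

namespace Sym
variable {W : Cochain K}

/-- The inclusion of generators. -/
def ι (W : Cochain K) : W.carrier →ₗ[K] Sym W := gen (SymRel W)

theorem ι_comm {i j : ℤ} {v w : W.carrier} (hv : v ∈ W.gr i) (hw : w ∈ W.gr j) :
    ι W v * ι W w = sgn K (i * j) • (ι W w * ι W v) := by
  have := Presented.mk_rel (SymRel.comm hv hw)
  simp only [map_mul, mk_ι, map_smul] at this
  exact this

/-- Products of homogeneous generators, of a given total degree. -/
inductive IsMono (W : Cochain K) : ℤ → Sym W → Prop
  | one : IsMono W 0 1
  | cons {i j : ℤ} {w : W.carrier} {x : Sym W} (hw : w ∈ W.gr i) (hx : IsMono W j x) :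
      IsMono W (i + j) (ι W w * x)

/-- The grading of the symmetric algebra. -/
def gr (W : Cochain K) (i : ℤ) : Submodule K (Sym W) := Submodule.span K {x | IsMono W i x}

theorem ι_mul_mem {i j : ℤ} {w : W.carrier} {x : Sym W} (hw : w ∈ W.gr i) (hx : x ∈ gr W j) :
    ι W w * x ∈ gr W (i + j) := by
  induction hx using Submodule.span_induction with
  | mem x hx => exact Submodule.subset_span (.cons hw hx)
  | zero => simp
  | add x y _ _ hx hy => rw [mul_add]; exact add_mem hx hy
  | smul c x _ hx => rw [mul_smul_comm]; exact Submodule.smul_mem _ _ hx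

theorem one_mem : (1 : Sym W) ∈ gr W 0 := Submodule.subset_span .one

theorem ι_mem {i : ℤ} {w : W.carrier} (hw : w ∈ W.gr i) : ι W w ∈ gr W i := by
  simpa using ι_mul_mem hw one_mem

/-- Induction on homogeneous elements. -/
theorem gr_induction {C : ∀ i x, x ∈ gr W i → Prop} (one : C 0 1 one_mem)
    (zero : ∀ i, C i 0 (zero_mem _))
    (add : ∀ i x y hx hy, C i x hx → C i y hy → C i (x + y) (add_mem hx hy))
    (smul : ∀ i (c : K) x hx, C i x hx → C i (c • x) (Submodule.smul_mem _ c hx))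
    (mul : ∀ i j w x (hw : w ∈ W.gr i) hx, C j x hx → C (i + j) (ι W w * x) (ι_mul_mem hw hx))
    {i : ℤ} {x : Sym W} (hx : x ∈ gr W i) : C i x hx := by
  induction hx using Submodule.span_induction with
  | mem x hx =>
    induction hx with
    | one => exact one
    | cons hw hx ih => exact mul _ _ _ _ hw (Submodule.subset_span hx) ih
  | zero => exact zero i
  | add x y _ _ hx hy => exact add _ _ _ _ _ hx hy
  | smul c x _ hx => exact smul _ _ _ _ hx

theorem mul_mem {i j : ℤ} {x y : Sym W} (hx : x ∈ gr W i) (hy : y ∈ gr W j) :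
    x * y ∈ gr W (i + j) := by
  induction hx using gr_induction with
  | one => simpa using hy
  | zero i => simp
  | add i x x' _ _ hx hx' => rw [add_mul]; exact add_mem hx hx'
  | smul i c x _ hx => rw [smul_mul_assoc]; exact Submodule.smul_mem _ _ hx
  | mul i k w x hw _ hx => rw [mul_assoc, add_assoc]; exact ι_mul_mem hw hx

theorem ι_mul_comm {i j : ℤ} {w : W.carrier} {x : Sym W} (hw : w ∈ W.gr i) (hx : x ∈ gr W j) :
    ι W w * x = sgn K (i * j) • (x * ι W w) := by
  induction hx using gr_induction with
  | one => simp [sgn_zero]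
  | zero j => simp
  | add j x y _ _ hx hy => rw [mul_add, hx, hy, add_mul, smul_add]
  | smul j c x _ hx => rw [mul_smul_comm, hx, smul_mul_assoc, smul_comm]
  | mul j k v x hv _ hx =>
    rw [← mul_assoc, ι_comm hw hv, smul_mul_assoc, mul_assoc, hx, mul_smul_comm, smul_smul,
      ← sgn_add, mul_add, mul_assoc]

theorem comm {i j : ℤ} {x y : Sym W} (hx : x ∈ gr W i) (hy : y ∈ gr W j) :
    x * y = sgn K (i * j) • (y * x) := by
  induction hx using gr_induction with
  | one => simp [sgn_zero]
  | zero j => simp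
  | add j x y _ _ hx hy => rw [add_mul, hx, hy, mul_add, smul_add]
  | smul j c x _ hx => rw [smul_mul_assoc, hx, mul_smul_comm, smul_comm]
  | mul i k w x hw _ hx =>
    rw [mul_assoc, hx, mul_smul_comm, ← mul_assoc, ι_mul_comm hw hy, smul_mul_assoc, smul_smul,
      ← sgn_add, mul_assoc, add_mul, add_comm]

instance : SetLike.GradedMonoid (gr W) where
  one_mem := one_mem
  mul_mem _ _ _ _ hx hy := mul_mem hx hy

/-- The inclusion of generators, with values in the direct sum of the homogeneous parts. -/
def ιGraded (W : Cochain K) : W.carrier →ₗ[K] ⨁ i, gr W i :=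
  gradedMap W.isInternal fun i => DirectSum.lof K ℤ (fun i => gr W i) i ∘ₗ
    ((ι W).restrict fun _ hw => ι_mem hw)

theorem ιGraded_of_mem {i : ℤ} {w : W.carrier} (hw : w ∈ W.gr i) :
    ιGraded W w = DirectSum.of (fun i => gr W i) i ⟨ι W w, ι_mem hw⟩ :=
  gradedMap_of_mem W.isInternal _ hw

theorem isInternal (W : Cochain K) : DirectSum.IsInternal (gr W) := by
  have hrel : ∀ ⦃x y⦄, SymRel W x y →
      TensorAlgebra.lift K (ιGraded W) x = TensorAlgebra.lift K (ιGraded W) y := by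
    rintro _ _ ⟨hv, hw⟩
    rename_i i j v w
    rw [map_smul]
    simp only [map_mul, TensorAlgebra.lift_ι_apply, ιGraded_of_mem hv, ιGraded_of_mem hw,
      DirectSum.of_mul_of]
    rw [← DirectSum.lof_eq_of K, ← DirectSum.lof_eq_of K, ← map_smul]
    refine DirectSum.of_eq_of_gradedMonoid_eq (Sigma.subtype_ext (add_comm _ _) ?_)
    exact ι_comm hv hw
  let F : Sym W →ₐ[K] ⨁ i, gr W i := Presented.lift _ hrel
  have hF : ∀ w, F (ι W w) = ιGraded W w := by
    intro w
    simp only [F, ι, ← mk_ι, Presented.lift_mk, TensorAlgebra.lift_ι_apply]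
  let _ : GradedAlgebra (gr W) := GradedAlgebra.ofAlgHom _ F
    (by
      refine AlgHom.ext fun x => ?_
      induction x using presented_induction with
      | h1 => simp
      | hadd x y hx hy => simp only [map_add, hx, hy]
      | hsmul c x hx => simp only [map_smul, hx]
      | hmul w x hx =>
        rw [map_mul, map_mul, hx]
        congr 1
        suffices h : (DirectSum.coeAlgHom (gr W)).toLinearMap ∘ₗ F.toLinearMap ∘ₗ ι W = ι W from
          LinearMap.congr_fun h w
        refine hom_ext_of_internal W.isInternal fun i v hv => ?_
        simp [hF, ιGraded_of_mem hv])
    (by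
      rintro i ⟨x, hx⟩
      dsimp only
      induction hx using gr_induction with
      | one => rw [map_one]; rfl
      | zero i => rw [map_zero]; exact (map_zero (DirectSum.of (fun i => gr W i) i)).symm
      | add i x y hx hy hx' hy' => rw [map_add, hx', hy', ← map_add]; rfl
      | smul i c x hx hx' =>
        rw [map_smul, hx', ← DirectSum.lof_eq_of K, ← map_smul]; rfl
      | mul i j w x hw hx0 hx =>
        rw [map_mul, hx, hF, ιGraded_of_mem hw, DirectSum.of_mul_of]
        rfl)
  exact DirectSum.Decomposition.isInternal (gr W)

end Sym
end Sym

namespace CDGA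
variable {K : Type*} [Field K] (A : CDGA K)

/-- The derivations of degree `i` of a commutative differential graded algebra. -/
def der (i : ℤ) : Submodule K (A.carrier →ₗ[K] A.carrier) where
  carrier := {D | (∀ j, ∀ a ∈ A.gr j, D a ∈ A.gr (j + i)) ∧
    ∀ j, ∀ a ∈ A.gr j, ∀ b, D (a * b) = D a * b + sgn K (i * j) • (a * D b)}
  add_mem' {D E} hD hE := by
    refine ⟨fun j a ha => add_mem (hD.1 j a ha) (hE.1 j a ha), fun j a ha b => ?_⟩
    simp only [LinearMap.add_apply, hD.2 j a ha b, hE.2 j a ha b, add_mul, mul_add, smul_add]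
    abel
  zero_mem' := ⟨fun j a ha => zero_mem _, fun j a ha b => by simp⟩
  smul_mem' c D hD := by
    refine ⟨fun j a ha => Submodule.smul_mem _ _ (hD.1 j a ha), fun j a ha b => ?_⟩
    simp only [LinearMap.smul_apply, hD.2 j a ha b, smul_add, smul_mul_assoc, mul_smul_comm,
      smul_comm c]

variable {A}

theorem der_map_one {i : ℤ} (D : A.der i) : (D : A.carrier →ₗ[K] A.carrier) 1 = 0 := by
  have := D.2.2 0 1 A.one_mem 1
  simpa [sgn_zero] using this

/-- The module structure `(a D)(b) = a D(b)` of derivations. -/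
def derSmul {i j : ℤ} (a : A.gr i) (D : A.der j) : A.der (i + j) :=
  ⟨LinearMap.mulLeft K (a : A.carrier) ∘ₗ (D : A.carrier →ₗ[K] A.carrier), by
    refine ⟨fun k b hb => ?_, fun k b hb c => ?_⟩
    · have := A.mul_mem a.2 (D.2.1 k b hb)
      rwa [show i + (k + j) = k + (i + j) by ring] at this
    · simp only [LinearMap.comp_apply, LinearMap.mulLeft_apply, D.2.2 k b hb c, mul_add,
        mul_smul_comm, ← mul_assoc, A.comm a.2 hb, smul_mul_assoc, smul_smul, add_mul, sgn_add]
      rw [mul_comm (sgn K (j * k))]⟩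

/-- The commutator of derivations. -/
def derBracket {i j : ℤ} (D : A.der i) (E : A.der j) : A.der (i + j) :=
  ⟨(D : A.carrier →ₗ[K] A.carrier) ∘ₗ (E : A.carrier →ₗ[K] A.carrier) -
      sgn K (i * j) • ((E : A.carrier →ₗ[K] A.carrier) ∘ₗ (D : A.carrier →ₗ[K] A.carrier)), by
    refine ⟨fun k b hb => ?_, fun k b hb c => ?_⟩
    · have h1 := D.2.1 _ _ (E.2.1 k b hb)
      have h2 := E.2.1 _ _ (D.2.1 k b hb)
      rw [show k + j + i = k + (i + j) by ring] at h1
      rw [show k + i + j = k + (i + j) by ring] at h2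
      exact sub_mem h1 (Submodule.smul_mem _ _ h2)
    · simp only [LinearMap.sub_apply, LinearMap.smul_apply, LinearMap.comp_apply,
        D.2.2 k b hb c, E.2.2 k b hb c, map_add, map_smul, D.2.2 _ _ (E.2.1 k b hb) c,
        E.2.2 _ _ (D.2.1 k b hb) c, D.2.2 k b hb, E.2.2 k b hb, mul_add, add_mul, sgn_add,
        mul_comm j i]
      rcases sgn_cases (K := K) (i * j) with h1 | h1 <;>
      rcases sgn_cases (K := K) (i * k) with h2 | h2 <;>
      rcases sgn_cases (K := K) (j * k) with h3 | h3 <;>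
      simp only [h1, h2, h3, one_smul, neg_smul, mul_one, mul_neg, neg_neg, sub_mul, mul_sub,
        neg_mul] <;> abel⟩

/-- The differential `∂ D = d D - (-1)^|D| D d` of derivations. -/
def derDiff (i : ℤ) : A.der i →ₗ[K] A.der (i + 1) where
  toFun D := ⟨A.d ∘ₗ (D : A.carrier →ₗ[K] A.carrier) -
      sgn K i • ((D : A.carrier →ₗ[K] A.carrier) ∘ₗ A.d), by
    have hd : A.d ∈ A.der 1 := ⟨fun j a ha => A.d_mem ha, fun j a ha b => by
      simpa using A.leibniz ha b⟩
    have := (derBracket ⟨A.d, hd⟩ D).2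
    simp only [derBracket, one_mul] at this
    rwa [add_comm 1 i] at this⟩
  map_add' D E := by
    ext a; simp; abel
  map_smul' c D := by
    ext a; simp [smul_sub, smul_comm c]

variable (A)

/-- The complex of derivations. -/
abbrev Der : Type _ := ⨁ i, A.der i

/-- A homogeneous derivation as an element of the complex of derivations. -/
abbrev toDer (i : ℤ) : A.der i →ₗ[K] A.Der := DirectSum.lof K ℤ (fun i => A.der i) i

end CDGA

namespace Sym
variable {K : Type*} [Field K] {W : Cochain K}

theorem twisted_rel (p : ℤ) (f : W.carrier →ₗ[K] Sym W)
    (hf : ∀ i, ∀ w ∈ W.gr i, f w ∈ gr W (i + p)) ⦃x y⦄ (h : SymRel W x y) :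
    twistedMat (r := SymRel W) (ι W ∘ₗ signOp W.isInternal p) f x =
      twistedMat (r := SymRel W) (ι W ∘ₗ signOp W.isInternal p) f y := by
  obtain ⟨hv, hw⟩ := h
  rename_i i j v w
  have e0 : ι W v * ι W w = sgn K (i * j) • (ι W w * ι W v) := ι_comm hv hw
  have e1 : f v * ι W w = sgn K ((i + p) * j) • (ι W w * f v) := comm (hf i v hv) (ι_mem hw)
  have e2 : ι W v * f w = sgn K (i * (j + p)) • (f w * ι W v) := comm (ι_mem hv) (hf j w hw)
  simp only [map_mul, map_smul, twistedMat_ι]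
  ext a b
  fin_cases a <;> fin_cases b <;>
    simp [Matrix.mul_apply, Fin.sum_univ_two, signOp_of_mem _ _ hv, signOp_of_mem _ _ hw]
  · rw [e0]
    simp only [smul_smul]
    congr 1
    ring
  · change sgn K (p * i) • (ι W v * f w) + f v * ι W w =
      sgn K (i * j) • sgn K (p * j) • (ι W w * f v) + sgn K (i * j) • (f w * ι W v)
    rw [e1, e2, smul_smul, smul_smul, add_comm, ← sgn_add, ← sgn_add]
    congr 2
    · congr 1; ring
    · exact sgn_eq ⟨i * p, by ring⟩
  · exact e0

/-- The derivation of degree `p` which extends a homogeneous linear map on generators. -/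
def extend (p : ℤ) (f : W.carrier →ₗ[K] Sym W)
    (hf : ∀ i, ∀ w ∈ W.gr i, f w ∈ gr W (i + p)) : Sym W →ₗ[K] Sym W :=
  twistedDer (r := SymRel W) (ι W ∘ₗ signOp W.isInternal p) f (twisted_rel p f hf)

section extend
variable (p : ℤ) (f : W.carrier →ₗ[K] Sym W) (hf : ∀ i, ∀ w ∈ W.gr i, f w ∈ gr W (i + p))

theorem extend_ι (w : W.carrier) : extend p f hf (ι W w) = f w :=
  twistedDer_gen (r := SymRel W) _ f _ w

theorem extend_one : extend p f hf 1 = 0 := twistedDer_one (r := SymRel W) _ f _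

theorem extend_ι_mul {i : ℤ} {w : W.carrier} (hw : w ∈ W.gr i) (x : Sym W) :
    extend p f hf (ι W w * x) = f w * x + sgn K (p * i) • (ι W w * extend p f hf x) := by
  refine (twistedDer_gen_mul (r := SymRel W) _ f _ w x).trans ?_
  simp [signOp_of_mem _ _ hw, extend]

theorem extend_mem {i : ℤ} {x : Sym W} (hx : x ∈ gr W i) : extend p f hf x ∈ gr W (i + p) := by
  induction hx using gr_induction with
  | one => rw [extend_one]; exact zero_mem _
  | zero i => rw [map_zero]; exact zero_mem _
  | add i x y _ _ hx hy => rw [map_add]; exact add_mem hx hy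
  | smul i c x _ hx => rw [map_smul]; exact Submodule.smul_mem _ _ hx
  | mul i j w x hw hx0 hx =>
    rw [extend_ι_mul p f hf hw]
    refine add_mem ?_ (Submodule.smul_mem _ _ ?_)
    · have := mul_mem (hf i w hw) hx0
      rwa [show i + p + j = i + j + p by ring] at this
    · rw [add_assoc]; exact ι_mul_mem hw hx

theorem extend_mul {i : ℤ} {x : Sym W} (hx : x ∈ gr W i) (y : Sym W) :
    extend p f hf (x * y) = extend p f hf x * y + sgn K (p * i) • (x * extend p f hf y) := by
  induction hx using gr_induction with
  | one => simp [extend_one, sgn_zero]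
  | zero i => simp
  | add i x y _ _ hx hy => simp only [add_mul, map_add, hx, hy, smul_add]; abel
  | smul i c x _ hx =>
    simp only [smul_mul_assoc, map_smul, hx, smul_add, smul_comm c]
  | mul i j w x hw hx0 hx =>
    rw [mul_assoc, extend_ι_mul p f hf hw, extend_ι_mul p f hf hw, hx]
    simp only [add_mul, mul_add, smul_mul_assoc, mul_smul_comm, smul_smul, smul_add, mul_assoc,
      sgn_add]
    abel

end extend

end Sym

/-- The free commutative differential graded algebra `Sym W` on a cochain complex. -/
def freeCDGA {K : Type*} [Field K] (W : Cochain K) : CDGA K where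
  carrier := Sym W
  gr := Sym.gr W
  isInternal := Sym.isInternal W
  one_mem := Sym.one_mem
  mul_mem := Sym.mul_mem
  comm := Sym.comm
  d := Sym.extend 1 (Sym.ι W ∘ₗ W.d) fun _ _ hw => Sym.ι_mem (W.d_mem hw)
  d_mem ha := Sym.extend_mem _ _ _ ha
  leibniz {i a} ha b := by rw [Sym.extend_mul _ _ _ ha, one_mul]
  d_d a := by
    have hf : ∀ i, ∀ w ∈ W.gr i, (Sym.ι W ∘ₗ W.d) w ∈ Sym.gr W (i + 1) :=
      fun _ _ hw => Sym.ι_mem (W.d_mem hw)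
    suffices h : Sym.extend 1 (Sym.ι W ∘ₗ W.d) hf ∘ₗ Sym.extend 1 (Sym.ι W ∘ₗ W.d) hf = 0 from
      LinearMap.congr_fun h a
    refine hom_ext_of_internal (Sym.isInternal W) fun i x hx => ?_
    rw [LinearMap.comp_apply, LinearMap.zero_apply]
    induction hx using Sym.gr_induction with
    | one => simp [Sym.extend_one]
    | zero i => simp
    | add i x y _ _ hx hy => simp [hx, hy]
    | smul i c x _ hx => simp [hx]
    | mul i j w x hw hx0 hx =>
      rw [Sym.extend_ι_mul _ _ _ hw, map_add, map_smul, Sym.extend_ι_mul _ _ _ hw, hx,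
        LinearMap.comp_apply, Sym.extend_ι_mul _ _ _ (W.d_mem hw)]
      simp only [LinearMap.comp_apply, W.d_d, map_zero, zero_mul, mul_zero, smul_zero, add_zero,
        zero_add, one_mul, sgn_add]
      rw [show sgn K 1 = -1 by simp [sgn], mul_neg, mul_one, ← add_smul, neg_add_cancel,
        zero_smul]

/-- The derivation of degree `p` of the free algebra which extends a linear map of degree `p` on
generators. -/
def freeDer {K : Type*} [Field K] {W : Cochain K} (p : ℤ) (f : W.carrier →ₗ[K] Sym W)
    (hf : ∀ i, ∀ w ∈ W.gr i, f w ∈ Sym.gr W (i + p)) : (freeCDGA W).der p :=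
  ⟨Sym.extend p f hf, fun _ _ ha => Sym.extend_mem _ _ _ ha,
    fun _ _ ha b => Sym.extend_mul _ _ _ ha b⟩

section CE
variable {K : Type*} [Field K] (g : Cochain K) [Module.Finite K g.carrier]

/-- The complex `g*[-1]`. -/
abbrev dualShift : Cochain K := g.dual.shift (-1)

/-- The free algebra `Sym (g*[-1])`. -/
abbrev freeAlg : CDGA K := freeCDGA (dualShift g)

/-- The element `s θ` of `g*[-1]`, as an element of the free algebra. -/
def sTheta : Module.Dual K g.carrier →ₗ[K] (freeAlg g).carrier := Sym.ι (dualShift g)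

/-- The map `s θ ↦ θ x` on generators. -/
def evalAt (x : g.carrier) : Module.Dual K g.carrier →ₗ[K] Sym (dualShift g) :=
  Algebra.linearMap K (Sym (dualShift g)) ∘ₗ Module.Dual.eval K g.carrier x

theorem evalAt_mem {e i : ℤ} (x : g.gr e) (θ : Module.Dual K g.carrier)
    (hθ : θ ∈ g.dualGr (i + -1)) : evalAt g x θ ∈ Sym.gr (dualShift g) (i + (e - 1)) := by
  have h2 : evalAt g x θ = θ x • (1 : Sym (dualShift g)) := by
    simp [evalAt, Algebra.algebraMap_eq_smul_one]
  rw [h2]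
  by_cases h : i + (e - 1) = 0
  · rw [h]
    exact Submodule.smul_mem _ _ Sym.one_mem
  · rw [hθ e (by omega) x x.2, zero_smul]
    exact zero_mem _

/-- The derivation `s⁻¹ x`, of degree `|x| - 1`, with `(s⁻¹ x) (s θ) = θ x`. -/
def contraction {e : ℤ} (x : g.gr e) : (freeAlg g).der (e - 1) :=
  freeDer (W := dualShift g) (e - 1) (evalAt g x) fun _ θ hθ => evalAt_mem g x θ hθ

theorem contraction_sTheta {e : ℤ} (x : g.gr e) (θ : Module.Dual K g.carrier) :
    (contraction g x : (freeAlg g).carrier →ₗ[K] (freeAlg g).carrier) (sTheta g θ) =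
      algebraMap K (freeAlg g).carrier (θ x) :=
  Sym.extend_ι (W := dualShift g) _ (evalAt g x) (fun _ θ hθ => evalAt_mem g x θ hθ) θ

end CE

section Pol
variable {K : Type*} [Field K] (A : CDGA K) (n : ℤ)

/-- Generators of the polyvectors: elements `a` of `A` and `s^(n+1) D` of `T_A[-n-1]`. -/
abbrev PolGen : Type _ := A.carrier × A.Der

/-- The generator attached to an element of `A`. -/
def inA : A.carrier →ₗ[K] PolGen A := LinearMap.inl K A.carrier A.Der

/-- The generator `s^(n+1) D` attached to a derivation. -/
def inT (i : ℤ) : A.der i →ₗ[K] PolGen A := LinearMap.inr K A.carrier A.Der ∘ₗ A.toDer i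

/-- The free generator attached to an element of `A`. -/
def preA : A.carrier →ₗ[K] TensorAlgebra K (PolGen A) := TensorAlgebra.ι K ∘ₗ inA A

/-- The free generator attached to `s^(n+1) D`. -/
def preT (i : ℤ) : A.der i →ₗ[K] TensorAlgebra K (PolGen A) := TensorAlgebra.ι K ∘ₗ inT A i

/-- The defining relations of the relative symmetric algebra `Sym_A (T_A[-n-1])`. -/
inductive PolRel : TensorAlgebra K (PolGen A) → TensorAlgebra K (PolGen A) → Prop
  | one : PolRel (preA A 1) 1
  | mul (a b : A.carrier) : PolRel (preA A a * preA A b) (preA A (a * b))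
  | smul {i j : ℤ} (a : A.gr i) (D : A.der j) :
      PolRel (preA A a * preT A j D) (sgn K (i * (n + 1)) • preT A (i + j) (CDGA.derSmul a D))
  | comm_A_T {i j : ℤ} (a : A.gr i) (D : A.der j) :
      PolRel (preA A a * preT A j D) (sgn K (i * (j + n + 1)) • (preT A j D * preA A a))
  | comm_T_T {i j : ℤ} (D : A.der i) (E : A.der j) :
      PolRel (preT A i D * preT A j E)
        (sgn K ((i + n + 1) * (j + n + 1)) • (preT A j E * preT A i D))

/-- The algebra `Pol(A, n) = Sym_A (T_A[-n-1])` of `n`-shifted polyvectors. -/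
abbrev Pol : Type _ := Presented (PolRel A n)

namespace Pol

/-- The inclusion of `A`. -/
def ofA : A.carrier →ₗ[K] Pol A n := gen (PolRel A n) ∘ₗ inA A

/-- The inclusion `D ↦ s^(n+1) D` of `T_A[-n-1]` in degree `i + n + 1`. -/
def ofT (i : ℤ) : A.der i →ₗ[K] Pol A n := gen (PolRel A n) ∘ₗ inT A i

variable {A n}

theorem mk_preA (a : A.carrier) : Presented.mk (PolRel A n) (preA A a) = ofA A n a := rfl

theorem mk_preT {i : ℤ} (D : A.der i) :
    Presented.mk (PolRel A n) (preT A i D) = ofT A n i D := rfl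

theorem ofA_one : ofA A n 1 = 1 := by
  have := Presented.mk_rel (PolRel.one (A := A) (n := n))
  rwa [map_one (Presented.mk (PolRel A n))] at this

theorem ofA_mul (a b : A.carrier) : ofA A n a * ofA A n b = ofA A n (a * b) := by
  have := Presented.mk_rel (PolRel.mul (A := A) (n := n) a b)
  rwa [map_mul] at this

theorem ofA_mul_ofT {i j : ℤ} (a : A.gr i) (D : A.der j) :
    ofA A n a * ofT A n j D = sgn K (i * (n + 1)) • ofT A n (i + j) (CDGA.derSmul a D) := by
  have := Presented.mk_rel (PolRel.smul (n := n) a D)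
  rwa [map_mul, map_smul] at this

theorem comm_A_T {i j : ℤ} (a : A.gr i) (D : A.der j) :
    ofA A n a * ofT A n j D = sgn K (i * (j + n + 1)) • (ofT A n j D * ofA A n a) := by
  have := Presented.mk_rel (PolRel.comm_A_T (n := n) a D)
  rwa [map_mul, map_smul, map_mul] at this

theorem comm_T_T {i j : ℤ} (D : A.der i) (E : A.der j) :
    ofT A n i D * ofT A n j E =
      sgn K ((i + n + 1) * (j + n + 1)) • (ofT A n j E * ofT A n i D) := by
  have := Presented.mk_rel (PolRel.comm_T_T (n := n) D E)
  rwa [map_mul, map_smul, map_mul] at this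

theorem comm_A_A {i j : ℤ} (a : A.gr i) (b : A.gr j) :
    ofA A n a * ofA A n b = sgn K (i * j) • (ofA A n b * ofA A n a) := by
  rw [ofA_mul, ofA_mul, A.comm a.2 b.2, map_smul]

theorem comm_T_A {i j : ℤ} (a : A.gr i) (D : A.der j) :
    ofT A n j D * ofA A n a = sgn K ((j + n + 1) * i) • (ofA A n a * ofT A n j D) := by
  rw [comm_A_T, smul_smul, ← sgn_add, sgn_eq (b := 0) ⟨i * (j + n + 1), by ring⟩, sgn_zero,
    one_smul]

variable (A n)

/-- The monomials `s^(n+1) D_1 ⋯ s^(n+1) D_m a` of weight `m` and degree `i`. -/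
inductive IsMono : ℕ → ℤ → Pol A n → Prop
  | ofA {i : ℤ} (a : A.gr i) : IsMono 0 i (ofA A n a)
  | cons {m : ℕ} {i j : ℤ} (D : A.der j) {x : Pol A n} (hx : IsMono m i x) :
      IsMono (m + 1) (j + n + 1 + i) (ofT A n j D * x)

/-- The polyvectors of weight `m` and degree `i`. -/
def gr (m : ℕ) (i : ℤ) : Submodule K (Pol A n) := Submodule.span K {x | IsMono A n m i x}

/-- The polyvectors of degree `i`. -/
def deg (i : ℤ) : Submodule K (Pol A n) := ⨆ m, gr A n m i

variable {A n}

theorem ofT_mul_gr {m : ℕ} {i j : ℤ} (D : A.der j) {x : Pol A n} (hx : x ∈ gr A n m i) :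
    ofT A n j D * x ∈ gr A n (m + 1) (j + n + 1 + i) := by
  induction hx using Submodule.span_induction with
  | mem x hx => exact Submodule.subset_span (.cons D hx)
  | zero => simp
  | add x y _ _ hx hy => rw [mul_add]; exact add_mem hx hy
  | smul c x _ hx => rw [mul_smul_comm]; exact Submodule.smul_mem _ _ hx

theorem ofA_mul_gr {m : ℕ} {i j : ℤ} (a : A.gr j) {x : Pol A n} (hx : x ∈ gr A n m i) :
    ofA A n a * x ∈ gr A n m (j + i) := by
  induction hx using Submodule.span_induction with
  | mem x hx =>
    induction hx with
    | ofA b => rw [ofA_mul]; exact Submodule.subset_span (.ofA ⟨_, A.mul_mem a.2 b.2⟩)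
    | @cons m i k D x hx ih =>
      rw [← mul_assoc, comm_A_T, smul_mul_assoc, mul_assoc]
      have := ofT_mul_gr D ih
      rw [show k + n + 1 + (j + i) = j + (k + n + 1 + i) by ring] at this
      exact Submodule.smul_mem _ _ this
  | zero => simp
  | add x y _ _ hx hy => rw [mul_add]; exact add_mem hx hy
  | smul c x _ hx => rw [mul_smul_comm]; exact Submodule.smul_mem _ _ hx

theorem gr_le_deg (m : ℕ) (i : ℤ) : gr A n m i ≤ deg A n i := le_iSup (fun m => gr A n m i) m

theorem ofT_mul_deg {i j : ℤ} (D : A.der j) {x : Pol A n} (hx : x ∈ deg A n i) :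
    ofT A n j D * x ∈ deg A n (j + n + 1 + i) := by
  induction hx using Submodule.iSup_induction' with
  | mem m x hx => exact gr_le_deg _ _ (ofT_mul_gr D hx)
  | zero => simp
  | add x y _ _ hx hy => rw [mul_add]; exact add_mem hx hy

theorem ofA_mul_deg {i j : ℤ} (a : A.gr j) {x : Pol A n} (hx : x ∈ deg A n i) :
    ofA A n a * x ∈ deg A n (j + i) := by
  induction hx using Submodule.iSup_induction' with
  | mem m x hx => exact gr_le_deg _ _ (ofA_mul_gr a hx)
  | zero => simp
  | add x y _ _ hx hy => rw [mul_add]; exact add_mem hx hy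

theorem ofA_mem_deg {i : ℤ} (a : A.gr i) : ofA A n a ∈ deg A n i :=
  gr_le_deg 0 i (Submodule.subset_span (.ofA a))

theorem one_mem_deg : (1 : Pol A n) ∈ deg A n 0 := by
  rw [← ofA_one]; exact ofA_mem_deg ⟨1, A.one_mem⟩

theorem ofT_mem_deg {i : ℤ} (D : A.der i) : ofT A n i D ∈ deg A n (i + n + 1) := by
  have := ofT_mul_deg (n := n) D one_mem_deg
  rwa [mul_one, add_zero] at this

theorem mul_mem_deg {i j : ℤ} {x y : Pol A n} (hx : x ∈ deg A n i) (hy : y ∈ deg A n j) :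
    x * y ∈ deg A n (i + j) := by
  induction hx using Submodule.iSup_induction' with
  | mem m x hx =>
    induction hx using Submodule.span_induction with
    | mem x hx =>
      induction hx with
      | ofA a => exact ofA_mul_deg a hy
      | cons D hx ih => rw [mul_assoc, add_assoc]; exact ofT_mul_deg D ih
    | zero => simp
    | add x x' _ _ hx hx' => rw [add_mul]; exact add_mem hx hx'
    | smul c x _ hx => rw [smul_mul_assoc]; exact Submodule.smul_mem _ _ hx
  | zero => simp
  | add x x' _ _ hx hx' => rw [add_mul]; exact add_mem hx hx'

/-- Induction on homogeneous polyvectors. -/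
theorem deg_induction {C : ∀ i x, x ∈ deg A n i → Prop}
    (ofA : ∀ i (a : A.gr i), C i (ofA A n a) (ofA_mem_deg a))
    (zero : ∀ i, C i 0 (zero_mem _))
    (add : ∀ i x y hx hy, C i x hx → C i y hy → C i (x + y) (add_mem hx hy))
    (smul : ∀ i (c : K) x hx, C i x hx → C i (c • x) (Submodule.smul_mem _ c hx))
    (ofT_mul : ∀ i j (D : A.der j) x hx, C i x hx →
      C (j + n + 1 + i) (ofT A n j D * x) (ofT_mul_deg D hx))
    {i : ℤ} {x : Pol A n} (hx : x ∈ deg A n i) : C i x hx := by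
  induction hx using Submodule.iSup_induction' with
  | mem m x hx =>
    induction hx using Submodule.span_induction with
    | mem x hx =>
      induction hx with
      | ofA a => exact ofA _ a
      | cons D hx ih => exact ofT_mul _ _ D _ (gr_le_deg _ _ (Submodule.subset_span hx)) ih
    | zero => exact zero i
    | add x y _ _ hx hy => exact add _ _ _ _ _ hx hy
    | smul c x _ hx => exact smul _ _ _ _ hx
  | zero => exact zero i
  | add x y _ _ hx hy => exact add _ _ _ _ _ hx hy

theorem ofA_comm {i j : ℤ} (a : A.gr i) {x : Pol A n} (hx : x ∈ deg A n j) :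
    ofA A n a * x = sgn K (i * j) • (x * ofA A n a) := by
  induction hx using deg_induction with
  | ofA j b => exact comm_A_A a b
  | zero j => simp
  | add j x y _ _ hx hy => rw [mul_add (_ : Pol A n), hx, hy, add_mul x y, smul_add]
  | smul j c x _ hx => rw [mul_smul_comm, hx, smul_mul_assoc, smul_comm]
  | ofT_mul j k D x _ hx =>
    rw [← mul_assoc, comm_A_T, smul_mul_assoc, mul_assoc, hx, mul_smul_comm, smul_smul,
      ← sgn_add, ← mul_add, mul_assoc]

theorem ofT_comm {i j : ℤ} (D : A.der i) {x : Pol A n} (hx : x ∈ deg A n j) :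
    ofT A n i D * x = sgn K ((i + n + 1) * j) • (x * ofT A n i D) := by
  induction hx using deg_induction with
  | ofA j b => exact comm_T_A b D
  | zero j => simp
  | add j x y _ _ hx hy => rw [mul_add (_ : Pol A n), hx, hy, add_mul x y, smul_add]
  | smul j c x _ hx => rw [mul_smul_comm, hx, smul_mul_assoc, smul_comm]
  | ofT_mul j k E x _ hx =>
    rw [← mul_assoc, comm_T_T, smul_mul_assoc, mul_assoc, hx, mul_smul_comm, smul_smul,
      ← sgn_add, ← mul_add, mul_assoc]

theorem smul_sgn_comm {x y : Pol A n} {a b : ℤ} (h : x = sgn K a • y) (hab : Even (a - b)) :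
    y = sgn K b • x := by
  rw [h, smul_smul, ← sgn_add, sgn_eq (b := 0), sgn_zero, one_smul]
  obtain ⟨c, hc⟩ := hab
  exact ⟨b + c, by linear_combination hc⟩

/-- A linear map on generators. -/
def genMap {X : Type*} [AddCommMonoid X] [Module K X] (φ : A.carrier →ₗ[K] X)
    (ψ : ∀ i, A.der i →ₗ[K] X) : PolGen A →ₗ[K] X :=
  LinearMap.coprod φ (DirectSum.toModule K ℤ X ψ)

theorem genMap_A {X : Type*} [AddCommMonoid X] [Module K X] (φ : A.carrier →ₗ[K] X)
    (ψ : ∀ i, A.der i →ₗ[K] X) (a : A.carrier) : genMap φ ψ (inA A a) = φ a := by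
  simp [genMap, inA]

theorem genMap_T {X : Type*} [AddCommMonoid X] [Module K X] (φ : A.carrier →ₗ[K] X)
    (ψ : ∀ i, A.der i →ₗ[K] X) {i : ℤ} (D : A.der i) :
    genMap φ ψ (inT A i D) = ψ i D := by
  simp [genMap, inT, DirectSum.toModule_lof]

theorem gen_ext {X : Type*} [AddCommMonoid X] [Module K X] {F G : PolGen A →ₗ[K] X}
    (hA : ∀ i (a : A.gr i), F (inA A a) = G (inA A a))
    (hT : ∀ i (D : A.der i), F (inT A i D) = G (inT A i D)) : F = G := by
  refine LinearMap.prod_ext (hom_ext_of_internal A.isInternal fun i a ha => hA i ⟨a, ha⟩) ?_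
  refine DirectSum.linearMap_ext K fun i => LinearMap.ext fun D => hT i D

variable (A n)

/-- The sign twist of degree `p` on generators. -/
def twist (p : ℤ) : PolGen A →ₗ[K] Pol A n :=
  genMap (ofA A n ∘ₗ signOp A.isInternal p) fun i => sgn K (p * (i + n + 1)) • ofT A n i

/-- Values on generators of a derivation of degree `p` of the algebra of polyvectors. -/
structure DerData (p : ℤ) where
  φ : A.carrier →ₗ[K] Pol A n
  ψ : ∀ i, A.der i →ₗ[K] Pol A n
  φ_deg : ∀ i (a : A.gr i), φ a ∈ deg A n (i + p)
  ψ_deg : ∀ i (D : A.der i), ψ i D ∈ deg A n (i + n + 1 + p)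
  φ_one : φ 1 = 0
  φ_mul : ∀ {i} (a : A.gr i) (b : A.carrier),
    φ (a * b) = φ a * ofA A n b + sgn K (p * i) • (ofA A n a * φ b)
  ψ_smul : ∀ {i j} (a : A.gr i) (D : A.der j),
    sgn K (i * (n + 1)) • ψ (i + j) (CDGA.derSmul a D) =
      φ a * ofT A n j D + sgn K (p * i) • (ofA A n a * ψ j D)

namespace DerData
variable {A n} {p : ℤ} (δ : DerData A n p)

theorem twist_A {i : ℤ} (a : A.gr i) :
    twist A n p (inA A a) = sgn K (p * i) • ofA A n a := by
  rw [twist, genMap_A, LinearMap.comp_apply, signOp_of_mem _ _ a.2, map_smul]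

theorem twist_T {i : ℤ} (D : A.der i) :
    twist A n p (inT A i D) = sgn K (p * (i + n + 1)) • ofT A n i D := by
  rw [twist, genMap_T, LinearMap.smul_apply]

theorem mat_A {i : ℤ} (a : A.gr i) :
    twistedMat (twist A n p) (genMap δ.φ δ.ψ) (preA A a) =
      !![sgn K (p * i) • ofA A n a, δ.φ a; 0, ofA A n a] := by
  refine (twistedMat_ι _ _ _).trans ?_
  rw [twist_A, genMap_A]
  rfl

theorem mat_T {i : ℤ} (D : A.der i) :
    twistedMat (twist A n p) (genMap δ.φ δ.ψ) (preT A i D) =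
      !![sgn K (p * (i + n + 1)) • ofT A n i D, δ.ψ i D; 0, ofT A n i D] := by
  refine (twistedMat_ι _ _ _).trans ?_
  rw [twist_T, genMap_T]
  rfl

theorem mat_ext {R : Type*} {a b c d a' b' c' d' : R} (h1 : a = a') (h2 : b = b') (h3 : c = c')
    (h4 : d = d') : !![a, b; c, d] = !![a', b'; c', d'] := by
  rw [h1, h2, h3, h4]

theorem smul_mat (c : K) (a b d e : Pol A n) :
    c • !![a, b; d, e] = !![c • a, c • b; c • d, c • e] := by
  ext i j; fin_cases i <;> fin_cases j <;> simp

theorem rel_mul {i j : ℤ} (a : A.gr i) (b : A.gr j) :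
    twistedMat (twist A n p) (genMap δ.φ δ.ψ) (preA A a * preA A b) =
      twistedMat (twist A n p) (genMap δ.φ δ.ψ) (preA A (a * b)) := by
  have h := δ.mat_A (⟨_, A.mul_mem a.2 b.2⟩ : A.gr (i + j))
  dsimp only at h
  rw [map_mul, δ.mat_A, δ.mat_A, h, Matrix.mul_fin_two, δ.φ_mul a b]
  refine mat_ext ?_ ?_ (by simp) (by simp [ofA_mul])
  · simp only [smul_mul_assoc, mul_smul_comm, smul_smul, ofA_mul, mul_zero, add_zero, mul_add,
      sgn_add]
    rw [mul_comm]
  · rw [smul_mul_assoc, add_comm]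

theorem rel_comm {i j : ℤ} {u v u' v' : Pol A n} (h : u * v = sgn K (i * j) • (v * u))
    (hu : u' * v = sgn K ((i + p) * j) • (v * u')) (hv : u * v' = sgn K (i * (j + p)) • (v' * u)) :
    !![sgn K (p * i) • u, u'; 0, u] * !![sgn K (p * j) • v, v'; 0, v] =
      sgn K (i * j) • (!![sgn K (p * j) • v, v'; 0, v] * !![sgn K (p * i) • u, u'; 0, u]) := by
  rw [Matrix.mul_fin_two, Matrix.mul_fin_two, smul_mat]
  refine mat_ext ?_ ?_ ?_ ?_
  · rw [mul_zero, add_zero, mul_zero, add_zero, smul_mul_assoc, mul_smul_comm, h, smul_mul_assoc,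
      mul_smul_comm]
    simp only [smul_smul]
    congr 1; ring
  · rw [smul_mul_assoc, smul_mul_assoc, hu, hv, smul_add, smul_smul, smul_smul, ← sgn_add,
      ← sgn_add, add_comm]
    congr 2
    · exact sgn_eq ⟨0, by ring⟩
    · exact sgn_eq ⟨p * i, by ring⟩
  · rw [zero_mul, mul_zero, zero_mul, mul_zero, add_zero, smul_zero]
  · rw [zero_mul, zero_mul, zero_add, zero_add, h]

theorem rel_A_T {i j : ℤ} (a : A.gr i) (D : A.der j) :
    twistedMat (twist A n p) (genMap δ.φ δ.ψ) (preA A a * preT A j D) =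
      twistedMat (twist A n p) (genMap δ.φ δ.ψ)
        (sgn K (i * (j + n + 1)) • (preT A j D * preA A a)) := by
  rw [map_mul, map_smul, map_mul, δ.mat_A, δ.mat_T]
  exact rel_comm (comm_A_T a D)
    (smul_sgn_comm (ofT_comm D (δ.φ_deg i a)) ⟨0, by ring⟩) (ofA_comm a (δ.ψ_deg j D))

theorem rel_T_T {i j : ℤ} (D : A.der i) (E : A.der j) :
    twistedMat (twist A n p) (genMap δ.φ δ.ψ) (preT A i D * preT A j E) =
      twistedMat (twist A n p) (genMap δ.φ δ.ψ)
        (sgn K ((i + n + 1) * (j + n + 1)) • (preT A j E * preT A i D)) := by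
  rw [map_mul, map_smul, map_mul, δ.mat_T, δ.mat_T]
  exact rel_comm (comm_T_T D E)
    (smul_sgn_comm (ofT_comm E (δ.ψ_deg i D)) ⟨0, by ring⟩) (ofT_comm D (δ.ψ_deg j E))

theorem rel ⦃x y⦄ (h : PolRel A n x y) :
    twistedMat (twist A n p) (genMap δ.φ δ.ψ) x = twistedMat (twist A n p) (genMap δ.φ δ.ψ) y := by
  induction h with
  | one =>
    have := δ.mat_A ⟨1, A.one_mem⟩
    dsimp only at this
    rw [this, map_one (twistedMat _ _), ofA_one, δ.φ_one, mul_zero, sgn_zero, one_smul,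
      Matrix.one_fin_two]
  | mul a b =>
    suffices h : ∀ a b : A.carrier, twistedMat (twist A n p) (genMap δ.φ δ.ψ) (preA A a) *
        twistedMat (twist A n p) (genMap δ.φ δ.ψ) (preA A b) =
        twistedMat (twist A n p) (genMap δ.φ δ.ψ) (preA A (a * b)) by rw [map_mul, h]
    intro a b
    have ha : a ∈ ⨆ i, A.gr i := by rw [A.isInternal.submodule_iSup_eq_top]; trivial
    have hb : b ∈ ⨆ i, A.gr i := by rw [A.isInternal.submodule_iSup_eq_top]; trivial
    induction ha using Submodule.iSup_induction' with
    | mem i a ha =>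
      induction hb using Submodule.iSup_induction' with
      | mem j b hb => simpa only [map_mul] using δ.rel_mul ⟨a, ha⟩ ⟨b, hb⟩
      | zero => simp
      | add x y _ _ hx hy => simp only [map_add, mul_add, hx, hy]
    | zero => simp
    | add x y _ _ hx hy => simp only [map_add, add_mul, hx, hy]
  | @smul i j a D =>
    rw [map_mul, map_smul, δ.mat_A, δ.mat_T, δ.mat_T, Matrix.mul_fin_two, smul_mat]
    refine mat_ext ?_ ?_ (by simp) (by simp [ofA_mul_ofT])
    · rw [mul_zero, add_zero, smul_mul_assoc, mul_smul_comm, ofA_mul_ofT]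
      simp only [smul_smul, ← sgn_add]
      congr 2; ring
    · rw [δ.ψ_smul, smul_mul_assoc, add_comm]
  | comm_A_T a D => exact δ.rel_A_T a D
  | comm_T_T D E => exact δ.rel_T_T D E

/-- The derivation of degree `p` with the given values on generators. -/
def toMap : Pol A n →ₗ[K] Pol A n := twistedDer (twist A n p) (genMap δ.φ δ.ψ) δ.rel

theorem toMap_ofA (a : A.carrier) : δ.toMap (ofA A n a) = δ.φ a :=
  (twistedDer_gen _ _ _ _).trans (genMap_A _ _ a)

theorem toMap_ofT_mul {i : ℤ} (D : A.der i) (x : Pol A n) :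
    δ.toMap (ofT A n i D * x) =
      δ.ψ i D * x + sgn K (p * (i + n + 1)) • (ofT A n i D * δ.toMap x) := by
  refine (twistedDer_gen_mul _ _ _ _ x).trans ?_
  rw [genMap_T, twist_T, smul_mul_assoc]
  rfl

theorem toMap_mem {i : ℤ} {x : Pol A n} (hx : x ∈ deg A n i) : δ.toMap x ∈ deg A n (i + p) := by
  induction hx using deg_induction with
  | ofA i a => rw [toMap_ofA]; exact δ.φ_deg i a
  | zero i => simp
  | add i x y _ _ hx hy => rw [map_add]; exact add_mem hx hy
  | smul i c x _ hx => rw [map_smul]; exact Submodule.smul_mem _ _ hx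
  | ofT_mul i j D x hx0 hx =>
    rw [toMap_ofT_mul]
    refine add_mem ?_ (Submodule.smul_mem _ _ ?_)
    · have := mul_mem_deg (δ.ψ_deg j D) hx0
      rwa [show j + n + 1 + p + i = j + n + 1 + i + p by ring] at this
    · rw [add_assoc (j + n + 1)]; exact ofT_mul_deg D hx

theorem toMap_one : δ.toMap 1 = 0 := twistedDer_one _ _ _

/-- Leibniz rule. -/
theorem toMap_mul {i : ℤ} {x : Pol A n} (hx : x ∈ deg A n i) (y : Pol A n) :
    δ.toMap (x * y) = δ.toMap x * y + sgn K (p * i) • (x * δ.toMap y) := by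
  induction hx using deg_induction with
  | ofA i a =>
    rw [toMap_ofA]
    refine (twistedDer_gen_mul _ _ _ _ y).trans ?_
    rw [genMap_A, twist_A, smul_mul_assoc]
    rfl
  | zero i => simp
  | add i x x' _ _ hx hx' => simp only [add_mul, map_add, hx, hx', smul_add]; abel
  | smul i c x _ hx => simp only [smul_mul_assoc, map_smul, hx, smul_add, smul_comm c]
  | ofT_mul i j D x _ hx =>
    rw [mul_assoc, toMap_ofT_mul, toMap_ofT_mul, hx]
    simp only [add_mul, mul_add, smul_mul_assoc, mul_smul_comm, smul_smul, smul_add, mul_assoc,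
      sgn_add]
    abel

theorem toMap_comb {p₁ p₂ d₁ d₂ : ℤ} (δ₁ : DerData A n p₁) (δ₂ : DerData A n p₂) {u v : Pol A n}
    (hu : u ∈ deg A n d₁) (hv : v ∈ deg A n d₂) (h₁ : Even (p₁ + d₁ - p))
    (h₂ : Even (p₂ + d₂ - p))
    (hA : ∀ i (a : A.gr i), δ.φ a = u * δ₁.φ a + v * δ₂.φ a)
    (hT : ∀ i (D : A.der i), δ.ψ i D = u * δ₁.ψ i D + v * δ₂.ψ i D) (x : Pol A n) :
    δ.toMap x = u * δ₁.toMap x + v * δ₂.toMap x := by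
  have key : ∀ {q d : ℤ} {w : Pol A n}, w ∈ deg A n d → Even (q + d - p) →
      LinearMap.mulLeft K w ∘ₗ twist A n q = LinearMap.mulRight K w ∘ₗ twist A n p := by
    intro q d w hw h
    refine gen_ext (fun i a => ?_) fun i D => ?_
    · simp only [LinearMap.comp_apply, LinearMap.mulLeft_apply, LinearMap.mulRight_apply, twist_A]
      rw [mul_smul_comm, smul_mul_assoc, ofA_comm a hw, smul_smul, ← sgn_add]
      obtain ⟨c, hc⟩ := h
      exact congrArg (· • _) (sgn_eq ⟨i * c - i * d, by linear_combination i * hc⟩)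
    · simp only [LinearMap.comp_apply, LinearMap.mulLeft_apply, LinearMap.mulRight_apply, twist_T]
      rw [mul_smul_comm, smul_mul_assoc, ofT_comm D hw, smul_smul, ← sgn_add]
      obtain ⟨c, hc⟩ := h
      exact congrArg (· • _) (sgn_eq ⟨(i + n + 1) * (c - d), by
        linear_combination (i + n + 1) * hc⟩)
  have hf : genMap δ.φ δ.ψ = LinearMap.mulLeft K u ∘ₗ genMap δ₁.φ δ₁.ψ +
      LinearMap.mulLeft K v ∘ₗ genMap δ₂.φ δ₂.ψ := by
    refine gen_ext (fun i a => ?_) fun i D => ?_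
    · simpa [genMap_A] using hA i a
    · simpa [genMap_T] using hT i D
  induction x using presented_induction with
  | h1 => simp [toMap_one]
  | hadd x y hx hy => simp only [map_add, hx, hy, mul_add]; abel
  | hsmul c x hx => simp only [map_smul, hx, mul_smul_comm, smul_add]
  | hmul m x hx =>
    have e0 : δ.toMap (gen _ m * x) = _ := twistedDer_gen_mul _ _ _ m x
    have e1 : δ₁.toMap (gen _ m * x) = _ := twistedDer_gen_mul _ _ _ m x
    have e2 : δ₂.toMap (gen _ m * x) = _ := twistedDer_gen_mul _ _ _ m x
    have k1 : u * twist A n p₁ m = twist A n p m * u := LinearMap.congr_fun (key hu h₁) m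
    have k2 : v * twist A n p₂ m = twist A n p m * v := LinearMap.congr_fun (key hv h₂) m
    have hm : genMap δ.φ δ.ψ m = u * genMap δ₁.φ δ₁.ψ m + v * genMap δ₂.φ δ₂.ψ m :=
      LinearMap.congr_fun hf m
    change _ = genMap δ.φ δ.ψ m * x + twist A n p m * δ.toMap x at e0
    change _ = genMap δ₁.φ δ₁.ψ m * x + twist A n p₁ m * δ₁.toMap x at e1
    change _ = genMap δ₂.φ δ₂.ψ m * x + twist A n p₂ m * δ₂.toMap x at e2
    rw [e0, e1, e2, hm, hx]
    simp only [mul_add, add_mul, ← mul_assoc, k1, k2]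
    abel

end DerData

variable {A n}

theorem ofT_lin {i j k : ℤ} (hi : i = k) (hj : j = k) {F : A.der k} {D : A.der i} {E : A.der j}
    (c e : K) (h : (F : A.carrier →ₗ[K] A.carrier) = c • (D : A.carrier →ₗ[K] A.carrier) +
      e • (E : A.carrier →ₗ[K] A.carrier)) :
    ofT A n k F = c • ofT A n i D + e • ofT A n j E := by
  subst hi hj
  rw [← map_smul, ← map_smul, ← map_add]
  congr 1
  exact Subtype.ext h

variable (A n)

theorem sgn_smul_congr {X : Type*} [AddCommMonoid X] [Module K X] {a b : ℤ} (h : Even (a - b))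
    (x : X) : sgn K a • x = sgn K b • x := by rw [sgn_eq h]

theorem mul_neg_smul {A : CDGA K} {n : ℤ} (c : K) (x y : Pol A n) :
    x * -(c • y) = -(c • (x * y)) :=
  (mul_neg x _).trans (congrArg Neg.neg (mul_smul_comm c x y))

theorem neg_smul_pol {A : CDGA K} {n : ℤ} (c : K) (x : Pol A n) : -c • x = -(c • x) := by
  rw [Algebra.smul_def, Algebra.smul_def, map_neg]
  exact neg_mul (algebraMap K (Pol A n) c) x

theorem neg_smul_mul {A : CDGA K} {n : ℤ} (c : K) (x y : Pol A n) :
    -(c • x) * y = -(c • (x * y)) :=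
  (neg_mul _ y).trans (congrArg Neg.neg (smul_mul_assoc c x y))

/-- The values on generators of the differential of `Pol(A, n)`: it is `d` on `A` and
`s^(n+1) D ↦ (-1)^(n+1) s^(n+1) ∂ D` on `T_A[-n-1]`. -/
def diffData : DerData A n 1 where
  φ := ofA A n ∘ₗ A.d
  ψ i := sgn K (n + 1) • (ofT A n (i + 1) ∘ₗ CDGA.derDiff i)
  φ_deg i a := ofA_mem_deg ⟨_, A.d_mem a.2⟩
  ψ_deg i D := by
    have := ofT_mem_deg (n := n) (CDGA.derDiff i D)
    rw [show i + 1 + n + 1 = i + n + 1 + 1 by ring] at this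
    exact Submodule.smul_mem _ _ this
  φ_one := by
    have := A.leibniz A.one_mem 1
    simp [sgn_zero] at this
    simp [this]
  φ_mul {i} a b := by
    simp only [LinearMap.comp_apply, A.leibniz a.2, map_add, map_smul, ofA_mul, one_mul]
  ψ_smul {i j} a D := by
    have h1 := ofA_mul_ofT (n := n) ⟨_, A.d_mem a.2⟩ D
    have h2 := ofA_mul_ofT (n := n) a (CDGA.derDiff j D)
    have h3 := ofT_lin (n := n) (by ring) (by ring) (F := CDGA.derDiff _ (CDGA.derSmul a D))
      (D := CDGA.derSmul ⟨_, A.d_mem a.2⟩ D) (E := CDGA.derSmul a (CDGA.derDiff j D))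
      1 (sgn K i) (by
        ext b
        simp [CDGA.derDiff, CDGA.derSmul, A.leibniz a.2, mul_sub, smul_sub, sgn_add, smul_smul]
        abel)
    dsimp only at h1
    simp only [LinearMap.smul_apply, LinearMap.comp_apply, mul_smul_comm, h1, h2, h3, smul_smul,
      smul_add, ← sgn_add, one_mul, mul_one]
    congr 2
    · exact sgn_eq ⟨0, by ring⟩
    · exact sgn_eq ⟨0, by ring⟩

/-- The differential of `Pol(A, n)`. -/
def diff : Pol A n →ₗ[K] Pol A n := (diffData A n).toMap

variable {A}

/-- The values on generators of `{a, -}` for `a` in `A` (shifts omitted): `{a, b} = 0` and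
`{a, s^(n+1) D} = -(-1)^(|a||D|) D(a)`, the antisymmetric counterpart of `bracketTData`. -/
def bracketAData {i : ℤ} (a : A.gr i) : DerData A n (i - n - 1) where
  φ := 0
  ψ j := -(sgn K (i * j) • (ofA A n ∘ₗ LinearMap.applyₗ (a : A.carrier) ∘ₗ (A.der j).subtype))
  φ_deg j b := zero_mem _
  ψ_deg j D := by
    have := ofA_mem_deg (n := n) ⟨_, D.2.1 i a a.2⟩
    dsimp only at this
    rw [show i + j = j + n + 1 + (i - n - 1) by ring] at this
    exact neg_mem (Submodule.smul_mem _ _ this)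
  φ_one := rfl
  φ_mul _ _ := by simp
  ψ_smul {k j} b D := by
    simp [CDGA.derSmul, ← ofA_mul, smul_smul, ← sgn_add]
    exact sgn_smul_congr ⟨k * (n + 1), by ring⟩ _

/-- The values on generators of `{s^(n+1) D, -}` (shifts omitted):
`{s^(n+1) D, a} = (-1)^(|D|(n+1)) D(a)` and `{s^(n+1) D, s^(n+1) E} = s^(n+1) [D, E]`. -/
def bracketTData {i : ℤ} (D : A.der i) : DerData A n i where
  φ := sgn K (i * (n + 1)) • (ofA A n ∘ₗ (D : A.carrier →ₗ[K] A.carrier))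
  ψ j := ofT A n (i + j) ∘ₗ
    { toFun := CDGA.derBracket D
      map_add' := fun E F => by ext a; simp [CDGA.derBracket]; abel
      map_smul' := fun c E => by ext a; simp [CDGA.derBracket, smul_sub, smul_comm c] }
  φ_deg j a := Submodule.smul_mem _ _ (ofA_mem_deg ⟨_, D.2.1 j a a.2⟩)
  ψ_deg j E := by
    have := ofT_mem_deg (n := n) (CDGA.derBracket D E)
    rwa [show i + j + n + 1 = j + n + 1 + i by ring] at this
  φ_one := by simp [CDGA.der_map_one]
  φ_mul {j} a b := by
    simp only [LinearMap.smul_apply, LinearMap.comp_apply, D.2.2 j a a.2, map_add, map_smul,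
      ofA_mul, smul_add, smul_mul_assoc, mul_smul_comm]
    rw [smul_comm]
  ψ_smul {k j} a E := by
    have h1 := ofA_mul_ofT (n := n) ⟨_, D.2.1 k a a.2⟩ E
    have h2 := ofA_mul_ofT (n := n) a (CDGA.derBracket D E)
    have h3 := ofT_lin (n := n) (by ring) (by ring)
      (F := CDGA.derBracket D (CDGA.derSmul a E))
      (D := CDGA.derSmul ⟨_, D.2.1 k a a.2⟩ E) (E := CDGA.derSmul a (CDGA.derBracket D E))
      1 (sgn K (i * k)) (by
        ext b
        simp [CDGA.derBracket, CDGA.derSmul, D.2.2 k a a.2, mul_sub, smul_sub, smul_smul,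
          ← sgn_add, mul_add]
        abel)
    dsimp only at h1
    simp only [LinearMap.smul_apply, LinearMap.comp_apply, LinearMap.coe_mk, AddHom.coe_mk,
      smul_mul_assoc, h1, h2, h3, smul_smul, smul_add, ← sgn_add, mul_one]
    congr 2
    · exact sgn_eq ⟨-(i * (n + 1)), by ring⟩
    · exact sgn_eq ⟨0, by ring⟩

/-- The bracket `{a, -}` for `a` in `A`. -/
def bracketA {i : ℤ} (a : A.gr i) : Pol A n →ₗ[K] Pol A n := (bracketAData n a).toMap

/-- The bracket `{s^(n+1) D, -}` for a derivation `D`. -/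
def bracketT {i : ℤ} (D : A.der i) : Pol A n →ₗ[K] Pol A n := (bracketTData n D).toMap

variable {n}

theorem algebraMap_mem_deg (c : K) : algebraMap K (Pol A n) c ∈ deg A n 0 := by
  rw [Algebra.algebraMap_eq_smul_one]
  exact Submodule.smul_mem _ _ one_mem_deg

theorem bracketA_lin {i : ℤ} (c e : K) (a b : A.gr i) (x : Pol A n) :
    bracketA n (c • a + e • b) x = c • bracketA n a x + e • bracketA n b x := by
  rw [Algebra.smul_def, Algebra.smul_def]
  refine DerData.toMap_comb _ _ _ (algebraMap_mem_deg c) (algebraMap_mem_deg e) (by simp) (by simp)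
    (fun j d => ?_) (fun j D => ?_) x
  · simp [bracketAData]
  · simp [bracketAData, ← Algebra.smul_def, smul_comm _ c, smul_comm _ e]
    abel

theorem bracketT_lin {i : ℤ} (c e : K) (D E : A.der i) (x : Pol A n) :
    bracketT n (c • D + e • E) x = c • bracketT n D x + e • bracketT n E x := by
  rw [Algebra.smul_def, Algebra.smul_def]
  refine DerData.toMap_comb _ _ _ (algebraMap_mem_deg c) (algebraMap_mem_deg e) (by simp) (by simp)
    (fun j d => ?_) (fun j F => ?_) x
  · simp [bracketTData, ← Algebra.smul_def, smul_comm _ c, smul_comm _ e]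
  · rw [← Algebra.smul_def, ← Algebra.smul_def]
    refine ofT_lin rfl rfl c e ?_
    ext b
    simp [CDGA.derBracket, smul_sub, smul_comm c, smul_comm e]
    abel

theorem bracketA_one (x : Pol A n) : bracketA n ⟨1, A.one_mem⟩ x = 0 := by
  have := DerData.toMap_comb (bracketAData n ⟨1, A.one_mem⟩) (bracketAData n ⟨1, A.one_mem⟩)
    (bracketAData n ⟨1, A.one_mem⟩) (zero_mem (deg A n 0)) (zero_mem (deg A n 0)) (by simp)
    (by simp) (fun j d => by simp [bracketAData])
    (fun j D => by simp [bracketAData, CDGA.der_map_one]) x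
  simpa [bracketA] using this

theorem bracketA_mul {i j : ℤ} (a : A.gr i) (b : A.gr j) (x : Pol A n) :
    bracketA n (⟨_, A.mul_mem a.2 b.2⟩ : A.gr (i + j)) x =
      ofA A n a * bracketA n b x + sgn K (i * j) • (ofA A n b * bracketA n a x) := by
  rw [← smul_mul_assoc]
  refine DerData.toMap_comb _ _ _ (ofA_mem_deg a) (Submodule.smul_mem _ _ (ofA_mem_deg b))
    ⟨0, by ring⟩ ⟨0, by ring⟩ (fun k d => by simp [bracketAData]) (fun k D => ?_) x
  simp only [bracketAData, LinearMap.neg_apply, LinearMap.smul_apply, LinearMap.comp_apply,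
    Submodule.subtype_apply, LinearMap.applyₗ_apply_apply, D.2.2 i a a.2, map_add, map_smul,
    smul_mul_assoc, ← ofA_mul]
  have h1 : ofA A n (D.1 a) * ofA A n b =
      sgn K ((i + k) * j) • (ofA A n b * ofA A n (D.1 a)) :=
    comm_A_A ⟨_, D.2.1 i a a.2⟩ b
  rw [h1]
  simp only [smul_add, smul_smul, ← sgn_add, neg_add, mul_neg_smul, smul_neg]
  rw [add_comm]
  exact congrArg₂ (· + ·) (congrArg Neg.neg (sgn_smul_congr ⟨k * i, by ring⟩ _))
    (congrArg Neg.neg (sgn_smul_congr ⟨j * k, by ring⟩ _))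

theorem bracketT_smul {i j : ℤ} (a : A.gr i) (D : A.der j) (x : Pol A n) :
    sgn K (i * (n + 1)) • bracketT n (CDGA.derSmul a D) x =
      ofA A n a * bracketT n D x +
        sgn K (i * (j + n + 1)) • (ofT A n j D * bracketA n a x) := by
  suffices h : bracketT n (CDGA.derSmul a D) x =
      (sgn K (i * (n + 1)) • ofA A n a) * bracketT n D x +
        (sgn K (i * (n + 1) + i * (j + n + 1)) • ofT A n j D) * bracketA n a x by
    rw [h]
    simp only [smul_mul_assoc, smul_add, smul_smul, ← sgn_add]
    congr 1
    · rw [sgn_eq (b := 0) ⟨i * (n + 1), by ring⟩, sgn_zero, one_smul]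
    · exact congrArg (· • _) (sgn_eq ⟨i * (n + 1), by ring⟩)
  refine DerData.toMap_comb _ _ _ (Submodule.smul_mem _ _ (ofA_mem_deg a))
    (Submodule.smul_mem _ _ (ofT_mem_deg D)) ⟨0, by ring⟩ ⟨0, by ring⟩ (fun k d => ?_)
    (fun k E => ?_) x
  · simp [bracketTData, bracketAData, CDGA.derSmul, ← ofA_mul, smul_smul, ← sgn_add]
    exact congrArg (· • _) (sgn_eq ⟨0, by ring⟩)
  · let Ea : A.gr (i + k) := ⟨E.1 a, E.2.1 i a a.2⟩
    have h1 := ofA_mul_ofT (n := n) a (CDGA.derBracket D E)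
    have h2 := ofA_mul_ofT (n := n) Ea D
    have h2' : ofT A n j D * ofA A n (E.1 a) = _ := ofT_comm D (ofA_mem_deg (n := n) Ea)
    have h3 := ofT_lin (n := n) (by ring) (by ring)
      (F := CDGA.derBracket (CDGA.derSmul a D) E)
      (D := CDGA.derSmul a (CDGA.derBracket D E)) (E := CDGA.derSmul Ea D)
      1 (-sgn K ((i + j) * k)) (by
        ext b
        simp [CDGA.derBracket, CDGA.derSmul, E.2.2 i a a.2, mul_sub, smul_smul, ← sgn_add]
        rw [sgn_smul_congr (a := (i + j) * k + k * i) (b := j * k) ⟨k * i, by ring⟩]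
        abel)
    have e0 : (bracketTData n (CDGA.derSmul a D)).ψ k E =
      ofT A n (i + j + k) (CDGA.derBracket (CDGA.derSmul a D) E) := rfl
    have e1 : (bracketTData n D).ψ k E = ofT A n (j + k) (CDGA.derBracket D E) := rfl
    have e2 : (bracketAData n a).ψ k E = -(sgn K (i * k) • ofA A n (E.1 a)) := rfl
    have h2'' := h2'.trans (congrArg (sgn K ((j + n + 1) * (i + k)) • ·) h2)
    simp only [smul_smul, ← sgn_add] at h2''
    rw [e0, e1, e2, h3]
    rw [smul_mul_assoc, h1, smul_mul_assoc, mul_neg_smul, h2'', smul_neg, smul_smul, smul_smul,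
      smul_smul, ← sgn_add, ← sgn_add, ← sgn_add]
    refine congrArg₂ (· + ·) ?_ ((neg_smul_pol _ _).trans (congrArg Neg.neg ?_))
    · rw [← sgn_zero (K := K)]
      exact sgn_smul_congr ⟨-(i * (n + 1)), by ring⟩ _
    · exact sgn_smul_congr ⟨-(2 * i * (n + 1) + i * j + (n + 1) * k), by ring⟩ _

variable (n)

/-- The map `a ↦ {a, P}`. -/
def bracketALeft (P : Pol A n) (i : ℤ) : A.gr i →ₗ[K] Pol A n where
  toFun a := bracketA n a P
  map_add' a b := by simpa using bracketA_lin 1 1 a b P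
  map_smul' c a := by simpa using bracketA_lin c 0 a a P

/-- The map `D ↦ {s^(n+1) D, P}`. -/
def bracketTLeft (P : Pol A n) (i : ℤ) : A.der i →ₗ[K] Pol A n where
  toFun D := bracketT n D P
  map_add' D E := by simpa using bracketT_lin 1 1 D E P
  map_smul' c D := by simpa using bracketT_lin c 0 D D P

/-- The values on `A` of the bracket `{P, -}`. -/
def schoutenA (k : ℤ) (P : Pol A n) : A.carrier →ₗ[K] Pol A n :=
  gradedMap A.isInternal fun i => -(sgn K ((k - n - 1) * (i - n - 1)) • bracketALeft n P i)

/-- The values on derivations of the bracket `{P, -}`. -/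
def schoutenT (k : ℤ) (P : Pol A n) (i : ℤ) : A.der i →ₗ[K] Pol A n :=
  -(sgn K ((k - n - 1) * i) • bracketTLeft n P i)

theorem schoutenA_of_mem (k : ℤ) (P : Pol A n) {i : ℤ} (a : A.gr i) :
    schoutenA n k P a = -(sgn K ((k - n - 1) * (i - n - 1)) • bracketA n a P) :=
  gradedMap_of_mem _ _ a.2

theorem schoutenT_apply (k : ℤ) (P : Pol A n) {i : ℤ} (D : A.der i) :
    schoutenT n k P i D = -(sgn K ((k - n - 1) * i) • bracketT n D P) := rfl

theorem bracketA_mem {i k : ℤ} (a : A.gr i) {P : Pol A n} (hP : P ∈ deg A n k) :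
    bracketA n a P ∈ deg A n (k + (i - n - 1)) := DerData.toMap_mem _ hP

theorem bracketT_mem {i k : ℤ} (D : A.der i) {P : Pol A n} (hP : P ∈ deg A n k) :
    bracketT n D P ∈ deg A n (k + i) := DerData.toMap_mem _ hP

theorem schoutenA_mul {k i j : ℤ} {P : Pol A n} (hP : P ∈ deg A n k) (a : A.gr i) (b : A.gr j) :
    schoutenA n k P (a * b) = schoutenA n k P a * ofA A n b +
      sgn K ((k - n - 1) * i) • (ofA A n a * schoutenA n k P b) := by
  have h := schoutenA_of_mem n k P (⟨_, A.mul_mem a.2 b.2⟩ : A.gr (i + j))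
  rw [h, schoutenA_of_mem, schoutenA_of_mem, bracketA_mul, ofA_comm b (bracketA_mem n a hP),
    smul_add, neg_add, add_comm, smul_smul, smul_smul, ← sgn_add, ← sgn_add, mul_neg_smul,
    smul_neg, smul_smul, ← sgn_add, neg_smul_mul]
  exact congrArg₂ (· + ·) (congrArg Neg.neg (sgn_smul_congr ⟨k * j - n * j + i * j - j, by ring⟩ _))
    (congrArg Neg.neg (sgn_smul_congr ⟨0, by ring⟩ _))

theorem schoutenT_smul {k i j : ℤ} {P : Pol A n} (hP : P ∈ deg A n k) (a : A.gr i)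
    (D : A.der j) :
    sgn K (i * (n + 1)) • schoutenT n k P (i + j) (CDGA.derSmul a D) =
      schoutenA n k P a * ofT A n j D +
        sgn K ((k - n - 1) * i) • (ofA A n a * schoutenT n k P j D) := by
  rw [schoutenA_of_mem, schoutenT_apply, schoutenT_apply, smul_neg, smul_comm, bracketT_smul,
    ofT_comm D (bracketA_mem n a hP), smul_add, neg_add, add_comm, smul_smul, smul_smul,
    ← sgn_add, ← sgn_add, mul_neg_smul, smul_neg, smul_smul, ← sgn_add, neg_smul_mul]
  exact congrArg₂ (· + ·) (congrArg Neg.neg (sgn_smul_congr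
      ⟨-1 + k + k * n + k * j - 2 * n + n * i - n * j - n ^ 2 + i + i * j - j, by ring⟩ _))
    (congrArg Neg.neg (sgn_smul_congr ⟨0, by ring⟩ _))

/-- The values on generators of the Schouten-Nijenhuis bracket `{P, -}` for a polyvector `P` of
degree `k`: by antisymmetry `{P, Q} = -(-1)^((|P|-n-1)(|Q|-n-1)) {Q, P}` they are determined by
the brackets `{a, -}` and `{s^(n+1) D, -}`. -/
def schoutenData (k : ℤ) (P : deg A n k) : DerData A n (k - n - 1) where
  φ := schoutenA n k P
  ψ := schoutenT n k P
  φ_deg i a := by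
    rw [schoutenA_of_mem]
    have := bracketA_mem n a P.2
    rw [show k + (i - n - 1) = i + (k - n - 1) by ring] at this
    exact neg_mem (Submodule.smul_mem _ _ this)
  ψ_deg i D := by
    rw [schoutenT_apply]
    have := bracketT_mem n D P.2
    rw [show k + i = i + n + 1 + (k - n - 1) by ring] at this
    exact neg_mem (Submodule.smul_mem _ _ this)
  φ_one := by
    have := schoutenA_of_mem n k (P : Pol A n) ⟨1, A.one_mem⟩
    rw [bracketA_one, smul_zero, neg_zero] at this
    exact this
  φ_mul {i} a b := by
    have hb : b ∈ ⨆ i, A.gr i := by rw [A.isInternal.submodule_iSup_eq_top]; trivial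
    induction hb using Submodule.iSup_induction' with
    | mem j b hb => exact schoutenA_mul n P.2 a ⟨b, hb⟩
    | zero => simp
    | add x y _ _ hx hy => simp only [mul_add, map_add, hx, hy, smul_add]; abel
  ψ_smul a D := schoutenT_smul n P.2 a D

/-- The Schouten-Nijenhuis bracket `{P, -}` for a polyvector `P` of degree `k`. Here shifts are
omitted: in terms of the degree zero bracket on `Pol(A, n)[n+1]` it is characterised by
`{s^(-n-1) P, s^(-n-1) Q} = s^(-n-1) (schouten n k P Q)`. -/
def schouten (k : ℤ) (P : deg A n k) : Pol A n →ₗ[K] Pol A n := (schoutenData n k P).toMap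

/-- The bracket `{P, -}` is a derivation. -/
theorem schouten_mul {k i : ℤ} (P : deg A n k) {Q : Pol A n} (hQ : Q ∈ deg A n i) (R : Pol A n) :
    schouten n k P (Q * R) =
      schouten n k P Q * R + sgn K ((k - n - 1) * i) • (Q * schouten n k P R) :=
  DerData.toMap_mul _ hQ R

theorem schouten_ofA_ofA {i : ℤ} (a : A.gr i) (b : A.carrier) :
    schouten n i ⟨ofA A n a, ofA_mem_deg a⟩ (ofA A n b) = 0 := by
  suffices h : schoutenA n i (ofA A n a) = 0 from
    (DerData.toMap_ofA _ b).trans (LinearMap.congr_fun h b)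
  refine hom_ext_of_internal A.isInternal fun j c hc => ?_
  have h2 : bracketA n ⟨c, hc⟩ (ofA A n a) = 0 := DerData.toMap_ofA _ _
  rw [schoutenA_of_mem n i _ ⟨c, hc⟩, h2, smul_zero, neg_zero, LinearMap.zero_apply]

theorem schouten_ofT_ofA {i j : ℤ} (D : A.der i) (a : A.gr j) :
    schouten n (i + n + 1) ⟨ofT A n i D, ofT_mem_deg D⟩ (ofA A n a) =
      sgn K (i * (n + 1)) • ofA A n (D.1 a) := by
  have h1 : schouten n (i + n + 1) ⟨ofT A n i D, ofT_mem_deg D⟩ (ofA A n a) =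
    schoutenA n (i + n + 1) (ofT A n i D) a := DerData.toMap_ofA _ _
  have h2 : bracketA n a (ofT A n i D) = -(sgn K (j * i) • ofA A n (D.1 a)) :=
    (twistedDer_gen _ _ _ _).trans (genMap_T _ _ D)
  rw [h1, schoutenA_of_mem, h2, smul_neg, neg_neg, smul_smul, ← sgn_add]
  exact sgn_smul_congr ⟨i * (j - n - 1), by ring⟩ _

theorem schouten_ofT_ofT {i j : ℤ} (D : A.der i) (E : A.der j) :
    schouten n (i + n + 1) ⟨ofT A n i D, ofT_mem_deg D⟩ (ofT A n j E) =
      ofT A n (i + j) (CDGA.derBracket D E) := by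
  have h1 : schouten n (i + n + 1) ⟨ofT A n i D, ofT_mem_deg D⟩ (ofT A n j E) =
    schoutenT n (i + n + 1) (ofT A n i D) j E := (twistedDer_gen _ _ _ _).trans (genMap_T _ _ E)
  have h2 : bracketT n E (ofT A n i D) = ofT A n (j + i) (CDGA.derBracket E D) :=
    (twistedDer_gen _ _ _ _).trans (genMap_T _ _ D)
  have h3 := ofT_lin (n := n) (add_comm j i) (add_comm j i) (F := CDGA.derBracket D E)
    (D := CDGA.derBracket E D) (E := CDGA.derBracket E D) (-sgn K (i * j)) 0 (by
      ext b
      simp [CDGA.derBracket, smul_sub, smul_smul, ← sgn_add]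
      rw [sgn_eq (a := i * j + j * i) (b := 0) ⟨i * j, by ring⟩, sgn_zero, one_smul]
      abel)
  rw [h1, schoutenT_apply, h2, h3, zero_smul, add_zero, neg_smul]
  exact congrArg Neg.neg (sgn_smul_congr ⟨0, by ring⟩ _)

end Pol
end Pol

section Tensor
variable {K : Type*} [Field K]

/-- The tensor power `C^(⊗ l)` of (the total space of) a complex. -/
abbrev TPow (C : Cochain K) (l : ℕ) : Type _ := ⨂[K]^l C.carrier

/-- The Koszul sign of a permutation of elements of degrees `e`: in the symmetric algebra one has
`v₁ ⋯ v_l = koszul σ e • v_(σ 1) ⋯ v_(σ l)`. -/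
def koszul (K : Type*) [Field K] {l : ℕ} (σ : Equiv.Perm (Fin l)) (e : Fin l → ℤ) : K :=
  ∏ p : Fin l × Fin l, if p.1 < p.2 ∧ σ p.2 < σ p.1 then sgn K (e (σ p.1) * e (σ p.2)) else 1

/-- The signature of a permutation as a scalar. -/
def sign (K : Type*) [Field K] {l : ℕ} (σ : Equiv.Perm (Fin l)) : K :=
  ((Equiv.Perm.sign σ : ℤ) : K)

/-- The `n`-th power of the signature of a permutation as a scalar. -/
def signPow (K : Type*) [Field K] (n : ℤ) {l : ℕ} (σ : Equiv.Perm (Fin l)) : K :=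
  (((Equiv.Perm.sign σ) ^ n : ℤˣ) : ℤ)

variable (C : Cochain K)

/-- The operator `y₁ ⊗ ⋯ ⊗ y_l ↦ koszul σ |y| • y₁ ⊗ ⋯ ⊗ y_l`. Since a Koszul sign depends only on
the parities of the degrees, it is a sum over all possible parities. -/
def koszulOp {l : ℕ} (σ : Equiv.Perm (Fin l)) : TPow C l →ₗ[K] TPow C l :=
  ∑ c : Fin l → Fin 2, koszul K σ (fun i => ((c i : ℕ) : ℤ)) •
    PiTensorProduct.map fun i => parityProj C.isInternal (c i)

/-- The symmetric braiding `γ_σ`, with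
`γ_σ (y₁ ⊗ ⋯ ⊗ y_l) = koszul σ |y| • y_(σ 1) ⊗ ⋯ ⊗ y_(σ l)`. -/
def braid {l : ℕ} (σ : Equiv.Perm (Fin l)) : TPow C l →ₗ[K] TPow C l :=
  (PiTensorProduct.reindex K (fun _ => C.carrier) σ.symm).toLinearMap ∘ₗ koszulOp C σ

/-- The degree `k` part of the tensor power. -/
def tensorGr (l : ℕ) (k : ℤ) : Submodule K (TPow C l) :=
  Submodule.span K {t | ∃ (e : Fin l → ℤ) (y : Fin l → C.carrier), (∀ j, y j ∈ C.gr (e j)) ∧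
    ∑ j, e j = k ∧ t = PiTensorProduct.tprod K y}

/-- The differential of the tensor power. -/
def tensorD (l : ℕ) : TPow C l →ₗ[K] TPow C l :=
  ∑ i : Fin l, PiTensorProduct.map fun j =>
    if j < i then signOp C.isInternal 1 else if j = i then C.d else LinearMap.id

/-- The differential `∂ L = d L - (-1)^i L d` on maps of degree `i`. -/
def homDiff {l m : ℕ} (i : ℤ) (L : TPow C l →ₗ[K] TPow C m) : TPow C l →ₗ[K] TPow C m :=
  tensorD C m ∘ₗ L - sgn K i • (L ∘ₗ tensorD C l)

/-- The maps `C^(⊗ l) → C^(⊗ m)` of degree `i` with totally antisymmetric input, and whose output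
is totally symmetric for even `n` and totally antisymmetric for odd `n`. -/
def homAS (n : ℤ) (l m : ℕ) (i : ℤ) : Submodule K (TPow C l →ₗ[K] TPow C m) where
  carrier := {L | (∀ k, ∀ t ∈ tensorGr C l k, L t ∈ tensorGr C m (k + i)) ∧
    (∀ σ : Equiv.Perm (Fin l), sign K σ • (L ∘ₗ braid C σ) = L) ∧
    ∀ ρ : Equiv.Perm (Fin m), signPow K n ρ • (braid C ρ ∘ₗ L) = L}
  add_mem' {L M} hL hM := by
    refine ⟨fun k t ht => add_mem (hL.1 k t ht) (hM.1 k t ht), fun σ => ?_, fun ρ => ?_⟩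
    · rw [LinearMap.add_comp, smul_add, hL.2.1, hM.2.1]
    · rw [LinearMap.comp_add, smul_add, hL.2.2, hM.2.2]
  zero_mem' := by
    refine ⟨fun k t ht => zero_mem _, fun σ => ?_, fun ρ => ?_⟩
    · rw [LinearMap.zero_comp, smul_zero]
    · rw [LinearMap.comp_zero, smul_zero]
  smul_mem' c L hL := by
    refine ⟨fun k t ht => Submodule.smul_mem _ _ (hL.1 k t ht), fun σ => ?_, fun ρ => ?_⟩
    · rw [LinearMap.smul_comp, smul_comm, hL.2.1]
    · rw [LinearMap.comp_smul, smul_comm, hL.2.2]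

/-- The composition `(L ⊗ id) ∘ (id ⊗ L')` along the first output of `L'` and the last input of
`L`, where `i` is the degree of `L'`: it sends `y₁ ⊗ ⋯ ⊗ y_a ⊗ z` to
`(-1)^(i (|y₁| + ⋯ + |y_a|)) (L ⊗ id) (y₁ ⊗ ⋯ ⊗ y_a ⊗ L' z)`. -/
def compMid {a l' m b : ℕ} (L : TPow C (a + 1) →ₗ[K] TPow C m)
    (L' : TPow C l' →ₗ[K] TPow C (b + 1)) (i : ℤ) : TPow C (a + l') →ₗ[K] TPow C (m + b) :=
  TensorPower.mulEquiv.toLinearMap ∘ₗ TensorProduct.map L LinearMap.id ∘ₗ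
    (TensorPower.mulEquiv (n := a + 1) (m := b)).symm.toLinearMap ∘ₗ
    (TensorPower.cast K C.carrier (show a + (b + 1) = a + 1 + b by omega)).toLinearMap ∘ₗ
    TensorPower.mulEquiv.toLinearMap ∘ₗ
    TensorProduct.map (PiTensorProduct.map fun _ => signOp C.isInternal i) L' ∘ₗ
    TensorPower.mulEquiv.symm.toLinearMap

open Classical in
/-- The shuffles `Sh(p, q)`: permutations which are increasing on the first `p` and on the last `q`
elements. -/
def Sh (p q : ℕ) : Finset (Equiv.Perm (Fin (p + q))) :=
  Finset.univ.filter fun σ =>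
    (StrictMono fun i : Fin p => σ (Fin.castAdd q i)) ∧
      StrictMono fun j : Fin q => σ (Fin.natAdd p j)

/-- The sum of `(-1)^|σ| (-1)^(|ρ| n) γ ∘ (L ⊗ id) ∘ (id ⊗ L') ∘ γ_σ` over the shuffles `σ` and
`ρ`, where the braiding `γ` of the outputs moves the output `i` to the position `ρ i`; here `i` is
the degree of `L'`. -/
def shuffleComp (n : ℤ) {a l' m b : ℕ} (L : TPow C (a + 1) →ₗ[K] TPow C m)
    (L' : TPow C l' →ₗ[K] TPow C (b + 1)) (i : ℤ) : TPow C (a + l') →ₗ[K] TPow C (m + b) :=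
  ∑ σ ∈ Sh a l', ∑ ρ ∈ Sh m b,
    (sign K σ * signPow K n ρ) • (braid C ρ⁻¹ ∘ₗ compMid C L L' i ∘ₗ braid C σ)

/-- Transport of a map along equalities of the numbers of inputs and outputs. -/
def castHom {l l' m m' : ℕ} (hl : l = l') (hm : m = m') (L : TPow C l →ₗ[K] TPow C m) :
    TPow C l' →ₗ[K] TPow C m' :=
  (TensorPower.cast K C.carrier hm).toLinearMap ∘ₗ L ∘ₗ
    (TensorPower.cast K C.carrier hl.symm).toLinearMap

/-- The families of maps `π^(m,l)` in `hom^-_±(C^(⊗ l), C^(⊗ m))` of degree `(1-m) n + 2 - l`, for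
`m ≥ 2` and `l ≥ 0`, bounded in `l` for every `m`, which satisfy the Maurer-Cartan identities. The
family is extended by zero to `m < 2`; in the sums `m₁`, `m₂ = b + 1`, `l₁ = a + 1`, `l₂` satisfy
`m₁ + m₂ - 1 = m` and `l₁ + l₂ - 1 = l`. -/
structure MapFamily (n : ℤ) where
  map : ∀ m l : ℕ, TPow C l →ₗ[K] TPow C m
  mem : ∀ m l : ℕ, map m l ∈ homAS C n l m ((1 - m) * n + 2 - l)
  zero : ∀ m : ℕ, m < 2 → ∀ l, map m l = 0
  bounded : ∀ m, ∃ N, ∀ l, N < l → map m l = 0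
  maurerCartan : ∀ m : ℕ, 2 ≤ m → ∀ l : ℕ,
    sgn K ((m - 1) * n + l - 1) • homDiff C ((1 - m) * n + 2 - l) (map m l) +
      ∑ p : Finset.HasAntidiagonal.antidiagonal m, ∑ q : Finset.HasAntidiagonal.antidiagonal l,
        (let m₁ : ℕ := p.1.1; let b : ℕ := p.1.2; let m₂ : ℕ := b + 1
         let a : ℕ := q.1.1; let l₁ : ℕ := a + 1; let l₂ : ℕ := q.1.2
         (sgn K (((1 - m₁) * n + 2 - l₁) * ((m₂ - 1) * n + l₂ - 1)) *
            sgn K (n * (m₂ - 1) * (l₁ - 1))) •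
          castHom C (Finset.HasAntidiagonal.mem_antidiagonal.1 q.2) (Finset.HasAntidiagonal.mem_antidiagonal.1 p.2)
            (shuffleComp C n (map m₁ l₁) (map m₂ l₂) ((1 - m₂) * n + 2 - l₂))) = 0

/-- The map `L_B` attached to `B = x₁ ⋯ x_m θ₁ ⋯ θ_l`, with `x_k` of degree `e k` and `θ_j` of
degree `f j`: it sends `y₁ ⊗ ⋯ ⊗ y_l` to the sum over the permutations `σ` and `ρ` of
`x_(ρ 1) ⊗ ⋯ ⊗ x_(ρ m) ∏ θ_(σ j) (y_j)` with the Koszul signs of `ρ` for `(-1)^n`-symmetric `x_k`,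
of `σ` for antisymmetric `θ_j`, and of the reversal for symmetric `y_j`. -/
def mapOfMonomial (n : ℤ) {m l : ℕ} (e : Fin m → ℤ) (x : Fin m → C.carrier) (f : Fin l → ℤ)
    (θ : Fin l → Module.Dual K C.carrier) : TPow C l →ₗ[K] TPow C m :=
  ∑ σ : Equiv.Perm (Fin l), ∑ ρ : Equiv.Perm (Fin m),
    (signPow K n ρ * koszul K ρ e * (sign K σ * koszul K σ f)) •
      (((PiTensorProduct.lift ((MultilinearMap.mkPiAlgebra K (Fin l) K).compLinearMap
        fun j => θ (σ j))) ∘ₗ koszulOp C Fin.revPerm).smulRight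
          (PiTensorProduct.tprod K fun k => x (ρ k)))

end Tensor

section Main
variable {K : Type*} [Field K]

/-- The `n`-shifted Poisson structures on `A`: completed polyvectors `π = ∑ π^(m)` of degree `n + 2`
and weight at least `2` which satisfy the Maurer-Cartan equation
`∂ (s^(-n-1) π) + 1/2 {s^(-n-1) π, s^(-n-1) π} = 0`, written out in every weight and with
`s^(-n-1)` moved to the left and omitted. -/
structure PoissonStructure (A : CDGA K) (n : ℤ) where
  comp : ℕ → Pol A n
  mem : ∀ m, comp m ∈ Pol.gr A n m (n + 2)
  zero : ∀ m : ℕ, m < 2 → comp m = 0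
  maurerCartan : ∀ m : ℕ, sgn K (n + 1) • Pol.diff A n (comp m) +
    (1 / 2 : K) • ∑ p ∈ Finset.HasAntidiagonal.antidiagonal (m + 1),
      Pol.schouten n (n + 2) ⟨comp p.1, Pol.gr_le_deg _ _ (mem p.1)⟩ (comp p.2) = 0

variable (g : Cochain K) [Module.Finite K g.carrier] (n : ℤ)

/-- The polyvector `s^n x₁ ⋯ s^n x_m s θ₁ ⋯ s θ_l`, where `s^n x = s^(n+1) (s⁻¹ x)`. -/
def monomial {m l : ℕ} {e : Fin m → ℤ} (x : ∀ k, g.gr (e k))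
    (θ : Fin l → Module.Dual K g.carrier) : Pol (freeAlg g) n :=
  (List.ofFn fun k => Pol.ofT (freeAlg g) n (e k - 1) (contraction g (x k))).prod *
    (List.ofFn fun j => Pol.ofA (freeAlg g) n (sTheta g (θ j))).prod

theorem prod_sTheta_mem {l : ℕ} {f : Fin l → ℤ} (θ : ∀ j, g.dualGr (f j)) :
    (List.ofFn fun j => Pol.ofA (freeAlg g) n (sTheta g (θ j))).prod ∈
      Pol.gr (freeAlg g) n 0 (∑ j, (f j + 1)) := by
  induction l with
  | zero =>
    simp only [List.ofFn_zero, List.prod_nil, Finset.univ_eq_empty, Finset.sum_empty]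
    rw [← Pol.ofA_one]
    exact Submodule.subset_span (.ofA ⟨1, (freeAlg g).one_mem⟩)
  | succ l ih =>
    rw [List.ofFn_succ, List.prod_cons, Fin.sum_univ_succ]
    have h : sTheta g (θ 0) ∈ (freeAlg g).gr (f 0 + 1) := by
      refine Sym.ι_mem (W := dualShift g) ?_
      change (θ 0 : Module.Dual K g.carrier) ∈ g.dualGr (f 0 + 1 + -1)
      rw [show f 0 + 1 + -1 = f 0 by ring]
      exact (θ 0).2
    exact Pol.ofA_mul_gr ⟨_, h⟩ (ih fun j => θ j.succ)

theorem monomial_mem {m l : ℕ} {e : Fin m → ℤ} {f : Fin l → ℤ} (x : ∀ k, g.gr (e k))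
    (θ : ∀ j, g.dualGr (f j)) :
    monomial g n x (fun j => (θ j : Module.Dual K g.carrier)) ∈
      Pol.gr (freeAlg g) n m (∑ k, (e k + n) + ∑ j, (f j + 1)) := by
  unfold monomial
  induction m with
  | zero => simpa using prod_sTheta_mem g n θ
  | succ m ih =>
    rw [List.ofFn_succ, List.prod_cons, Fin.sum_univ_succ, mul_assoc]
    have := Pol.ofT_mul_gr (contraction g (x 0)) (ih fun k => x k.succ)
    rw [show e 0 - 1 + n + 1 = e 0 + n by ring, ← add_assoc] at this
    exact this

end Main

end

end ShiftedPoisson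

namespace ShiftedPoisson
noncomputable section

/-! ### Koszul signs of permutations and their behaviour under a shift of all degrees. -/

section KoszulCombinatorics
variable {K : Type*} [Field K]

/-! Polyvectors on `Sym (g*[-1])` behave like polynomials. Fix a homogeneous basis b_i of g with
coordinate functionals θ^i. The algebra is generated by X_i = s^n b_i, of degree |b_i| + n, and Y_i
= s θ^i, of degree 1 - |b_i| (`HomBasis.adjoin_eq_top`). Up to normalising signs, bracketing with s
θ^i is the partial derivative along X_i and bracketing with s^n b_i is the partial derivative along
Y_i. These operators are available on the presented algebra because the bracket is, so freeness
needs no separate proof. A word of partial derivatives followed by the augmentation is a Taylor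
coefficient (`PolModel.coef`). In characteristic 0 the coefficients determine the polyvector:
summing coefficients times monomials counts each rearrangement, and dividing by m! l! gives the
polyvector back (`PolModel.coef_recon`, `PolModel.exists_sum_recon_coef`).

The map attached to a polyvector has as matrix entry at (w, v) the Taylor coefficient at (w, v)
times the sign with exponent `phiExp`, which is the sign prescribed on monomials together with that
of the reversal. Taylor coefficients are symmetric with Koszul signs for the degrees |b| + n and 1 -
|b|, whereas the entries of an admissible map are symmetric with Koszul signs for |b| twisted by
signatures. The décalage identity `koszul_add_const` says that `phiExp` converts one symmetry into
the other. Only finitely many l occur, since a polyvector is a finite sum of monomials.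

For the Maurer-Cartan equation both terms are compared on coefficients. The graded commutator of a
partial derivative with the differential is a combination of partial derivatives with coefficients
from the matrix of d, so the coefficients of the differential are sums over one replaced letter, as
for the differential of maps (`PolModel.toHom_diff`). The bracket is a sum over i of products of a
Y_i-derivative and an X_i-derivative; its two halves are exchanged by swapping the arguments, which
absorbs the factor 1/2 (`PolModel.half_sum_schouten`). The Leibniz rule for words distributes the
letters by shuffles (`PolModel.coef_mul`), and the index i becomes the contracted slot of ⋄
(`PolModel.toHom_bracket`). The signs then agree by a polynomial identity modulo 2
(`bracket_sign_parity`), once the degree conditions have eliminated the output degrees. Since the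
maps determine a polyvector of given weight (`PolModel.eq_zero_of_toHom`), the two systems of
equations are equivalent. -/

theorem sgn_mul_self (a : ℤ) : sgn K a * sgn K a = 1 := by
  rcases sgn_cases (K := K) a with h | h <;> simp [h]

theorem sgn_neg (a : ℤ) : sgn K (-a) = sgn K a := sgn_eq ⟨-a, by ring⟩

theorem sgn_even {a : ℤ} (h : Even a) : sgn K a = 1 := by
  rw [← sgn_zero (K := K)]; exact sgn_eq (by simpa using h)

theorem sgn_one : sgn K 1 = -1 := by simp [sgn]

theorem sgn_sum {ι : Type*} (s : Finset ι) (f : ι → ℤ) :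
    sgn K (∑ i ∈ s, f i) = ∏ i ∈ s, sgn K (f i) := by
  classical
  induction s using Finset.induction_on with
  | empty => simp [sgn_zero]
  | insert a s ha ih => rw [Finset.sum_insert ha, Finset.prod_insert ha, sgn_add, ih]

/-- The permutation with first value `k`, and which is `τ` on the remaining elements. -/
def consPerm {l : ℕ} (k : Fin (l + 1)) (τ : Equiv.Perm (Fin l)) : Equiv.Perm (Fin (l + 1)) :=
  k.cycleRange.symm * Equiv.Perm.decomposeFin.symm (0, τ)

@[simp] theorem consPerm_zero {l : ℕ} (k : Fin (l + 1)) (τ : Equiv.Perm (Fin l)) :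
    consPerm k τ 0 = k := by
  simp [consPerm]

@[simp] theorem consPerm_succ {l : ℕ} (k : Fin (l + 1)) (τ : Equiv.Perm (Fin l)) (i : Fin l) :
    consPerm k τ i.succ = k.succAbove (τ i) := by
  simp [consPerm]

theorem consPerm_bijective (l : ℕ) :
    Function.Bijective fun p : Fin (l + 1) × Equiv.Perm (Fin l) => consPerm p.1 p.2 := by
  rw [Fintype.bijective_iff_injective_and_card]
  constructor
  · rintro ⟨k, τ⟩ ⟨k', τ'⟩ h
    have h0 : k = k' := by simpa using Equiv.congr_fun h 0
    subst h0
    refine Prod.ext rfl (Equiv.ext fun i => ?_)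
    simpa using Equiv.congr_fun h i.succ
  · simp [Fintype.card_perm, Nat.factorial_succ]

theorem sum_perm_succ {l : ℕ} {X : Type*} [AddCommMonoid X]
    (f : Equiv.Perm (Fin (l + 1)) → X) : ∑ σ, f σ = ∑ k, ∑ τ, f (consPerm k τ) := by
  rw [← Fintype.sum_prod_type']
  exact (Fintype.sum_bijective _ (consPerm_bijective l) _ _ fun _ => rfl).symm

theorem perm_induction {C : ∀ l, Equiv.Perm (Fin l) → Prop} (h0 : C 0 1)
    (hs : ∀ l k τ, C l τ → C (l + 1) (consPerm k τ)) {l : ℕ} (σ : Equiv.Perm (Fin l)) : C l σ := by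
  induction l with
  | zero => rwa [Subsingleton.elim σ 1]
  | succ l ih =>
    obtain ⟨⟨k, τ⟩, rfl⟩ := (consPerm_bijective l).2 σ
    exact hs l k τ (ih τ)

/-- The inversions at position 0 pair the letter `k` with exactly the letters below `k`, whatever
their order; the other inversions are those of `τ`, because `succAbove` is monotone. This recursion
drives the inductions over permutations below. -/
theorem koszul_consPerm {l : ℕ} (k : Fin (l + 1)) (τ : Equiv.Perm (Fin l))
    (e : Fin (l + 1) → ℤ) : koszul K (consPerm k τ) e =
      (∏ i : Fin l, if k.succAbove i < k then sgn K (e k * e (k.succAbove i)) else 1) *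
        koszul K τ (e ∘ k.succAbove) := by
  unfold koszul
  rw [Fintype.prod_prod_type, Fin.prod_univ_succ, Fin.prod_univ_succ]
  congr 1
  · simp only [lt_irrefl, false_and, if_false, one_mul, consPerm_zero, consPerm_succ,
      Fin.succ_pos, true_and]
    exact Equiv.prod_comp τ fun i => if k.succAbove i < k then
      sgn K (e k * e (k.succAbove i)) else 1
  · rw [Fintype.prod_prod_type]
    refine Finset.prod_congr rfl fun i _ => ?_
    rw [Fin.prod_univ_succ]
    simp [Fin.succAbove_lt_succAbove_iff]

theorem koszul_zero (σ : Equiv.Perm (Fin 0)) (e : Fin 0 → ℤ) : koszul K σ e = 1 := by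
  simp [koszul]

theorem koszul_congr {l : ℕ} (σ : Equiv.Perm (Fin l)) {e f : Fin l → ℤ}
    (h : ∀ i, Even (e i - f i)) : koszul K σ e = koszul K σ f := by
  refine Finset.prod_congr rfl fun p _ => ?_
  congr 1
  refine sgn_eq ?_
  have h1 := h (σ p.1)
  have h2 := h (σ p.2)
  rw [show e (σ p.1) * e (σ p.2) - f (σ p.1) * f (σ p.2) = (e (σ p.1) - f (σ p.1)) * e (σ p.2) +
    f (σ p.1) * (e (σ p.2) - f (σ p.2)) by ring]
  exact (h1.mul_right _).add (h2.mul_left _)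

/-- A pair of positions is inverted by `σ⁻¹` exactly when its preimages under `σ`, taken in the
opposite order, are inverted by `σ`; the sign is symmetric in the two degrees. -/
theorem koszul_inv {l : ℕ} (σ : Equiv.Perm (Fin l)) (e : Fin l → ℤ) :
    koszul K σ⁻¹ (e ∘ σ) = koszul K σ e := by
  unfold koszul
  refine Fintype.prod_equiv ((Equiv.prodComm _ _).trans (Equiv.prodCongr σ⁻¹ σ⁻¹)) _ _ fun p => ?_
  simp only [Equiv.trans_apply, Equiv.prodComm_apply, Prod.fst_swap, Prod.snd_swap,
    Equiv.prodCongr_apply, Prod.map, Function.comp]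
  have h : ∀ x, σ (σ⁻¹ x) = x := fun x => σ.apply_symm_apply x
  simp only [h, mul_comm, and_comm]

theorem koszul_mul_self {l : ℕ} (σ : Equiv.Perm (Fin l)) (e : Fin l → ℤ) :
    koszul K σ e * koszul K σ e = 1 := by
  rw [koszul, ← Finset.prod_mul_distrib]
  refine Finset.prod_eq_one fun p _ => ?_
  split_ifs
  · exact sgn_mul_self _
  · simp

/-- With all degrees equal to 1 each inversion contributes -1, and the signature is the parity of
the number of inversions. -/
theorem koszul_const_one {l : ℕ} (σ : Equiv.Perm (Fin l)) :
    koszul K σ (fun _ => 1) = sign K σ := by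
  have h : koszul K σ (fun _ => 1) =
      ((∏ j, ∏ i ∈ Finset.Iio j, if σ i < σ j then 1 else -1 : ℤˣ) : ℤ) := by
    unfold koszul
    rw [Fintype.prod_prod_type_right]
    push_cast
    refine Finset.prod_congr rfl fun j _ => ?_
    rw [← Finset.prod_subset (Finset.subset_univ (Finset.Iio j))]
    · refine Finset.prod_congr rfl fun i hi => ?_
      rw [Finset.mem_Iio] at hi
      have hne : σ i ≠ σ j := fun h => hi.ne (σ.injective h)
      rcases lt_or_gt_of_ne hne with h | h
      · simp [h, not_lt.2 h.le]
      · simp [h, not_lt.2 h.le, hi, sgn_one]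
    · intro i _ hi
      rw [Finset.mem_Iio] at hi
      simp [hi]
  rw [h, sign, Equiv.Perm.sign_eq_prod_prod_Iio]

theorem signPow_cases (n : ℤ) {l : ℕ} (σ : Equiv.Perm (Fin l)) :
    signPow K n σ = if Even n then 1 else sign K σ := by
  unfold signPow sign
  split_ifs with h
  · obtain ⟨k, rfl⟩ := h
    simp [← mul_two, zpow_mul', Int.units_sq]
  · rw [Int.not_even_iff_odd] at h
    obtain ⟨k, rfl⟩ := h
    rw [zpow_add, zpow_mul, zpow_two, Int.units_mul_self]
    simp

theorem koszul_const {l : ℕ} (n : ℤ) (σ : Equiv.Perm (Fin l)) :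
    koszul K σ (fun _ => n) = signPow K n σ := by
  rw [signPow_cases]
  split_ifs with h
  · rw [← Finset.prod_const_one (s := Finset.univ) (ι := Fin l × Fin l)]
    refine Finset.prod_congr rfl fun p _ => ?_
    rw [sgn_even (h.mul_left _), ite_self]
  · rw [← koszul_const_one]
    refine koszul_congr σ fun i => ?_
    rw [Int.not_even_iff_odd] at h
    exact h.sub_odd odd_one

/-- The sum `∑ k e_k` over the positions `k`. -/
def posSum {l : ℕ} (e : Fin l → ℤ) : ℤ := ∑ k : Fin l, e k * (k : ℕ)

theorem posSum_succ {l : ℕ} (e : Fin (l + 1) → ℤ) :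
    posSum e = posSum (e ∘ Fin.succ) + ∑ i : Fin l, e i.succ := by
  simp [posSum, Fin.sum_univ_succ, mul_add, Finset.sum_add_distrib]

/-- Deleting the letter `k` lowers the position of each later letter by one, which accounts for the
last sum. -/
theorem posSum_succAbove {l : ℕ} (e : Fin (l + 1) → ℤ) (k : Fin (l + 1)) :
    posSum e = e k * (k : ℕ) + posSum (e ∘ k.succAbove) +
      ∑ i : Fin l, (if k.succAbove i < k then 0 else e (k.succAbove i)) := by
  unfold posSum
  rw [Fin.sum_univ_succAbove _ k, add_assoc, ← Finset.sum_add_distrib]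
  congr 1
  refine Finset.sum_congr rfl fun i _ => ?_
  split_ifs with h
  · rw [Fin.succAbove_lt_iff_castSucc_lt] at h
    simp [Fin.succAbove_of_castSucc_lt _ _ h]
  · rw [Fin.succAbove_lt_iff_castSucc_lt, not_lt] at h
    simp [Fin.succAbove_of_le_castSucc _ _ h, mul_add]

theorem card_succAbove_lt {l : ℕ} (k : Fin (l + 1)) :
    ∑ i : Fin l, (if k.succAbove i < k then (1 : ℤ) else 0) = (k : ℕ) := by
  simp only [Fin.succAbove_lt_iff_castSucc_lt]
  rw [Finset.sum_boole]
  have h : (Finset.univ.filter fun i : Fin l => i.castSucc < k).card = (k : ℕ) := by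
    simp only [Fin.lt_def, Fin.val_castSucc]
    rw [Fin.card_filter_val_lt]
    exact min_eq_right (Nat.le_of_lt_succ k.2)
  rw [h]

/-- Décalage. An inverted pair contributes (e_i + n)(e_j + n) = e_i e_j + n² + n (e_i + e_j). The
first two terms give the Koszul sign and the power of the signature. In the third, e_i is counted
once for each inversion in which the letter i takes part, and this number has the parity of the
displacement of that letter; hence the difference of the two position sums. -/
theorem koszul_add_const {l : ℕ} (n : ℤ) (σ : Equiv.Perm (Fin l)) (e : Fin l → ℤ) :
    koszul K σ (fun i => e i + n) = koszul K σ e * signPow K n σ *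
      sgn K (n * (posSum e + posSum (e ∘ σ))) := by
  rw [← koszul_const]
  induction σ using perm_induction with
  | h0 => simp only [koszul_zero, posSum, one_mul]; simp [sgn_zero]
  | hs l k τ ih =>
    have ih' := ih (e ∘ k.succAbove)
    rw [koszul_consPerm, koszul_consPerm, koszul_consPerm]
    have e1 : (fun i => e i + n) ∘ k.succAbove = fun i => (e ∘ k.succAbove) i + n := rfl
    have e2 : (fun _ : Fin (l + 1) => n) ∘ k.succAbove = fun _ => n := rfl
    rw [e1, ih', e2, posSum_succAbove e k, posSum_succ (e ∘ consPerm k τ)]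
    have e3 : (e ∘ consPerm k τ) ∘ Fin.succ = (e ∘ k.succAbove) ∘ τ := by
      ext i; simp
    have e4 : ∑ i : Fin l, (e ∘ consPerm k τ) i.succ = ∑ i, e (k.succAbove i) := by
      simp only [Function.comp, consPerm_succ]
      exact Equiv.sum_comp τ fun i => e (k.succAbove i)
    rw [e3, e4]
    have e5 : ∀ f : Fin (l + 1) → Fin (l + 1) → ℤ,
        (∏ i : Fin l, if k.succAbove i < k then sgn K (f k (k.succAbove i)) else 1) =
          sgn K (∑ i : Fin l, if k.succAbove i < k then f k (k.succAbove i) else 0) := by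
      intro f
      rw [sgn_sum]
      exact Finset.prod_congr rfl fun i _ => by split_ifs <;> simp [sgn_zero]
    rw [e5 fun a b => (e a + n) * (e b + n), e5 fun a b => e a * e b, e5 fun a b => n * n]
    set A := koszul K τ (e ∘ k.succAbove)
    set B := koszul K τ fun _ => n
    -- The contribution of the letter `k`, which jumps over the letters below it. Writing its
    -- position as the number of those letters (`card_succAbove_lt`) lets the parities be compared
    -- summand by summand.
    have key : sgn K (∑ i : Fin l, if k.succAbove i < k then (e k + n) * (e (k.succAbove i) + n)
          else 0) =
        sgn K (∑ i : Fin l, if k.succAbove i < k then e k * e (k.succAbove i) else 0) *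
        sgn K (∑ i : Fin l, if k.succAbove i < k then n * n else 0) *
        sgn K (n * (e k * (k : ℕ) + ∑ i : Fin l, (if k.succAbove i < k then 0 else
          e (k.succAbove i)) + ∑ i, e (k.succAbove i))) := by
      rw [← sgn_add, ← sgn_add]
      refine sgn_eq ⟨-(n * ∑ i : Fin l, if k.succAbove i < k then 0 else e (k.succAbove i)), ?_⟩
      rw [← card_succAbove_lt k]
      simp only [Finset.mul_sum, ← Finset.sum_add_distrib, ← Finset.sum_sub_distrib,
        ← Finset.sum_neg_distrib]
      refine Finset.sum_congr rfl fun i _ => ?_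
      split_ifs <;> ring
    rw [key]
    have s : ∀ x y z : ℤ, sgn K (n * (x + y)) = sgn K (n * x) * sgn K (n * y) := by
      intro x y z; rw [mul_add, sgn_add]
    simp only [mul_add, sgn_add]
    ring

/-- The second elementary symmetric function. -/
def pairSum {l : ℕ} (e : Fin l → ℤ) : ℤ :=
  ∑ i : Fin l, ∑ j : Fin l, if i < j then e i * e j else 0

/-- Expresses `pairSum` through power sums, so that its invariance under permutations and its
behaviour under changing, appending or concatenating entries follow by arithmetic. -/
theorem two_pairSum {l : ℕ} (e : Fin l → ℤ) :
    2 * pairSum e = (∑ i, e i) ^ 2 - ∑ i, e i ^ 2 := by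
  have h : pairSum e = ∑ i : Fin l, ∑ j : Fin l, if j < i then e i * e j else 0 := by
    rw [pairSum, Finset.sum_comm]
    exact Finset.sum_congr rfl fun i _ => Finset.sum_congr rfl fun j _ => by rw [mul_comm]
  have h3 : ∑ i, e i ^ 2 = ∑ i : Fin l, ∑ j : Fin l, if i = j then e i * e j else 0 := by
    refine Finset.sum_congr rfl fun i _ => ?_
    simp [sq]
  rw [two_mul]
  nth_rw 2 [h]
  rw [eq_sub_iff_add_eq, h3, pairSum, sq, Finset.sum_mul_sum, ← Finset.sum_add_distrib,
    ← Finset.sum_add_distrib]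
  refine Finset.sum_congr rfl fun i _ => ?_
  rw [← Finset.sum_add_distrib, ← Finset.sum_add_distrib]
  refine Finset.sum_congr rfl fun j _ => ?_
  rcases lt_trichotomy i j with h | h | h
  · simp [h, h.ne, not_lt.2 h.le]
  · simp [h]
  · simp [h, h.ne', not_lt.2 h.le]

theorem pairSum_comp {l : ℕ} (e : Fin l → ℤ) (σ : Equiv.Perm (Fin l)) :
    pairSum (e ∘ σ) = pairSum e := by
  refine mul_left_cancel₀ (two_ne_zero (α := ℤ)) ?_
  rw [two_pairSum, two_pairSum]
  simp only [Function.comp]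
  rw [Equiv.sum_comp σ e, Equiv.sum_comp σ fun i => e i ^ 2]

/-- The reversal inverts every pair. -/
theorem koszul_rev {l : ℕ} (e : Fin l → ℤ) : koszul K Fin.revPerm e = sgn K (pairSum e) := by
  rw [← pairSum_comp e Fin.revPerm, pairSum, sgn_sum, koszul, Fintype.prod_prod_type]
  refine Finset.prod_congr rfl fun i _ => ?_
  rw [sgn_sum]
  refine Finset.prod_congr rfl fun j _ => ?_
  by_cases h : i < j <;> simp [h, sgn_zero]

end KoszulCombinatorics

/-! ### Words of derivations acting on words of graded commuting letters. -/

section OrderedProducts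

/-- The product of a family in reverse order; for operators, `D 0` is applied first. -/
def iter {R : Type*} [Monoid R] {N : ℕ} (D : Fin N → R) : R := (List.ofFn D).reverse.prod

theorem iter_zero {R : Type*} [Monoid R] (D : Fin 0 → R) : iter D = 1 := by simp [iter]

theorem iter_succ {R : Type*} [Monoid R] {N : ℕ} (D : Fin (N + 1) → R) :
    iter D = iter (fun i => D i.succ) * D 0 := by
  simp [iter, List.ofFn_succ]

theorem iter_succ_last {R : Type*} [Monoid R] {N : ℕ} (D : Fin (N + 1) → R) :
    iter D = D (Fin.last N) * iter fun i => D i.castSucc := by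
  rw [iter, List.ofFn_succ']
  simp [iter]

theorem iter_eq_filter {R : Type*} [Monoid R] {N : ℕ} (D : Fin N → R) (c : Fin N → Bool) :
    iter (fun i => if c i then D i else 1) = (((List.finRange N).filter c).map D).reverse.prod := by
  have h : ∀ L : List (Fin N), (L.map fun i => if c i then D i else 1).reverse.prod =
      ((L.filter c).map D).reverse.prod := by
    intro L
    induction L with
    | nil => simp
    | cons a L ih => by_cases h : c a <;> simp_all
  rw [iter, List.ofFn_eq_map, h]

variable {K : Type*} [Field K]

section
variable {R : Type*} [Ring R] [Algebra K R]

/-- The letter `k` passes exactly the letters standing before it. -/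
theorem prod_moveFront {l : ℕ} (v : Fin (l + 1) → R) (e : Fin (l + 1) → ℤ)
    (h : ∀ i j, v i * v j = sgn K (e i * e j) • (v j * v i)) (k : Fin (l + 1)) :
    (List.ofFn v).prod =
      (∏ i : Fin l, if k.succAbove i < k then sgn K (e k * e (k.succAbove i)) else 1) •
        (v k * (List.ofFn (v ∘ k.succAbove)).prod) := by
  induction l with
  | zero =>
    have : k = 0 := Subsingleton.elim (α := Fin 1) _ _
    subst this
    simp
  | succ l ih =>
    refine Fin.cases ?_ (fun k => ?_) k
    · simp [Function.comp_def]
    · rw [List.ofFn_succ, List.prod_cons, Fin.prod_univ_succ]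
      have := ih (v ∘ Fin.succ) (e ∘ Fin.succ) (fun i j => h _ _) k
      simp only [Function.comp_def] at this
      rw [this, List.ofFn_succ, List.prod_cons, mul_smul_comm, ← mul_assoc, h, smul_mul_assoc,
        smul_smul]
      simp only [Function.comp_apply, Fin.succ_succAbove_zero, Fin.succ_pos, if_true,
        Fin.succ_succAbove_succ, Fin.succ_lt_succ_iff, mul_assoc]
      rw [mul_comm, mul_comm (e 0)]

/-- Selection sort: bring `σ 0` to the front and reorder the rest by induction; the signs multiply
as in `koszul_consPerm`. Only the mutual commutation of the letters is used, so the result applies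
to elements and to operators. -/
theorem prod_reorder {l : ℕ} (σ : Equiv.Perm (Fin l)) (v : Fin l → R) (e : Fin l → ℤ)
    (h : ∀ i j, v i * v j = sgn K (e i * e j) • (v j * v i)) :
    (List.ofFn v).prod = koszul K σ e • (List.ofFn (v ∘ σ)).prod := by
  induction σ using perm_induction with
  | h0 => simp [koszul_zero]
  | hs l k τ ih =>
    rw [koszul_consPerm, prod_moveFront (K := K) v e h k,
      ih (v ∘ k.succAbove) (e ∘ k.succAbove) fun i j => h _ _, List.ofFn_succ, List.prod_cons,
      mul_smul_comm, smul_smul]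
    simp [Function.comp_def]

/-- `iter` multiplies in reverse order, so it is an ordinary product in the opposite algebra, where
the commutation signs are the same. -/
theorem iter_reorder {l : ℕ} (σ : Equiv.Perm (Fin l)) (v : Fin l → R) (e : Fin l → ℤ)
    (h : ∀ i j, v i * v j = sgn K (e i * e j) • (v j * v i)) :
    iter v = koszul K σ e • iter (v ∘ σ) := by
  have key : ∀ w : Fin l → R, MulOpposite.op (iter w) =
      (List.ofFn fun i => MulOpposite.op (w i)).prod := by
    intro w
    rw [iter, MulOpposite.op_list_prod, List.map_reverse, List.reverse_reverse, List.map_ofFn]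
    rfl
  apply MulOpposite.op_injective
  rw [MulOpposite.op_smul, key, key]
  refine prod_reorder σ _ e fun i j => ?_
  rw [← MulOpposite.op_mul, ← MulOpposite.op_mul, ← MulOpposite.op_smul, h j i, mul_comm (e j)]

/-- Expansion of a derivation applied to a product of generators. -/
theorem der_prod {l : ℕ} (D : R →ₗ[K] R) (v : Fin (l + 1) → R) (p : Fin (l + 1) → K) (d : ℤ)
    (e : Fin (l + 1) → ℤ)
    (h : ∀ j r, D (v j * r) = p j • r + sgn K (d * e j) • (v j * D r)) {r : R} (hr : D r = 0) :
    D ((List.ofFn v).prod * r) = ∑ k : Fin (l + 1), (p k *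
      ∏ i : Fin l, if k.succAbove i < k then sgn K (d * e (k.succAbove i)) else 1) •
        ((List.ofFn (v ∘ k.succAbove)).prod * r) := by
  induction l with
  | zero => simp [h, hr]
  | succ l ih =>
    rw [List.ofFn_succ, List.prod_cons, mul_assoc, h, Fin.sum_univ_succ]
    congr 1
    · simp [Function.comp_def]
    · rw [ih (fun i => v i.succ) (fun i => p i.succ) (fun i => e i.succ) fun j r => h _ r,
        Finset.mul_sum, Finset.smul_sum]
      refine Finset.sum_congr rfl fun k _ => ?_
      rw [List.ofFn_succ (f := v ∘ _), List.prod_cons, Fin.prod_univ_succ]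
      simp only [Function.comp_apply, Fin.succ_succAbove_zero, Fin.succ_pos, if_true,
        Fin.succ_succAbove_succ, Fin.succ_lt_succ_iff, mul_smul_comm, smul_smul, mul_assoc,
        Function.comp_def]
      congr 1
      ring

/-- The pairing of a word of derivations with a word of generators. -/
theorem iter_prod {l : ℕ} (D : Fin l → Module.End K R) (v : Fin l → R) (p : Fin l → Fin l → K)
    (d e : Fin l → ℤ)
    (h : ∀ i j r, D i (v j * r) = p i j • r + sgn K (d i * e j) • (v j * D i r))
    (hp : ∀ i j, p i j ≠ 0 → Even (d i - e j)) {r : R} (hr : ∀ i, D i r = 0) :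
    iter D ((List.ofFn v).prod * r) =
      (∑ σ : Equiv.Perm (Fin l), koszul K σ e * ∏ j, p j (σ j)) • r := by
  induction l with
  | zero => simp [iter_zero, koszul_zero]
  | succ l ih =>
    rw [iter_succ, Module.End.mul_apply, der_prod (D 0) v (p 0) (d 0) e (h 0) (hr 0), map_sum,
      sum_perm_succ, Finset.sum_smul]
    refine Finset.sum_congr rfl fun k _ => ?_
    rw [map_smul, ih (fun i => D i.succ) (v ∘ k.succAbove) (fun i j => p i.succ (k.succAbove j))
      (fun i => d i.succ) (e ∘ k.succAbove) (fun i j r => h _ _ r) (fun i j => hp _ _)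
      fun i => hr _, smul_smul]
    congr 1
    rw [Finset.mul_sum]
    refine Finset.sum_congr rfl fun τ _ => ?_
    rw [koszul_consPerm, Fin.prod_univ_succ]
    simp only [consPerm_zero, consPerm_succ]
    -- The derivation passes letters with the sign of its own degree, while the Koszul sign uses the
    -- degree of the letter `k` that it hits. A nonzero pairing forces the two parities to agree.
    by_cases h0 : p 0 k = 0
    · simp [h0]
    · have : ∀ i : Fin l, sgn K (d 0 * e (k.succAbove i)) = sgn K (e k * e (k.succAbove i)) := by
        intro i
        refine sgn_eq ?_
        rw [← sub_mul]
        exact (hp 0 k h0).mul_right _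
      simp only [this]
      ring

/-- Every derivation consumes one letter. With too few letters a derivation meets 1; with too many,
a letter is left in front and `φ` kills it. -/
theorem iter_prod_eq_zero {N l : ℕ} (D : Fin N → Module.End K R) (v : Fin l → R)
    (p : Fin N → Fin l → K) (d : Fin N → ℤ) (e : Fin l → ℤ)
    (h : ∀ i j r, D i (v j * r) = p i j • r + sgn K (d i * e j) • (v j * D i r))
    (hr : ∀ i, D i 1 = 0) {X : Type*} [AddCommGroup X] [Module K X] (φ : R →ₗ[K] X)
    (hφ : ∀ j r, φ (v j * r) = 0) (hl : l ≠ N) : φ (iter D (List.ofFn v).prod) = 0 := by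
  induction N generalizing l with
  | zero =>
    cases l with
    | zero => exact absurd rfl hl
    | succ l => rw [iter_zero, Module.End.one_apply, List.ofFn_succ, List.prod_cons, hφ]
  | succ N ih =>
    rw [iter_succ, Module.End.mul_apply]
    cases l with
    | zero => simp [hr]
    | succ l =>
      rw [← mul_one (List.ofFn v).prod, der_prod (D 0) v (p 0) (d 0) e (h 0) (hr 0), map_sum,
        map_sum]
      refine Finset.sum_eq_zero fun k _ => ?_
      rw [map_smul, map_smul, mul_one,
        ih (fun i => D i.succ) (v ∘ k.succAbove) (fun i j => p i.succ (k.succAbove j))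
          (fun i => d i.succ) (e ∘ k.succAbove) (fun i j r => h _ _ r) (fun i => hr _)
          (fun j r => hφ _ r) (by omega), smul_zero]

/-- The sign of the splitting of a word of degrees `d` into the letters selected by `c` and the
remaining ones. -/
def splitSign (K : Type*) [Field K] {N : ℕ} (d : Fin N → ℤ) (c : Fin N → Bool) : K :=
  ∏ i : Fin N, ∏ j : Fin N, if i < j ∧ c i = true ∧ c j = false then sgn K (d i * d j) else 1

theorem splitSign_cons {N : ℕ} (d : Fin (N + 1) → ℤ) (a : Bool) (c : Fin N → Bool) :
    splitSign K d (Fin.cons a c : Fin (N + 1) → Bool) =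
      (if a then sgn K (d 0 * ∑ i : Fin N, if c i then 0 else d i.succ) else 1) *
        splitSign K (d ∘ Fin.succ) c := by
  unfold splitSign
  rw [Fin.prod_univ_succ, Fin.prod_univ_succ]
  congr 1
  · simp only [lt_irrefl, false_and, if_false, one_mul, Fin.cons_zero, Fin.cons_succ, Fin.succ_pos,
      true_and]
    cases a
    · simp
    · rw [Finset.mul_sum, sgn_sum]
      refine Finset.prod_congr rfl fun i _ => ?_
      cases c i <;> simp [sgn_zero]
  · refine Finset.prod_congr rfl fun i _ => ?_
    rw [Fin.prod_univ_succ]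
    simp

theorem sum_fun_bool_succ {N : ℕ} {X : Type*} [AddCommMonoid X]
    (f : (Fin (N + 1) → Bool) → X) :
    ∑ c, f c = ∑ c, f (Fin.cons true c : Fin (N + 1) → Bool) +
      ∑ c, f (Fin.cons false c : Fin (N + 1) → Bool) := by
  rw [← (Fin.consEquiv fun _ : Fin (N + 1) => Bool).sum_comp, Fintype.sum_prod_type,
    Fintype.sum_bool]
  rfl

/-- The Leibniz rule for a word of derivations. -/
theorem iter_mul {deg : ℤ → Submodule K R} {N : ℕ} (D : Fin N → Module.End K R) (d : Fin N → ℤ)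
    (hdeg : ∀ i k, ∀ P ∈ deg k, D i P ∈ deg (k - d i))
    (hmul : ∀ i k, ∀ P ∈ deg k, ∀ Q, D i (P * Q) = D i P * Q + sgn K (d i * k) • (P * D i Q))
    {k : ℤ} {P : R} (hP : P ∈ deg k) (Q : R) :
    iter D (P * Q) = ∑ c : Fin N → Bool,
      (sgn K (k * ∑ i, if c i then 0 else d i) * splitSign K d c) •
        (iter (fun i => if c i then D i else 1) P * iter (fun i => if c i then 1 else D i) Q) := by
  induction N generalizing k P Q with
  | zero => simp [iter_zero, splitSign, sgn_zero]
  | succ N ih =>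
    rw [iter_succ, Module.End.mul_apply, hmul 0 k P hP, map_add, map_smul,
      ih _ (fun i => d i.succ) (fun i => hdeg _) (fun i => hmul _) (hdeg 0 k P hP),
      ih _ (fun i => d i.succ) (fun i => hdeg _) (fun i => hmul _) hP, sum_fun_bool_succ,
      Finset.smul_sum]
    congr 1
    · refine Finset.sum_congr rfl fun c _ => ?_
      rw [iter_succ (N := N), iter_succ (N := N), splitSign_cons, Fin.sum_univ_succ]
      simp only [Fin.cons_zero, Fin.cons_succ, if_true, Module.End.mul_apply, Module.End.one_apply,
        zero_add]
      rw [← mul_assoc, ← sgn_add]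
      congr 2
      -- Applying `D 0` to `P` lowers its degree by `d 0`, which changes the prefactor by exactly
      -- the sign that `splitSign_cons` adds for a selected first letter.
      exact sgn_eq ⟨-(d 0 * ∑ i : Fin N, if c i then 0 else d i.succ), by ring⟩
    · refine Finset.sum_congr rfl fun c _ => ?_
      rw [iter_succ (N := N), iter_succ (N := N), splitSign_cons, Fin.sum_univ_succ]
      simp only [Fin.cons_zero, Fin.cons_succ, Module.End.mul_apply, Module.End.one_apply,
        Bool.false_eq_true, if_false, one_mul]
      rw [smul_smul, ← mul_assoc, ← sgn_add]
      congr 2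
      exact sgn_eq ⟨0, by ring⟩

end

/-! ### Shuffles as choices of subsets, and their signs. -/

section Shuffles
variable {p q : ℕ}

theorem mem_Sh {σ : Equiv.Perm (Fin (p + q))} : σ ∈ Sh p q ↔
    (StrictMono fun i : Fin p => σ (Fin.castAdd q i)) ∧
      StrictMono fun j : Fin q => σ (Fin.natAdd p j) := by
  simp [Sh]

/-- The elements which a permutation moves to one of the first `p` places. -/
def firstBlock (σ : Equiv.Perm (Fin (p + q))) (i : Fin (p + q)) : Bool := decide ((σ.symm i : ℕ) < p)

theorem firstBlock_castAdd (σ : Equiv.Perm (Fin (p + q))) (i : Fin p) :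
    firstBlock σ (σ (Fin.castAdd q i)) = true := by
  simp [firstBlock]

theorem firstBlock_natAdd (σ : Equiv.Perm (Fin (p + q))) (i : Fin q) :
    firstBlock σ (σ (Fin.natAdd p i)) = false := by
  simp [firstBlock]

/-- Both lists are increasing and have the same entries; the shuffle condition is what makes the
right one increasing. -/
theorem filter_firstBlock {σ : Equiv.Perm (Fin (p + q))} (hσ : σ ∈ Sh p q) :
    (List.finRange (p + q)).filter (firstBlock σ) = List.ofFn fun i => σ (Fin.castAdd q i) := by
  have h2 := ((mem_Sh.1 hσ).1.sortedLT_ofFn).pairwise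
  have h1 := (List.pairwise_lt_finRange (p + q)).filter (firstBlock σ)
  refine List.Perm.eq_of_pairwise' (r := (· < ·)) h1 h2 ?_
  rw [List.perm_ext_iff_of_nodup (h1.imp fun h => h.ne) (h2.imp fun h => h.ne)]
  intro a
  obtain ⟨b, rfl⟩ := σ.surjective a
  refine Fin.addCases (fun i => ?_) (fun i => ?_) b
  · simp [firstBlock_castAdd, List.mem_ofFn]
  · simp only [List.mem_filter, List.mem_finRange, firstBlock_natAdd, List.mem_ofFn]
    simp only [Bool.false_eq_true, and_false, EmbeddingLike.apply_eq_iff_eq, false_iff, not_exists]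
    intro j hj
    have := congrArg Fin.val hj
    simp at this
    omega

theorem filter_not_firstBlock {σ : Equiv.Perm (Fin (p + q))} (hσ : σ ∈ Sh p q) :
    (List.finRange (p + q)).filter (fun i => !firstBlock σ i) =
      List.ofFn fun i => σ (Fin.natAdd p i) := by
  have h2 := ((mem_Sh.1 hσ).2.sortedLT_ofFn).pairwise
  have h1 := (List.pairwise_lt_finRange (p + q)).filter fun i => !firstBlock σ i
  refine List.Perm.eq_of_pairwise' (r := (· < ·)) h1 h2 ?_
  rw [List.perm_ext_iff_of_nodup (h1.imp fun h => h.ne) (h2.imp fun h => h.ne)]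
  intro a
  obtain ⟨b, rfl⟩ := σ.surjective a
  refine Fin.addCases (fun i => ?_) (fun i => ?_) b
  · simp only [List.mem_filter, List.mem_finRange, firstBlock_castAdd, List.mem_ofFn]
    simp only [Bool.not_true, Bool.false_eq_true, and_false, EmbeddingLike.apply_eq_iff_eq,
      false_iff, not_exists]
    intro j hj
    have := congrArg Fin.val hj
    simp at this
    omega
  · simp [firstBlock_natAdd, List.mem_ofFn]

theorem iter_firstBlock {R : Type*} [Monoid R] {σ : Equiv.Perm (Fin (p + q))} (hσ : σ ∈ Sh p q)
    (D : Fin (p + q) → R) :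
    iter (fun i => if firstBlock σ i then D i else 1) = iter fun i => D (σ (Fin.castAdd q i)) := by
  rw [iter_eq_filter, filter_firstBlock hσ, iter, List.map_ofFn]
  rfl

theorem iter_not_firstBlock {R : Type*} [Monoid R] {σ : Equiv.Perm (Fin (p + q))}
    (hσ : σ ∈ Sh p q) (D : Fin (p + q) → R) :
    iter (fun i => if firstBlock σ i then 1 else D i) = iter fun i => D (σ (Fin.natAdd p i)) := by
  have h := iter_eq_filter D fun i => !firstBlock σ i
  rw [filter_not_firstBlock hσ] at h
  rw [List.map_ofFn] at h
  refine Eq.trans ?_ h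
  congr 1
  ext i
  cases firstBlock σ i <;> simp

theorem sum_not_firstBlock (σ : Equiv.Perm (Fin (p + q))) (d : Fin (p + q) → ℤ) :
    (∑ i, if firstBlock σ i then 0 else d i) = ∑ i : Fin q, d (σ (Fin.natAdd p i)) := by
  rw [← Equiv.sum_comp σ, Fin.sum_univ_add]
  simp [firstBlock_castAdd, firstBlock_natAdd]

/-- The inversions of a shuffle are pairs with one letter in each block. Such a mixed pair is either
inverted, and counted by `koszul`, or in order, and counted by `splitSign`; the last factor is the
product over all mixed pairs. -/
theorem splitSign_firstBlock {σ : Equiv.Perm (Fin (p + q))} (hσ : σ ∈ Sh p q)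
    (d : Fin (p + q) → ℤ) : splitSign K d (firstBlock σ) = koszul K σ d *
      sgn K ((∑ i : Fin p, d (σ (Fin.castAdd q i))) * ∑ i : Fin q, d (σ (Fin.natAdd p i))) := by
  have h1 : splitSign K d (firstBlock σ) = ∏ i : Fin p, ∏ j : Fin q,
      if σ (Fin.castAdd q i) < σ (Fin.natAdd p j) then
        sgn K (d (σ (Fin.castAdd q i)) * d (σ (Fin.natAdd p j))) else 1 := by
    unfold splitSign
    rw [← Equiv.prod_comp σ]
    have h0 : ∀ i : Fin (p + q), (∏ j, if i < j ∧ firstBlock σ i = true ∧ firstBlock σ j = false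
      then sgn K (d i * d j) else 1) = ∏ j, if i < σ j ∧ firstBlock σ i = true ∧
        firstBlock σ (σ j) = false then sgn K (d i * d (σ j)) else 1 := fun i =>
      (Equiv.prod_comp σ fun j => if i < j ∧ firstBlock σ i = true ∧ firstBlock σ j = false
        then sgn K (d i * d j) else 1).symm
    rw [Finset.prod_congr rfl fun i _ => h0 (σ i)]
    simp only [Fin.prod_univ_add, firstBlock_castAdd, firstBlock_natAdd]
    simp
  have h2 : koszul K σ d = ∏ i : Fin p, ∏ j : Fin q,
      if σ (Fin.natAdd p j) < σ (Fin.castAdd q i) then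
        sgn K (d (σ (Fin.castAdd q i)) * d (σ (Fin.natAdd p j))) else 1 := by
    unfold koszul
    simp only [Fintype.prod_prod_type, Fin.prod_univ_add]
    have e1 : ∀ i j : Fin p, ¬ (Fin.castAdd q i < Fin.castAdd q j ∧
        σ (Fin.castAdd q j) < σ (Fin.castAdd q i)) := by
      rintro i j ⟨h, h'⟩
      exact lt_asymm ((mem_Sh.1 hσ).1 h) h'
    have e2 : ∀ i j : Fin q, ¬ (Fin.natAdd p i < Fin.natAdd p j ∧
        σ (Fin.natAdd p j) < σ (Fin.natAdd p i)) := by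
      rintro i j ⟨h, h'⟩
      exact lt_asymm ((mem_Sh.1 hσ).2 ((Fin.natAdd_lt_natAdd_iff p).1 h)) h'
    have e3 : ∀ (i : Fin q) (j : Fin p), ¬ (Fin.natAdd p i < Fin.castAdd q j) := by
      intro i j h
      rw [Fin.lt_def] at h
      simp at h
      omega
    have e4 : ∀ (i : Fin p) (j : Fin q), Fin.castAdd q i < Fin.natAdd p j := by
      intro i j
      rw [Fin.lt_def]
      simp
      omega
    simp only [e1, e2, e3, e4, if_false, true_and, false_and, Finset.prod_const_one, one_mul, mul_one]
  rw [h1, h2, Finset.sum_mul_sum, sgn_sum, ← Finset.prod_mul_distrib]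
  refine Finset.prod_congr rfl fun i _ => ?_
  rw [sgn_sum, ← Finset.prod_mul_distrib]
  refine Finset.prod_congr rfl fun j _ => ?_
  have hne : σ (Fin.castAdd q i) ≠ σ (Fin.natAdd p j) := by
    intro h
    have := congrArg Fin.val (σ.injective h)
    simp at this
    omega
  rcases lt_or_gt_of_ne hne with h | h
  · simp [h, not_lt.2 h.le]
  · simp [h, not_lt.2 h.le, sgn_mul_self]

/-- Shuffles correspond to the choices of `p` out of `p + q` elements. -/
theorem sum_choose_eq_sum_Sh {X : Type*} [AddCommMonoid X] (f : (Fin (p + q) → Bool) → X) :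
    ∑ c : Fin (p + q) → Bool with (Finset.univ.filter fun i => c i = true).card = p, f c =
      ∑ σ ∈ Sh p q, f (firstBlock σ) := by
  symm
  refine Finset.sum_bij (fun σ _ => firstBlock σ) ?_ ?_ ?_ fun _ _ => rfl
  · intro σ _
    rw [Finset.mem_filter]
    refine ⟨Finset.mem_univ _, ?_⟩
    rw [← Finset.card_map σ.symm.toEmbedding]
    have : (Finset.univ.filter fun i => firstBlock σ i = true).map σ.symm.toEmbedding =
        Finset.univ.filter fun i : Fin (p + q) => (i : ℕ) < p := by
      ext i
      simp only [Finset.mem_map, Finset.mem_filter, Finset.mem_univ, true_and,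
        Equiv.coe_toEmbedding, firstBlock, decide_eq_true_eq]
      constructor
      · rintro ⟨j, hj, rfl⟩; exact hj
      · intro hi; exact ⟨σ i, by simpa using hi, by simp⟩
    rw [this, Fin.card_filter_val_lt]
    omega
  · intro σ hσ τ hτ h
    have h1 := filter_firstBlock hσ
    have h2 := filter_not_firstBlock hσ
    change firstBlock σ = firstBlock τ at h
    rw [h] at h1 h2
    rw [filter_firstBlock hτ] at h1
    rw [filter_not_firstBlock hτ] at h2
    refine Equiv.ext fun i => ?_
    refine Fin.addCases (fun i => ?_) (fun i => ?_) i
    · exact (congrFun (List.ofFn_injective h1) i).symm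
    · exact (congrFun (List.ofFn_injective h2) i).symm
  · intro c hc
    rw [Finset.mem_filter] at hc
    set s := Finset.univ.filter fun i => c i = true with hs
    have hs' : sᶜ.card = q := by
      rw [Finset.card_compl, hc.2, Fintype.card_fin]
      omega
    -- The shuffle of a subset lists its elements in increasing order, followed by those of the
    -- complement.
    refine ⟨finSumFinEquiv.symm.trans (finSumEquivOfFinset hc.2 hs'), ?_, ?_⟩
    · rw [mem_Sh]
      constructor
      · intro i j h
        simpa using h
      · intro i j h
        simpa using h
    · ext i
      obtain ⟨a, rfl⟩ := (finSumFinEquiv.symm.trans (finSumEquivOfFinset hc.2 hs')).surjective i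
      refine Fin.addCases (fun i => ?_) (fun i => ?_) a
      · rw [firstBlock_castAdd]
        have := s.orderEmbOfFin_mem hc.2 i
        simp only [hs, Finset.mem_filter] at this
        simpa using this.2.symm
      · rw [firstBlock_natAdd]
        have := sᶜ.orderEmbOfFin_mem hs' i
        rw [Finset.mem_compl] at this
        have := Bool.eq_false_of_not_eq_true fun h =>
          this (Finset.mem_filter.2 ⟨Finset.mem_univ _, h⟩)
        simpa using this.symm

end Shuffles

end OrderedProducts

/-! ### The brackets and the differential on generators of the polyvectors. -/

section PolGenerators
variable {K : Type*} [Field K] {A : CDGA K} (n : ℤ)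

namespace Pol

theorem bracketA_leibniz {i k : ℤ} (a : A.gr i) {P : Pol A n} (hP : P ∈ deg A n k) (Q : Pol A n) :
    bracketA n a (P * Q) =
      bracketA n a P * Q + sgn K ((i - n - 1) * k) • (P * bracketA n a Q) :=
  DerData.toMap_mul _ hP Q

theorem bracketT_leibniz {i k : ℤ} (D : A.der i) {P : Pol A n} (hP : P ∈ deg A n k)
    (Q : Pol A n) :
    bracketT n D (P * Q) = bracketT n D P * Q + sgn K (i * k) • (P * bracketT n D Q) :=
  DerData.toMap_mul _ hP Q

theorem bracketA_ofA {i : ℤ} (a : A.gr i) (b : A.carrier) : bracketA n a (ofA A n b) = 0 :=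
  DerData.toMap_ofA _ _

theorem bracketA_ofT {i j : ℤ} (a : A.gr i) (D : A.der j) :
    bracketA n a (ofT A n j D) = -(sgn K (i * j) • ofA A n (D.1 a)) :=
  (twistedDer_gen _ _ _ _).trans (genMap_T _ _ D)

theorem bracketA_map_one {i : ℤ} (a : A.gr i) : bracketA n a 1 = 0 := DerData.toMap_one _

theorem bracketT_ofA {i : ℤ} (D : A.der i) (b : A.carrier) :
    bracketT n D (ofA A n b) = sgn K (i * (n + 1)) • ofA A n (D.1 b) :=
  DerData.toMap_ofA _ _

theorem bracketT_ofT {i j : ℤ} (D : A.der i) (E : A.der j) :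
    bracketT n D (ofT A n j E) = ofT A n (i + j) (CDGA.derBracket D E) :=
  (twistedDer_gen _ _ _ _).trans (genMap_T _ _ E)

theorem bracketT_map_one {i : ℤ} (D : A.der i) : bracketT n D 1 = 0 := DerData.toMap_one _

/-- The multiples of the derivation `bracketA`. -/
def smulBracketA (c : K) {i : ℤ} (a : A.gr i) : Pol A n →ₗ[K] Pol A n := c • bracketA n a

/-- The multiples of the derivation `bracketT`. -/
def smulBracketT (c : K) {i : ℤ} (D : A.der i) : Pol A n →ₗ[K] Pol A n := c • bracketT n D

theorem smulBracketA_apply (c : K) {i : ℤ} (a : A.gr i) (P : Pol A n) :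
    smulBracketA n c a P = c • bracketA n a P := rfl

theorem smulBracketT_apply (c : K) {i : ℤ} (D : A.der i) (P : Pol A n) :
    smulBracketT n c D P = c • bracketT n D P := rfl

theorem diff_ofA_mul {i : ℤ} (a : A.gr i) (P : Pol A n) :
    diff A n (ofA A n a * P) = ofA A n (A.d a) * P + sgn K i • (ofA A n a * diff A n P) := by
  have h1 : diff A n (ofA A n a * P) = _ := DerData.toMap_mul (diffData A n) (ofA_mem_deg a) P
  have h2 : (diffData A n).toMap (ofA A n a) = ofA A n (A.d a) := DerData.toMap_ofA _ _
  rw [h1, h2, one_mul]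
  rfl

theorem diff_ofT_mul {i : ℤ} (D : A.der i) (P : Pol A n) :
    diff A n (ofT A n i D * P) = (sgn K (n + 1) • ofT A n (i + 1) (CDGA.derDiff i D)) * P +
      sgn K (i + n + 1) • (ofT A n i D * diff A n P) := by
  have h1 : diff A n (ofT A n i D * P) = _ := DerData.toMap_ofT_mul (diffData A n) D P
  rw [h1, one_mul]
  rfl

theorem diff_map_one : diff A n 1 = 0 := DerData.toMap_one _

/-- By antisymmetry the value of `{P, -}` on a generator is a bracket with that generator evaluated
at `P`. These brackets become the partial derivatives, so this form exhibits the bracket as a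
bidifferential operator. -/
theorem schouten_ofA_mul {i k : ℤ} (P : deg A n k) (a : A.gr i) (Q : Pol A n) :
    schouten n k P (ofA A n a * Q) =
      (-sgn K ((k - n - 1) * (i - n - 1))) • (bracketA n a P * Q) +
        sgn K ((k - n - 1) * i) • (ofA A n a * schouten n k P Q) := by
  have h2 : schouten n k P (ofA A n a) = schoutenA n k P a := DerData.toMap_ofA _ _
  rw [schouten_mul n P (ofA_mem_deg a), h2, schoutenA_of_mem, neg_smul_mul, neg_smul_pol]

theorem schouten_ofT_mul {i k : ℤ} (P : deg A n k) (D : A.der i) (Q : Pol A n) :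
    schouten n k P (ofT A n i D * Q) =
      (-sgn K ((k - n - 1) * i)) • (bracketT n D P * Q) +
        sgn K ((k - n - 1) * (i + n + 1)) • (ofT A n i D * schouten n k P Q) := by
  have h2 : schouten n k P (ofT A n i D) = schoutenT n k P i D :=
    (twistedDer_gen _ _ _ _).trans (genMap_T _ _ D)
  rw [schouten_mul n P (ofT_mem_deg D), h2, schoutenT_apply, neg_smul_mul, neg_smul_pol]

theorem schouten_map_one {k : ℤ} (P : deg A n k) : schouten n k P 1 = 0 := DerData.toMap_one _

end Pol
end PolGenerators

/-! ### Homogeneous bases, augmentations and partial derivatives for the free algebra. -/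

section FreePol
variable {K : Type*} [Field K]

/-- A basis of homogeneous elements. -/
structure HomBasis (g : Cochain K) (ι : Type*) where
  b : Module.Basis ι K g.carrier
  dg : ι → ℤ
  mem : ∀ i, b i ∈ g.gr (dg i)

theorem exists_homBasis (g : Cochain K) [Module.Finite K g.carrier] :
    ∃ r : ℕ, Nonempty (HomBasis g (Fin r)) := by
  let B := g.isInternal.collectedBasis fun i => Module.Basis.ofVectorSpace K (g.gr i)
  have : Finite (Σ i, Module.Basis.ofVectorSpaceIndex K (g.gr i)) := Module.Finite.finite_basis B
  have := Fintype.ofFinite (Σ i, Module.Basis.ofVectorSpaceIndex K (g.gr i))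
  let e := Fintype.equivFin (Σ i, Module.Basis.ofVectorSpaceIndex K (g.gr i))
  refine ⟨_, ⟨⟨B.reindex e, fun k => (e.symm k).1, fun k => ?_⟩⟩⟩
  rw [Module.Basis.reindex_apply]
  exact g.isInternal.collectedBasis_mem _ _

namespace HomBasis
variable {g : Cochain K} {ι : Type*} (B : HomBasis g ι)

theorem coord_mem (i : ι) : B.b.coord i ∈ g.dualGr (-B.dg i) := by
  intro j hj v hv
  by_contra h
  -- Precomposing a coordinate with the projection to degree `k` gives the coordinate or zero,
  -- according to the degree of its basis vector; this can be tested on the basis.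
  have h2 : ∀ k, B.b.coord i ∘ₗ gradedMap g.isInternal (fun a => if a = k then (g.gr a).subtype
    else 0) = if B.dg i = k then B.b.coord i else 0 := by
    intro k
    refine B.b.ext fun l => ?_
    rw [LinearMap.comp_apply, gradedMap_of_mem _ _ (B.mem l)]
    by_cases hl : l = i
    · subst hl
      split_ifs <;> simp
    · split_ifs <;> simp [hl]
  have h3 := LinearMap.congr_fun (h2 j) v
  rw [LinearMap.comp_apply, gradedMap_of_mem _ _ hv, if_pos rfl, if_neg (by omega)] at h3
  exact h h3

theorem coord_eq_zero {i : ι} {e : ℤ} {x : g.carrier} (hx : x ∈ g.gr e) (h : B.dg i ≠ e) :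
    B.b.coord i x = 0 :=
  B.coord_mem i e (by omega) x hx

theorem apply_eq_zero {i : ι} {f : ℤ} {θ : Module.Dual K g.carrier} (hθ : θ ∈ g.dualGr f)
    (h : f ≠ -B.dg i) : θ (B.b i) = 0 :=
  hθ _ (by omega) _ (B.mem i)

end HomBasis

theorem Sym.aug_rel (W : Cochain K) ⦃x y⦄ (h : SymRel W x y) :
    TensorAlgebra.lift K (0 : W.carrier →ₗ[K] K) x =
      TensorAlgebra.lift K (0 : W.carrier →ₗ[K] K) y := by
  obtain ⟨hv, hw⟩ := h
  simp

/-- The augmentation of a symmetric algebra. -/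
def Sym.aug (W : Cochain K) : Sym W →ₐ[K] K := Presented.lift _ (Sym.aug_rel W)

theorem Sym.aug_ι (W : Cochain K) (w : W.carrier) : Sym.aug W (Sym.ι W w) = 0 := by
  refine (Presented.lift_mk _ _ _).trans ?_
  simp

theorem Sym.aug_of_mem (W : Cochain K) {i : ℤ} (hi : i ≠ 0) {x : Sym W} (hx : x ∈ Sym.gr W i) :
    Sym.aug W x = 0 := by
  have : ∀ {i : ℤ} {x : Sym W}, x ∈ Sym.gr W i → i ≠ 0 → Sym.aug W x = 0 := by
    intro i x hx
    induction hx using Sym.gr_induction with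
    | one => exact fun h => absurd rfl h
    | zero i => simp
    | add i x y _ _ hx hy => intro h; rw [map_add, hx h, hy h, add_zero]
    | smul i c x _ hx => intro h; rw [map_smul, hx h, smul_zero]
    | mul i j w x hw _ hx => intro _; rw [map_mul, Sym.aug_ι, zero_mul]
  exact this hx hi

variable (g : Cochain K) [Module.Finite K g.carrier] (n : ℤ)

/-- The augmentation of the free algebra. -/
def freeAug : (freeAlg g).carrier →ₐ[K] K := Sym.aug (dualShift g)

theorem freeAug_sTheta (θ : Module.Dual K g.carrier) : freeAug g (sTheta g θ) = 0 :=
  Sym.aug_ι (dualShift g) θ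

namespace Pol

theorem aug_rel ⦃x y⦄ (h : PolRel (freeAlg g) n x y) :
    TensorAlgebra.lift K (genMap (A := freeAlg g) (freeAug g).toLinearMap
      fun _ => 0) x =
    TensorAlgebra.lift K (genMap (A := freeAlg g) (freeAug g).toLinearMap
      fun _ => 0) y := by
  have hA : ∀ a, TensorAlgebra.lift K (genMap (A := freeAlg g)
      (freeAug g).toLinearMap fun _ => 0) (preA (freeAlg g) a) =
        freeAug g a := by
    intro a
    refine (TensorAlgebra.lift_ι_apply _ _).trans ?_
    rw [genMap_A]
    rfl
  have hT : ∀ i D, TensorAlgebra.lift K (genMap (A := freeAlg g)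
      (freeAug g).toLinearMap fun _ => 0) (preT (freeAlg g) i D) = 0 := by
    intro i D
    refine (TensorAlgebra.lift_ι_apply _ _).trans ?_
    rw [genMap_T]
    rfl
  induction h with
  | one => rw [hA, map_one, map_one]
  | mul a b => rw [map_mul, hA, hA, hA, map_mul]
  | smul a D => rw [map_mul, map_smul, hT, hT, mul_zero, smul_zero]
  | comm_A_T a D => rw [map_mul, map_smul, map_mul, hT, mul_zero, zero_mul, smul_zero]
  | comm_T_T D E => rw [map_mul, map_smul, map_mul, hT, zero_mul, hT, zero_mul, smul_zero]

/-- The augmentation of the algebra of polyvectors. -/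
def aug : Pol (freeAlg g) n →ₐ[K] K := Presented.lift _ (aug_rel g n)

theorem aug_ofA (a : (freeAlg g).carrier) :
    aug g n (ofA (freeAlg g) n a) = freeAug g a := by
  refine (Presented.lift_mk _ _ _).trans ?_
  refine (TensorAlgebra.lift_ι_apply _ _).trans ?_
  rw [genMap_A]
  rfl

theorem aug_ofT {i : ℤ} (D : (freeAlg g).der i) : aug g n (ofT (freeAlg g) n i D) = 0 := by
  refine (Presented.lift_mk _ _ _).trans ?_
  refine (TensorAlgebra.lift_ι_apply _ _).trans ?_
  rw [genMap_T]
  rfl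

theorem aug_of_mem_deg {i : ℤ} (hi : i ≠ 0) {P : Pol (freeAlg g) n}
    (hP : P ∈ deg (freeAlg g) n i) : aug g n P = 0 := by
  have : ∀ {i : ℤ} {P : Pol (freeAlg g) n}, P ∈ deg (freeAlg g) n i → i ≠ 0 →
      aug g n P = 0 := by
    intro i P hP
    induction hP using deg_induction with
    | ofA i a =>
      intro h
      rw [aug_ofA]
      exact Sym.aug_of_mem (dualShift g) h a.2
    | zero i => simp
    | add i x y _ _ hx hy => intro h; rw [map_add, hx h, hy h, add_zero]
    | smul i c x _ hx => intro h; rw [map_smul, hx h, smul_zero]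
    | ofT_mul i j D x _ hx => intro _; rw [map_mul, aug_ofT, zero_mul]
  exact this hP hi

theorem aug_of_mem_gr {m : ℕ} {i : ℤ} {P : Pol (freeAlg g) n}
    (hP : P ∈ gr (freeAlg g) n (m + 1) i) : aug g n P = 0 := by
  induction hP using Submodule.span_induction with
  | mem P h =>
    cases h with
    | cons D h => rw [map_mul, aug_ofT, zero_mul]
  | zero => simp
  | add x y _ _ hx hy => rw [map_add, hx, hy, add_zero]
  | smul c x _ hx => rw [map_smul, hx, smul_zero]

end Pol

variable {g}

theorem sTheta_mem {i : ℤ} {θ : Module.Dual K g.carrier} (hθ : θ ∈ g.dualGr i) :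
    sTheta g θ ∈ (freeAlg g).gr (i + 1) := by
  refine Sym.ι_mem (W := dualShift g) ?_
  change θ ∈ g.dualGr (i + 1 + -1)
  rwa [add_neg_cancel_right]

/-- A derivation kills 1 and obeys the Leibniz rule, so it is determined by its values on
generators. -/
theorem freeAlg_der_ext {i : ℤ} {D E : (freeAlg g).der i}
    (h : ∀ j, ∀ θ ∈ g.dualGr j, D.1 (sTheta g θ) = E.1 (sTheta g θ)) : D = E := by
  refine Subtype.ext (hom_ext_of_internal (freeAlg g).isInternal fun k a ha => ?_)
  change a ∈ Sym.gr (dualShift g) k at ha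
  induction ha using Sym.gr_induction with
  | one => exact (CDGA.der_map_one D).trans (CDGA.der_map_one E).symm
  | zero i => exact (map_zero D.1).trans (map_zero E.1).symm
  | add i x y _ _ hx hy =>
    exact (map_add D.1 x y).trans ((congrArg₂ (· + ·) hx hy).trans (map_add E.1 x y).symm)
  | smul i c x _ hx =>
    exact (map_smul D.1 c x).trans ((congrArg (c • ·) hx).trans (map_smul E.1 c x).symm)
  | mul i j w x hw hx0 hx =>
    have h1 := D.2.2 i _ (Sym.ι_mem hw) x
    have h2 := E.2.2 i _ (Sym.ι_mem hw) x
    have h3 := h _ w hw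
    change D.1 (Sym.ι (dualShift g) w) = E.1 (Sym.ι (dualShift g) w) at h3
    refine h1.trans (Eq.trans ?_ h2.symm)
    rw [h3, hx]

theorem freeAlg_induction {C : (freeAlg g).carrier → Prop} (h1 : C 1)
    (hadd : ∀ x y, C x → C y → C (x + y)) (hsmul : ∀ (c : K) x, C x → C (c • x))
    (hmul : ∀ θ x, C x → C (sTheta g θ * x)) (a : (freeAlg g).carrier) : C a :=
  presented_induction (r := SymRel (dualShift g)) h1 hadd hsmul hmul a

theorem freeAlg_gr_induction {C : ℤ → (freeAlg g).carrier → Prop} (one : C 0 1)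
    (zero : ∀ i, C i 0) (add : ∀ i x y, C i x → C i y → C i (x + y))
    (smul : ∀ i (c : K) x, C i x → C i (c • x))
    (mul : ∀ i j θ x, θ ∈ g.dualGr i → C j x → C (i + 1 + j) (sTheta g θ * x))
    {i : ℤ} {a : (freeAlg g).carrier} (ha : a ∈ (freeAlg g).gr i) : C i a :=
  Sym.gr_induction (W := dualShift g) (C := fun i x _ => C i x) one zero
    (fun i x y _ _ => add i x y) (fun i c x _ => smul i c x)
    (fun i j w x hw _ hx => by
      have := mul (i + -1) j w x hw hx
      rwa [show i + -1 + 1 + j = i + j by ring] at this) ha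

/-- Each contraction sends generators to constants, and derivations kill constants. -/
theorem contraction_comm {e f : ℤ} (x : g.gr e) (y : g.gr f) :
    CDGA.derBracket (contraction g x) (contraction g y) = 0 := by
  refine freeAlg_der_ext fun j θ hθ => ?_
  have h0 : ∀ {k} (D : (freeAlg g).der k) (c : K), D.1 (algebraMap K _ c) = 0 := by
    intro k D c
    rw [Algebra.algebraMap_eq_smul_one, map_smul, CDGA.der_map_one, smul_zero]
  simp [CDGA.derBracket, contraction_sTheta, h0]

namespace HomBasis
variable {ι : Type*} (B : HomBasis g ι)

/-- The elements `s θ^i` of the free algebra. -/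
def y (i : ι) : (freeAlg g).gr (-B.dg i + 1) := ⟨sTheta g (B.b.coord i), sTheta_mem (B.coord_mem i)⟩

/-- The derivations `s⁻¹ b_i`. -/
def D (i : ι) : (freeAlg g).der (B.dg i - 1) := contraction g ⟨B.b i, B.mem i⟩

/-- The polyvectors `s^n b_i`. -/
def X (i : ι) : Pol (freeAlg g) n := Pol.ofT (freeAlg g) n _ (B.D i)

/-- The polyvectors `s θ^i`. -/
def Y (i : ι) : Pol (freeAlg g) n := Pol.ofA (freeAlg g) n (B.y i)

/-- The derivation along `s^n b_i`. -/
def dX (i : ι) : Module.End K (Pol (freeAlg g) n) :=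
  Pol.smulBracketA n (sgn K (B.dg i)) (B.y i)

/-- The derivation along `s θ^i`. -/
def dY (i : ι) : Module.End K (Pol (freeAlg g) n) :=
  Pol.smulBracketT n (sgn K ((B.dg i - 1) * (n + 1))) (B.D i)

theorem dX_mem_deg (i : ι) {k : ℤ} {P : Pol (freeAlg g) n} (hP : P ∈ Pol.deg (freeAlg g) n k) :
    B.dX n i P ∈ Pol.deg (freeAlg g) n (k - (B.dg i + n)) := by
  have := Pol.bracketA_mem n (B.y i) hP
  rw [show k + (-B.dg i + 1 - n - 1) = k - (B.dg i + n) by ring] at this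
  exact Submodule.smul_mem _ _ this

theorem dY_mem_deg (i : ι) {k : ℤ} {P : Pol (freeAlg g) n} (hP : P ∈ Pol.deg (freeAlg g) n k) :
    B.dY n i P ∈ Pol.deg (freeAlg g) n (k - (1 - B.dg i)) := by
  have := Pol.bracketT_mem n (B.D i) hP
  rw [show k + (B.dg i - 1) = k - (1 - B.dg i) by ring] at this
  exact Submodule.smul_mem _ _ this

theorem dX_mul (i : ι) {k : ℤ} {P : Pol (freeAlg g) n} (hP : P ∈ Pol.deg (freeAlg g) n k)
    (Q : Pol (freeAlg g) n) :
    B.dX n i (P * Q) = B.dX n i P * Q + sgn K ((B.dg i + n) * k) • (P * B.dX n i Q) := by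
  simp only [dX, Pol.smulBracketA_apply, Pol.bracketA_leibniz n _ hP, smul_add, smul_mul_assoc,
    mul_smul_comm]
  congr 1
  rw [smul_comm]
  exact Pol.sgn_smul_congr ⟨-(B.dg i + n) * k, by ring⟩ _

theorem dY_mul (i : ι) {k : ℤ} {P : Pol (freeAlg g) n} (hP : P ∈ Pol.deg (freeAlg g) n k)
    (Q : Pol (freeAlg g) n) :
    B.dY n i (P * Q) = B.dY n i P * Q + sgn K ((1 - B.dg i) * k) • (P * B.dY n i Q) := by
  simp only [dY, Pol.smulBracketT_apply, Pol.bracketT_leibniz n _ hP, smul_add, smul_mul_assoc,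
    mul_smul_comm]
  congr 1
  rw [smul_comm]
  exact Pol.sgn_smul_congr ⟨(B.dg i - 1) * k, by ring⟩ _

theorem dX_ofA (i : ι) (a : (freeAlg g).carrier) : B.dX n i (Pol.ofA (freeAlg g) n a) = 0 := by
  rw [dX, Pol.smulBracketA_apply, Pol.bracketA_ofA, smul_zero]

theorem dX_one (i : ι) : B.dX n i 1 = 0 := by
  rw [dX, Pol.smulBracketA_apply, Pol.bracketA_map_one, smul_zero]

theorem dY_one (i : ι) : B.dY n i 1 = 0 := by
  rw [dY, Pol.smulBracketT_apply, Pol.bracketT_map_one, smul_zero]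

theorem dX_ofT_mul (i : ι) {j : ℤ} (E : (freeAlg g).der j) (P : Pol (freeAlg g) n) :
    B.dX n i (Pol.ofT (freeAlg g) n j E * P) =
      -sgn K (B.dg i + (1 - B.dg i) * j) • (Pol.ofA (freeAlg g) n (E.1 (B.y i)) * P) +
        sgn K ((B.dg i + n) * (j + n + 1)) • (Pol.ofT (freeAlg g) n j E * B.dX n i P) := by
  rw [dX_mul n B i (Pol.ofT_mem_deg E)]
  congr 1
  rw [dX, Pol.smulBracketA_apply, Pol.bracketA_ofT, smul_neg, smul_smul, ← sgn_add, Pol.neg_smul_pol,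
    Pol.neg_smul_mul]
  exact congrArg Neg.neg (Pol.sgn_smul_congr ⟨0, by ring⟩ _)

/-- The reason for the factor `sgn K (B.dg i)` in `dX`: it makes `dX i` the partial derivative along
s^n b_i without a sign. If |x| ≠ |b_i| the coordinate of `x` vanishes; otherwise the accumulated
exponent is odd and cancels the minus sign of the bracket. -/
theorem dX_contraction_mul (i : ι) {e : ℤ} (x : g.gr e) (P : Pol (freeAlg g) n) :
    B.dX n i (Pol.ofT (freeAlg g) n _ (contraction g x) * P) =
      B.b.coord i x • P + sgn K ((B.dg i + n) * (e + n)) •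
        (Pol.ofT (freeAlg g) n _ (contraction g x) * B.dX n i P) := by
  rw [dX_ofT_mul, show e - 1 + n + 1 = e + n by ring]
  congr 1
  rw [y, contraction_sTheta, Algebra.algebraMap_eq_smul_one, map_smul, Pol.ofA_one,
    smul_mul_assoc, one_mul, smul_smul]
  congr 1
  by_cases h : B.dg i = e
  · subst h
    rw [sgn_eq (b := 1), sgn_one, neg_neg, one_mul]
    have := Int.even_mul_succ_self (B.dg i - 1)
    rw [show B.dg i + (1 - B.dg i) * (B.dg i - 1) - 1 =
      -((B.dg i - 1) * (B.dg i - 1 + 1)) + 2 * (B.dg i - 1) by ring]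
    exact this.neg.add (even_two_mul _)
  · rw [B.coord_eq_zero x.2 h, mul_zero]

/-- The elements s^n x are constants for `dY`, because contractions commute and the bracket term
drops out. -/
theorem dY_contraction_mul (i : ι) {e : ℤ} (x : g.gr e) (P : Pol (freeAlg g) n) :
    B.dY n i (Pol.ofT (freeAlg g) n _ (contraction g x) * P) =
      sgn K ((1 - B.dg i) * (e + n)) •
        (Pol.ofT (freeAlg g) n _ (contraction g x) * B.dY n i P) := by
  rw [dY_mul n B i (Pol.ofT_mem_deg _), show e - 1 + n + 1 = e + n by ring]
  rw [dY, Pol.smulBracketT_apply, Pol.bracketT_ofT, D, contraction_comm, map_zero, smul_zero, zero_mul, zero_add]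

/-- The factor in `dY` cancels the sign in the bracket of a derivation with an element of the
algebra, so that `dY i` extends the contraction along b_i itself. -/
theorem dY_ofA (i : ι) (a : (freeAlg g).carrier) :
    B.dY n i (Pol.ofA (freeAlg g) n a) = Pol.ofA (freeAlg g) n ((B.D i).1 a) := by
  rw [dY, Pol.smulBracketT_apply, Pol.bracketT_ofA, smul_smul, sgn_mul_self, one_smul]

theorem dX_sTheta_mul (i : ι) {f : ℤ} {θ : Module.Dual K g.carrier} (hθ : θ ∈ g.dualGr f)
    (P : Pol (freeAlg g) n) :
    B.dX n i (Pol.ofA (freeAlg g) n (sTheta g θ) * P) =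
      sgn K ((B.dg i + n) * (f + 1)) • (Pol.ofA (freeAlg g) n (sTheta g θ) * B.dX n i P) := by
  rw [dX_mul n B i (Pol.ofA_mem_deg ⟨_, sTheta_mem hθ⟩), dX_ofA, zero_mul, zero_add]

theorem dY_sTheta_mul (i : ι) {f : ℤ} {θ : Module.Dual K g.carrier} (hθ : θ ∈ g.dualGr f)
    (P : Pol (freeAlg g) n) :
    B.dY n i (Pol.ofA (freeAlg g) n (sTheta g θ) * P) =
      θ (B.b i) • P + sgn K ((1 - B.dg i) * (f + 1)) •
        (Pol.ofA (freeAlg g) n (sTheta g θ) * B.dY n i P) := by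
  rw [dY_mul n B i (Pol.ofA_mem_deg ⟨_, sTheta_mem hθ⟩), dY_ofA, D, contraction_sTheta,
    Algebra.algebraMap_eq_smul_one, map_smul, Pol.ofA_one, smul_mul_assoc, one_mul]

theorem dX_mem_gr (i : ι) {m : ℕ} {k : ℤ} {P : Pol (freeAlg g) n}
    (hP : P ∈ Pol.gr (freeAlg g) n (m + 1) k) :
    B.dX n i P ∈ Pol.gr (freeAlg g) n m (k - (B.dg i + n)) := by
  have hofA : ∀ {i j : ℤ} (E : (freeAlg g).der j) (a : (freeAlg g).gr i),
      E.1 a ∈ (freeAlg g).gr (i + j) := fun E a => E.2.1 _ _ a.2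
  induction hP using Submodule.span_induction with
  | mem P h =>
    generalize hm : m + 1 = m' at h
    induction h generalizing m with
    | ofA a => omega
    | @cons m' i' j E x hx ih =>
      obtain rfl : m = m' := by omega
      rw [dX_ofT_mul]
      refine add_mem (Submodule.smul_mem _ _ ?_) (Submodule.smul_mem _ _ ?_)
      · have := Pol.ofA_mul_gr (n := n) ⟨_, hofA E (B.y i)⟩ (Submodule.subset_span hx)
        rwa [show -B.dg i + 1 + j + i' = j + n + 1 + i' - (B.dg i + n) by ring] at this
      -- In weight 0 the induction hypothesis is not available, but there the remaining factor lies
      -- in the free algebra and is killed by `dX`.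
      · cases m with
        | zero =>
          cases hx with
          | ofA a => rw [dX_ofA, mul_zero]; exact zero_mem _
        | succ m =>
          have := Pol.ofT_mul_gr E (ih rfl)
          rwa [← add_sub_assoc] at this
  | zero => simp
  | add x y _ _ hx hy => rw [map_add]; exact add_mem hx hy
  | smul c x _ hx => rw [map_smul]; exact Submodule.smul_mem _ _ hx

theorem dX_gr_zero (i : ι) {k : ℤ} {P : Pol (freeAlg g) n}
    (hP : P ∈ Pol.gr (freeAlg g) n 0 k) : B.dX n i P = 0 := by
  induction hP using Submodule.span_induction with
  | mem P h =>
    cases h with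
    | ofA a => exact B.dX_ofA n i _
  | zero => simp
  | add x y _ _ hx hy => rw [map_add, hx, hy, add_zero]
  | smul c x _ hx => rw [map_smul, hx, smul_zero]

theorem dY_mem_gr (i : ι) {m : ℕ} {k : ℤ} {P : Pol (freeAlg g) n}
    (hP : P ∈ Pol.gr (freeAlg g) n m k) :
    B.dY n i P ∈ Pol.gr (freeAlg g) n m (k - (1 - B.dg i)) := by
  induction hP using Submodule.span_induction with
  | mem P h =>
    induction h with
    | @ofA k a =>
      rw [dY_ofA]
      have h := (B.D i).2.1 _ _ a.2
      rw [show k + (B.dg i - 1) = k - (1 - B.dg i) by ring] at h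
      exact Submodule.subset_span (.ofA ⟨_, h⟩)
    | @cons m' i' j E x hx ih =>
      rw [dY_mul n B i (Pol.ofT_mem_deg E)]
      refine add_mem ?_ (Submodule.smul_mem _ _ ?_)
      · rw [dY, Pol.smulBracketT_apply, Pol.bracketT_ofT, smul_mul_assoc]
        have := Pol.ofT_mul_gr (n := n) (CDGA.derBracket (B.D i) E) (Submodule.subset_span hx)
        rw [show B.dg i - 1 + j + n + 1 + i' = j + n + 1 + i' - (1 - B.dg i) by ring] at this
        exact Submodule.smul_mem _ _ this
      · have := Pol.ofT_mul_gr E ih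
        rwa [← add_sub_assoc] at this
  | zero => simp
  | add x y _ _ hx hy => rw [map_add]; exact add_mem hx hy
  | smul c x _ hx => rw [map_smul]; exact Submodule.smul_mem _ _ hx

end HomBasis

end FreePol

/-! ### Generation of the polyvectors by the elements attached to a basis. -/

section FreePolGenerators
variable {K : Type*} [Field K] {g : Cochain K} [Module.Finite K g.carrier] (n : ℤ)

namespace HomBasis
variable {ι : Type*} [Fintype ι] (B : HomBasis g ι)

theorem sTheta_eq_sum (θ : Module.Dual K g.carrier) :
    sTheta g θ = ∑ i, θ (B.b i) • (B.y i : (freeAlg g).carrier) := by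
  have h : θ = ∑ i, θ (B.b i) • B.b.coord i := by
    refine LinearMap.ext fun v => ?_
    conv_lhs => rw [← B.b.sum_repr v]
    simp
  conv_lhs => rw [h]
  rw [map_sum]
  exact Finset.sum_congr rfl fun i _ => map_smul _ _ _

/-- The contractions span the derivations over the free algebra: `E` agrees on every s θ with the
sum of the E(s θ^i) times the contraction along b_i. The sign is that of moving the coefficient past
the shift. -/
theorem ofT_eq_sum {j : ℤ} (E : (freeAlg g).der j) :
    Pol.ofT (freeAlg g) n j E = ∑ i, sgn K ((-B.dg i + 1 + j) * (n + 1)) •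
      (Pol.ofA (freeAlg g) n (E.1 (B.y i)) * B.X n i) := by
  have hE : ∀ i, E.1 (B.y i) ∈ (freeAlg g).gr (-B.dg i + 1 + j) := fun i => E.2.1 _ _ (B.y i).2
  have hj : ∀ i, -B.dg i + 1 + j + (B.dg i - 1) = j := fun i => by ring
  have hmem : ∀ i, (CDGA.derSmul ⟨_, hE i⟩ (B.D i)).1 ∈ (freeAlg g).der j := by
    intro i
    have : ∀ {k} (F : (freeAlg g).der k), k = j → F.1 ∈ (freeAlg g).der j := by
      rintro k F rfl
      exact F.2
    exact this _ (hj i)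
  have hsum : E = ∑ i, (⟨_, hmem i⟩ : (freeAlg g).der j) := by
    refine freeAlg_der_ext fun k θ hθ => ?_
    rw [AddSubmonoidClass.coe_finsetSum, LinearMap.sum_apply]
    conv_lhs => rw [B.sTheta_eq_sum θ, map_sum]
    refine Finset.sum_congr rfl fun i _ => ?_
    rw [map_smul]
    change _ = E.1 (B.y i) * (B.D i).1 (sTheta g θ)
    rw [D, contraction_sTheta, Algebra.algebraMap_eq_smul_one, mul_smul_comm, mul_one]
  have hcast : ∀ i, Pol.ofT (freeAlg g) n j ⟨_, hmem i⟩ =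
      Pol.ofT (freeAlg g) n _ (CDGA.derSmul ⟨_, hE i⟩ (B.D i)) := by
    intro i
    have := Pol.ofT_lin (n := n) (hj i) (hj i) (F := ⟨_, hmem i⟩)
      (D := CDGA.derSmul ⟨_, hE i⟩ (B.D i)) (E := CDGA.derSmul ⟨_, hE i⟩ (B.D i)) 1 0 (by simp)
    rwa [one_smul, zero_smul, add_zero] at this
  conv_lhs => rw [hsum, map_sum]
  refine Finset.sum_congr rfl fun i _ => ?_
  have h2 := Pol.ofA_mul_ofT (n := n) ⟨_, hE i⟩ (B.D i)
  dsimp only at h2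
  rw [hcast, X, h2, smul_smul, sgn_mul_self, one_smul]

/-- The free algebra is generated by the s θ^i, and the derivations are reached through
`ofT_eq_sum`. -/
theorem adjoin_eq_top :
    Algebra.adjoin K (Set.range (B.X n) ∪ Set.range (B.Y n)) = ⊤ := by
  set S := Algebra.adjoin K (Set.range (B.X n) ∪ Set.range (B.Y n))
  have hX : ∀ i, B.X n i ∈ S := fun i => Algebra.subset_adjoin (Or.inl ⟨i, rfl⟩)
  have hY : ∀ i, B.Y n i ∈ S := fun i => Algebra.subset_adjoin (Or.inr ⟨i, rfl⟩)
  have hA : ∀ a, Pol.ofA (freeAlg g) n a ∈ S := by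
    intro a
    induction a using freeAlg_induction with
    | h1 => rw [Pol.ofA_one]; exact S.one_mem
    | hadd x y hx hy => rw [map_add]; exact S.add_mem hx hy
    | hsmul c x hx => rw [map_smul]; exact S.smul_mem hx c
    | hmul θ x hx =>
      rw [← Pol.ofA_mul, B.sTheta_eq_sum, map_sum]
      refine S.mul_mem (S.sum_mem fun i _ => ?_) hx
      rw [map_smul]
      exact S.smul_mem (hY i) _
  have hT : ∀ j (E : (freeAlg g).der j), Pol.ofT (freeAlg g) n j E ∈ S := by
    intro j E
    rw [B.ofT_eq_sum]
    exact S.sum_mem fun i _ => S.smul_mem (S.mul_mem (hA _) (hX i)) _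
  rw [eq_top_iff]
  rintro x -
  induction x using presented_induction with
  | h1 => exact S.one_mem
  | hadd x y hx hy => exact S.add_mem hx hy
  | hsmul c x hx => exact S.smul_mem hx c
  | hmul m x hx =>
    refine S.mul_mem ?_ hx
    have : Submodule.comap (gen (PolRel (freeAlg g) n)) S.toSubmodule = ⊤ := by
      rw [eq_top_iff]
      rintro ⟨a, E⟩ -
      rw [← Prod.fst_add_snd (a, E)]
      refine Submodule.add_mem _ (hA a) ?_
      dsimp only
      induction E using DirectSum.induction_on with
      | zero => exact Submodule.zero_mem _
      | of j E => exact hT j E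
      | add x y hx hy =>
        have := Submodule.add_mem _ hx hy
        rwa [Prod.mk_add_mk, add_zero] at this
    have hm : m ∈ Submodule.comap (gen (PolRel (freeAlg g) n)) S.toSubmodule := by
      rw [this]; trivial
    exact hm

/-- The monomial `s^n b_(w 1) ⋯ s^n b_(w m) s θ^(v 1) ⋯ s θ^(v l)`. -/
def mono {m l : ℕ} (w : Fin m → ι) (v : Fin l → ι) : Pol (freeAlg g) n :=
  (List.ofFn fun k => B.X n (w k)).prod * (List.ofFn fun j => B.Y n (v j)).prod

/-- The span of the monomials of weight `m` and degree `i`. -/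
def monoSpan (m : ℕ) (i : ℤ) : Submodule K (Pol (freeAlg g) n) :=
  Submodule.span K {P | ∃ (l : ℕ) (w : Fin m → ι) (v : Fin l → ι),
    ∑ k, (B.dg (w k) + n) + ∑ j, (1 - B.dg (v j)) = i ∧ P = B.mono n w v}

theorem one_mem_monoSpan : (1 : Pol (freeAlg g) n) ∈ B.monoSpan n 0 0 :=
  Submodule.subset_span ⟨0, Fin.elim0, Fin.elim0, by simp, by simp [mono]⟩

theorem X_mul_monoSpan (i : ι) {m : ℕ} {k : ℤ} {P : Pol (freeAlg g) n}
    (hP : P ∈ B.monoSpan n m k) : B.X n i * P ∈ B.monoSpan n (m + 1) (B.dg i + n + k) := by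
  induction hP using Submodule.span_induction with
  | mem P h =>
    obtain ⟨l, w, v, h, rfl⟩ := h
    refine Submodule.subset_span ⟨l, Fin.cons i w, v, ?_, ?_⟩
    · rw [Fin.sum_univ_succ, ← h]
      simp only [Fin.cons_zero, Fin.cons_succ]
      ring
    · simp only [mono, List.ofFn_succ, List.prod_cons, Fin.cons_zero, Fin.cons_succ, mul_assoc]
  | zero => rw [mul_zero]; exact zero_mem _
  | add x y _ _ hx hy => rw [mul_add]; exact add_mem hx hy
  | smul c x _ hx => rw [mul_smul_comm]; exact Submodule.smul_mem _ _ hx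

theorem prod_X_mem_deg {m : ℕ} (w : Fin m → ι) : (List.ofFn fun k => B.X n (w k)).prod ∈
    Pol.deg (freeAlg g) n (∑ k, (B.dg (w k) + n)) := by
  induction m with
  | zero => simpa using Pol.one_mem_deg
  | succ m ih =>
    rw [List.ofFn_succ, List.prod_cons, Fin.sum_univ_succ]
    have := Pol.ofT_mul_deg (B.D (w 0)) (ih fun k => w k.succ)
    rwa [show B.dg (w 0) - 1 + n + 1 = B.dg (w 0) + n by ring] at this

/-- The new letter is moved behind all letters X, and the resulting sign is absorbed by the span. -/
theorem Y_mul_monoSpan (i : ι) {m : ℕ} {k : ℤ} {P : Pol (freeAlg g) n}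
    (hP : P ∈ B.monoSpan n m k) : B.Y n i * P ∈ B.monoSpan n m (-B.dg i + 1 + k) := by
  induction hP using Submodule.span_induction with
  | mem P h =>
    obtain ⟨l, w, v, h, rfl⟩ := h
    rw [mono, ← mul_assoc, Y, Pol.ofA_comm (B.y i) (B.prod_X_mem_deg n w), smul_mul_assoc,
      mul_assoc]
    refine Submodule.smul_mem _ _ (Submodule.subset_span ⟨l + 1, w, Fin.cons i v, ?_, ?_⟩)
    · rw [Fin.sum_univ_succ, ← h]
      simp only [Fin.cons_zero, Fin.cons_succ]
      ring
    · simp only [mono, List.ofFn_succ, List.prod_cons, Fin.cons_zero, Fin.cons_succ]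
      rw [Y]
  | zero => rw [mul_zero]; exact zero_mem _
  | add x y _ _ hx hy => rw [mul_add]; exact add_mem hx hy
  | smul c x _ hx => rw [mul_smul_comm]; exact Submodule.smul_mem _ _ hx

theorem ofA_mul_monoSpan {i : ℤ} {a : (freeAlg g).carrier} (ha : a ∈ (freeAlg g).gr i) {m : ℕ}
    {k : ℤ} {P : Pol (freeAlg g) n} (hP : P ∈ B.monoSpan n m k) :
    Pol.ofA (freeAlg g) n a * P ∈ B.monoSpan n m (i + k) := by
  refine freeAlg_gr_induction (C := fun i a => Pol.ofA (freeAlg g) n a * P ∈ B.monoSpan n m (i + k))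
    ?_ ?_ ?_ ?_ ?_ ha
  · rwa [Pol.ofA_one, one_mul, zero_add]
  · intro i; rw [map_zero, zero_mul]; exact zero_mem _
  · intro i x y hx hy; rw [map_add, add_mul]; exact add_mem hx hy
  · intro i c x hx; rw [map_smul, smul_mul_assoc]; exact Submodule.smul_mem _ _ hx
  · intro i j θ x hθ hx
    rw [← Pol.ofA_mul, B.sTheta_eq_sum, map_sum, mul_assoc, Finset.sum_mul]
    refine Submodule.sum_mem _ fun l _ => ?_
    rw [map_smul, smul_mul_assoc]
    -- A homogeneous θ involves only coordinates of its own degree; the terms of any other degree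
    -- have coefficient zero.
    by_cases hl : i = -B.dg l
    · have := B.Y_mul_monoSpan n l hx
      rw [← hl, ← add_assoc] at this
      exact Submodule.smul_mem _ _ this
    · rw [B.apply_eq_zero hθ hl, zero_smul]
      exact zero_mem _

/-- Refines generation by keeping track of weight and degree: a polyvector of weight `m` is a finite
combination of monomials with exactly `m` letters X and of the right total degree. -/
theorem gr_le_monoSpan (m : ℕ) (i : ℤ) : Pol.gr (freeAlg g) n m i ≤ B.monoSpan n m i := by
  refine Submodule.span_le.2 ?_
  intro P hP
  change Pol.IsMono (freeAlg g) n m i P at hP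
  change P ∈ B.monoSpan n m i
  induction hP with
  | ofA a =>
    have := B.ofA_mul_monoSpan n a.2 (B.one_mem_monoSpan n)
    rwa [mul_one, add_zero] at this
  | @cons m i j E x hx ih =>
    rw [B.ofT_eq_sum, Finset.sum_mul]
    refine Submodule.sum_mem _ fun k _ => ?_
    rw [smul_mul_assoc, mul_assoc]
    have := B.ofA_mul_monoSpan n (E.2.1 _ _ (B.y k).2) (B.X_mul_monoSpan n k ih)
    rw [show -B.dg k + 1 + j + (B.dg k + n + i) = j + n + 1 + i by ring] at this
    exact Submodule.smul_mem _ _ this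

end HomBasis
end FreePolGenerators

/-! ### The differential and the bracket in coordinates. -/

section FreeCDGA
variable {K : Type*} [Field K]

theorem freeCDGA_d_ι (W : Cochain K) (w : W.carrier) :
    (freeCDGA W).d (Sym.ι W w) = Sym.ι W (W.d w) :=
  Sym.extend_ι 1 (Sym.ι W ∘ₗ W.d) (fun _ _ hw => Sym.ι_mem (W.d_mem hw)) w

theorem freeCDGA_d_one (W : Cochain K) : (freeCDGA W).d 1 = 0 :=
  Sym.extend_one 1 (Sym.ι W ∘ₗ W.d) (fun _ _ hw => Sym.ι_mem (W.d_mem hw))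

/-- The minus sign in the differential of the dual cancels the one from the shift by -1, which
leaves the sign (-1)^|θ|. -/
theorem freeAlg_d_sTheta (g : Cochain K) [Module.Finite K g.carrier] {i : ℤ}
    {θ : Module.Dual K g.carrier} (hθ : θ ∈ g.dualGr i) :
    (freeAlg g).d (sTheta g θ) = sgn K i • sTheta g (θ ∘ₗ g.d) := by
  have h2 : (dualShift g).d θ = sgn K i • (θ ∘ₗ g.d) := by
    change sgn K (-1) • (-(g.d.dualMap (signOp g.dualGr_isInternal 1 θ))) = _
    rw [signOp_of_mem _ _ hθ, map_smul, smul_neg, sgn_neg, sgn_one, neg_smul,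
      one_smul, neg_neg, one_mul]
    rfl
  refine (freeCDGA_d_ι (dualShift g) θ).trans ?_
  rw [h2]
  exact map_smul (Sym.ι (dualShift g)) _ _

theorem Pol.sum_smul_ofA {A : CDGA K} {n : ℤ} {ι : Type*} [Fintype ι] (c : ι → K)
    (a : ι → A.carrier) :
    Pol.ofA A n (∑ j, c j • a j) = ∑ j, c j • Pol.ofA A n (a j) := by
  rw [map_sum]
  exact Finset.sum_congr rfl fun j _ => map_smul _ _ _

end FreeCDGA

section FreePolGenerators
variable {K : Type*} [Field K] {g : Cochain K} [Module.Finite K g.carrier] (n : ℤ)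

namespace HomBasis
variable {ι : Type*} [Fintype ι] (B : HomBasis g ι)

theorem freeAlg_d_y (i : ι) : (freeAlg g).d (B.y i) =
    ∑ j, (sgn K (B.dg i) * B.b.coord i (g.d (B.b j))) • (B.y j : (freeAlg g).carrier) := by
  refine (freeAlg_d_sTheta g (B.coord_mem i)).trans ?_
  rw [B.sTheta_eq_sum, Finset.smul_sum]
  refine Finset.sum_congr rfl fun j _ => ?_
  rw [smul_smul, sgn_neg]
  rfl

theorem diff_Y_mul (i : ι) (P : Pol (freeAlg g) n) :
    Pol.diff (freeAlg g) n (B.Y n i * P) =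
      (∑ j, (sgn K (B.dg i) * B.b.coord i (g.d (B.b j))) • B.Y n j) * P +
        sgn K (1 - B.dg i) • (B.Y n i * Pol.diff (freeAlg g) n P) := by
  have h := Pol.diff_ofA_mul n (B.y i) P
  rw [B.freeAlg_d_y, Pol.sum_smul_ofA, sgn_eq (a := -B.dg i + 1) (b := 1 - B.dg i) ⟨0, by ring⟩] at h
  exact h

/-- Of the two terms of the commutator with `d`, one differentiates a constant and vanishes; the
other contracts `d (s θ^i)`, which is linear in the generators. -/
theorem derDiff_D_y (i j : ι) : (CDGA.derDiff _ (B.D j)).1 (B.y i : (freeAlg g).carrier) =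
    (-(sgn K (B.dg j - 1 + B.dg i) * B.b.coord i (g.d (B.b j)))) •
      (1 : (freeAlg g).carrier) := by
  have h1 : (freeAlg g).d ((B.D j).1 (B.y i)) = 0 := by
    have := congrArg (freeAlg g).d (contraction_sTheta g ⟨B.b j, B.mem j⟩ (B.b.coord i))
    rw [Algebra.algebraMap_eq_smul_one, map_smul] at this
    refine this.trans ?_
    have := freeCDGA_d_one (dualShift g)
    exact (congrArg _ this).trans (smul_zero _)
  have h2 : (B.D j).1 ((freeAlg g).d (B.y i)) =
      (sgn K (B.dg i) * B.b.coord i (g.d (B.b j))) • (1 : (freeAlg g).carrier) := by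
    have := congrArg (B.D j).1 (freeAlg_d_sTheta g (B.coord_mem i))
    refine this.trans ?_
    rw [map_smul, D, contraction_sTheta, Algebra.algebraMap_eq_smul_one, smul_smul, sgn_neg]
    rfl
  change (freeAlg g).d ((B.D j).1 (B.y i)) - sgn K (B.dg j - 1) •
    (B.D j).1 ((freeAlg g).d (B.y i)) = _
  rw [h1, h2, zero_sub, smul_smul, sgn_add, neg_smul, mul_assoc]

/-- Expanding the differential of the contraction along b_j in contractions yields s^n (d b_j) up to
the sign (-1)^n: only indices with |b_i| = |b_j| + 1 contribute, and for these the other signs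
cancel. -/
theorem ofT_derDiff_D (j : ι) : sgn K (n + 1) • Pol.ofT (freeAlg g) n (B.dg j - 1 + 1)
    (CDGA.derDiff _ (B.D j)) = ∑ i, (sgn K n * B.b.coord i (g.d (B.b j))) • B.X n i := by
  rw [B.ofT_eq_sum n, Finset.smul_sum]
  refine Finset.sum_congr rfl fun i _ => ?_
  rw [derDiff_D_y, map_smul, Pol.ofA_one, smul_mul_assoc, one_mul, smul_smul, smul_smul]
  congr 1
  by_cases h : B.dg i = B.dg j + 1
  · rw [h, sgn_even (a := B.dg j - 1 + (B.dg j + 1)) ⟨B.dg j, by ring⟩,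
      sgn_even (a := _ * (n + 1)) ⟨0, by ring⟩, sgn_add n, sgn_one]
    ring
  · have := B.coord_eq_zero (g.d_mem (B.mem j)) h
    rw [this]
    ring

theorem diff_X_mul (j : ι) (P : Pol (freeAlg g) n) :
    Pol.diff (freeAlg g) n (B.X n j * P) =
      (∑ i, (sgn K n * B.b.coord i (g.d (B.b j))) • B.X n i) * P +
        sgn K (B.dg j + n) • (B.X n j * Pol.diff (freeAlg g) n P) := by
  have h := Pol.diff_ofT_mul n (B.D j) P
  rw [B.ofT_derDiff_D, sgn_eq (a := B.dg j - 1 + n + 1) (b := B.dg j + n) ⟨0, by ring⟩] at h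
  exact h

/-- For |P| = n + 2 the operator `{P, -}` is a derivation of degree 1. Its value on s^n b_i is a
multiple of `dY i P`, and by `schouten_Y_mul` its value on s θ^i is a multiple of `dX i P`: the
letters X and Y are conjugate variables. -/
theorem schouten_X_mul {P : Pol (freeAlg g) n} (hP : P ∈ Pol.deg (freeAlg g) n (n + 2)) (i : ι)
    (Q : Pol (freeAlg g) n) :
    Pol.schouten (A := freeAlg g) n (n + 2) ⟨P, hP⟩ (B.X n i * Q) =
      (-sgn K (n * (B.dg i - 1))) • (B.dY n i P * Q) +
        sgn K (B.dg i + n) • (B.X n i * Pol.schouten (A := freeAlg g) n (n + 2) ⟨P, hP⟩ Q) := by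
  have h := Pol.schouten_ofT_mul (A := freeAlg g) n ⟨P, hP⟩ (B.D i) Q
  rw [sgn_eq (a := (n + 2 - n - 1) * (B.dg i - 1 + n + 1)) (b := B.dg i + n) ⟨0, by ring⟩,
    sgn_eq (a := (n + 2 - n - 1) * (B.dg i - 1))
      (b := n * (B.dg i - 1) + (B.dg i - 1) * (n + 1)) ⟨-n * (B.dg i - 1), by ring⟩,
    sgn_add, ← neg_mul, mul_smul, ← smul_mul_assoc (sgn K ((B.dg i - 1) * (n + 1)))] at h
  exact h

theorem schouten_Y_mul {P : Pol (freeAlg g) n} (hP : P ∈ Pol.deg (freeAlg g) n (n + 2)) (i : ι)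
    (Q : Pol (freeAlg g) n) :
    Pol.schouten (A := freeAlg g) n (n + 2) ⟨P, hP⟩ (B.Y n i * Q) =
      (-sgn K n) • (B.dX n i P * Q) +
        sgn K (1 - B.dg i) • (B.Y n i * Pol.schouten (A := freeAlg g) n (n + 2) ⟨P, hP⟩ Q) := by
  have h := Pol.schouten_ofA_mul (A := freeAlg g) n ⟨P, hP⟩ (B.y i) Q
  rw [sgn_eq (a := (n + 2 - n - 1) * (-B.dg i + 1)) (b := 1 - B.dg i) ⟨0, by ring⟩,
    sgn_eq (a := (n + 2 - n - 1) * (-B.dg i + 1 - n - 1))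
      (b := n + B.dg i) ⟨-n - B.dg i, by ring⟩,
    sgn_add, ← neg_mul, mul_smul, ← smul_mul_assoc (sgn K (B.dg i))] at h
  exact h

end HomBasis
end FreePolGenerators

/-! ### The properties of the algebra of polyvectors that enter the comparison. -/

section PolModel
variable {K : Type*} [Field K]

theorem Pol.comm {A : CDGA K} {n i j : ℤ} {x y : Pol A n} (hx : x ∈ Pol.deg A n i)
    (hy : y ∈ Pol.deg A n j) : x * y = sgn K (i * j) • (y * x) := by
  induction hx using Pol.deg_induction with
  | ofA i a => exact Pol.ofA_comm a hy
  | zero i => rw [zero_mul, mul_zero, smul_zero]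
  | add i x z _ _ hx hz => rw [add_mul, mul_add, smul_add, hx, hz]
  | smul i c x _ hx => rw [smul_mul_assoc, mul_smul_comm, hx, smul_comm]
  | ofT_mul i k D x hx0 hx =>
    rw [mul_assoc, hx, mul_smul_comm, ← mul_assoc, Pol.ofT_comm D hy, smul_mul_assoc, mul_assoc,
      smul_smul, ← sgn_add]
    exact Pol.sgn_smul_congr ⟨0, by ring⟩ _

theorem Pol.mul_mem_gr {A : CDGA K} {n i j : ℤ} {p q : ℕ} {x y : Pol A n}
    (hx : x ∈ Pol.gr A n p i) (hy : y ∈ Pol.gr A n q j) : x * y ∈ Pol.gr A n (p + q) (i + j) := by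
  induction hx using Submodule.span_induction with
  | mem x hx =>
    induction hx with
    | ofA a => rw [zero_add]; exact Pol.ofA_mul_gr a hy
    | cons D hx ih =>
      rw [mul_assoc, add_assoc (_ + n + 1), Nat.add_right_comm]
      exact Pol.ofT_mul_gr D ih
  | zero => rw [zero_mul]; exact zero_mem _
  | add x x' _ _ hx hx' => rw [add_mul]; exact add_mem hx hx'
  | smul c x _ hx => rw [smul_mul_assoc]; exact Submodule.smul_mem _ _ hx

theorem Pol.diff_mem_gr {A : CDGA K} {n i : ℤ} {m : ℕ} {x : Pol A n} (hx : x ∈ Pol.gr A n m i) :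
    Pol.diff A n x ∈ Pol.gr A n m (i + 1) := by
  induction hx using Submodule.span_induction with
  | mem x hx =>
    induction hx with
    | ofA a =>
      rw [Pol.diff, Pol.DerData.toMap_ofA]
      exact Submodule.subset_span (.ofA ⟨_, A.d_mem a.2⟩)
    | @cons m i j D x hx ih =>
      rw [Pol.diff, Pol.DerData.toMap_ofT_mul]
      refine add_mem ?_ (Submodule.smul_mem _ _ ?_)
      · change (sgn K (n + 1) • Pol.ofT A n (j + 1) (CDGA.derDiff j D)) * x ∈ _
        rw [smul_mul_assoc]
        have := Pol.ofT_mul_gr (n := n) (CDGA.derDiff j D) (Submodule.subset_span hx)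
        rw [show j + 1 + n + 1 + i = j + n + 1 + i + 1 by ring] at this
        exact Submodule.smul_mem _ _ this
      · rw [add_assoc (j + n + 1)]
        exact Pol.ofT_mul_gr D ih
  | zero => rw [map_zero]; exact zero_mem _
  | add x y _ _ hx hy => rw [map_add]; exact add_mem hx hy
  | smul c x _ hx => rw [map_smul]; exact Submodule.smul_mem _ _ hx

/-- The structure of the algebra of polyvectors on `Sym (g*[-1])` in terms of the generators
`s^n x` and `s θ`, the partial derivatives along a homogeneous basis, and the augmentation. -/
structure PolModel {g : Cochain K} [Module.Finite K g.carrier] {ι : Type*} [Fintype ι]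
    (B : HomBasis g ι) (n : ℤ) (R : Type*) [Ring R] [Algebra K R] where
  sx : ∀ {e : ℤ}, g.gr e → R
  st : Module.Dual K g.carrier → R
  dX : ι → Module.End K R
  dY : ι → Module.End K R
  aug : R →ₐ[K] K
  deg : ℤ → Submodule K R
  gr : ℕ → ℤ → Submodule K R
  gr_le_deg : ∀ m i, gr m i ≤ deg i
  comm : ∀ {i j : ℤ} {x y : R}, x ∈ deg i → y ∈ deg j → x * y = sgn K (i * j) • (y * x)
  mul_mem_gr : ∀ {p q : ℕ} {i j : ℤ} {x y : R}, x ∈ gr p i → y ∈ gr q j →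
    x * y ∈ gr (p + q) (i + j)
  sx_mem : ∀ {e : ℤ} (x : g.gr e), sx x ∈ deg (e + n)
  st_mem : ∀ {f : ℤ} {θ : Module.Dual K g.carrier}, θ ∈ g.dualGr f → st θ ∈ deg (f + 1)
  dX_one : ∀ i, dX i 1 = 0
  dY_one : ∀ i, dY i 1 = 0
  dX_mem : ∀ i {k : ℤ} {P : R}, P ∈ deg k → dX i P ∈ deg (k - (B.dg i + n))
  dY_mem : ∀ i {k : ℤ} {P : R}, P ∈ deg k → dY i P ∈ deg (k - (1 - B.dg i))
  dX_mem_gr : ∀ i {m : ℕ} {k : ℤ} {P : R}, P ∈ gr (m + 1) k → dX i P ∈ gr m (k - (B.dg i + n))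
  dX_gr_zero : ∀ i {k : ℤ} {P : R}, P ∈ gr 0 k → dX i P = 0
  dY_mem_gr : ∀ i {m : ℕ} {k : ℤ} {P : R}, P ∈ gr m k → dY i P ∈ gr m (k - (1 - B.dg i))
  dX_mul : ∀ i {k : ℤ} {P : R}, P ∈ deg k → ∀ Q,
    dX i (P * Q) = dX i P * Q + sgn K ((B.dg i + n) * k) • (P * dX i Q)
  dY_mul : ∀ i {k : ℤ} {P : R}, P ∈ deg k → ∀ Q,
    dY i (P * Q) = dY i P * Q + sgn K ((1 - B.dg i) * k) • (P * dY i Q)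
  dX_sx_mul : ∀ i {e : ℤ} (x : g.gr e) (P : R),
    dX i (sx x * P) = B.b.coord i x • P + sgn K ((B.dg i + n) * (e + n)) • (sx x * dX i P)
  dY_sx_mul : ∀ i {e : ℤ} (x : g.gr e) (P : R),
    dY i (sx x * P) = sgn K ((1 - B.dg i) * (e + n)) • (sx x * dY i P)
  dX_st_mul : ∀ i {f : ℤ} {θ : Module.Dual K g.carrier}, θ ∈ g.dualGr f → ∀ P,
    dX i (st θ * P) = sgn K ((B.dg i + n) * (f + 1)) • (st θ * dX i P)
  dY_st_mul : ∀ i {f : ℤ} {θ : Module.Dual K g.carrier}, θ ∈ g.dualGr f → ∀ P,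
    dY i (st θ * P) = θ (B.b i) • P + sgn K ((1 - B.dg i) * (f + 1)) • (st θ * dY i P)
  aug_sx : ∀ {e : ℤ} (x : g.gr e), aug (sx x) = 0
  aug_st : ∀ θ, aug (st θ) = 0
  aug_of_mem_deg : ∀ {i : ℤ}, i ≠ 0 → ∀ {P : R}, P ∈ deg i → aug P = 0
  aug_of_mem_gr : ∀ {m : ℕ} {i : ℤ} {P : R}, P ∈ gr (m + 1) i → aug P = 0
  adjoin_eq_top : Algebra.adjoin K (Set.range (fun i => sx ⟨B.b i, B.mem i⟩) ∪
    Set.range fun i => st (B.b.coord i)) = ⊤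
  monomial_mem : ∀ {m l : ℕ} {e : Fin m → ℤ} {f : Fin l → ℤ} (x : ∀ k, g.gr (e k))
    (θ : ∀ j, g.dualGr (f j)), (List.ofFn fun k => sx (x k)).prod *
      (List.ofFn fun j => st (θ j)).prod ∈ gr m (∑ k, (e k + n) + ∑ j, (f j + 1))
  gr_le_span : ∀ m i, gr m i ≤ Submodule.span K {P | ∃ (l : ℕ) (w : Fin m → ι) (v : Fin l → ι),
    ∑ k, (B.dg (w k) + n) + ∑ j, (1 - B.dg (v j)) = i ∧
      P = (List.ofFn fun k => sx ⟨B.b (w k), B.mem (w k)⟩).prod *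
        (List.ofFn fun j => st (B.b.coord (v j))).prod}
  diff : Module.End K R
  diff_mem_gr : ∀ {m : ℕ} {i : ℤ} {P : R}, P ∈ gr m i → diff P ∈ gr m (i + 1)
  diff_one : diff 1 = 0
  diff_X_mul : ∀ j (P : R), diff (sx ⟨B.b j, B.mem j⟩ * P) =
    (∑ i, (sgn K n * B.b.coord i (g.d (B.b j))) • sx ⟨B.b i, B.mem i⟩) * P +
      sgn K (B.dg j + n) • (sx ⟨B.b j, B.mem j⟩ * diff P)
  diff_Y_mul : ∀ i (P : R), diff (st (B.b.coord i) * P) =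
    (∑ j, (sgn K (B.dg i) * B.b.coord i (g.d (B.b j))) • st (B.b.coord j)) * P +
      sgn K (1 - B.dg i) • (st (B.b.coord i) * diff P)
  schouten : ∀ P ∈ deg (n + 2), Module.End K R
  schouten_one : ∀ {P} (hP : P ∈ deg (n + 2)), schouten P hP 1 = 0
  schouten_X_mul : ∀ {P} (hP : P ∈ deg (n + 2)) i Q, schouten P hP (sx ⟨B.b i, B.mem i⟩ * Q) =
    (-sgn K (n * (B.dg i - 1))) • (dY i P * Q) +
      sgn K (B.dg i + n) • (sx ⟨B.b i, B.mem i⟩ * schouten P hP Q)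
  schouten_Y_mul : ∀ {P} (hP : P ∈ deg (n + 2)) i Q, schouten P hP (st (B.b.coord i) * Q) =
    (-sgn K n) • (dX i P * Q) + sgn K (1 - B.dg i) • (st (B.b.coord i) * schouten P hP Q)

variable {g : Cochain K} [Module.Finite K g.carrier] {ι : Type*} [Fintype ι]

theorem Pol.contraction_mem_deg (n : ℤ) {e : ℤ} (x : g.gr e) :
    Pol.ofT (freeAlg g) n _ (contraction g x) ∈ Pol.deg (freeAlg g) n (e + n) := by
  have := Pol.ofT_mem_deg (A := freeAlg g) (n := n) (contraction g x)
  rwa [show e - 1 + n + 1 = e + n by ring] at this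

theorem Pol.sTheta_mem_deg (n : ℤ) {f : ℤ} {θ : Module.Dual K g.carrier} (hθ : θ ∈ g.dualGr f) :
    Pol.ofA (freeAlg g) n (sTheta g θ) ∈ Pol.deg (freeAlg g) n (f + 1) :=
  Pol.ofA_mem_deg (A := freeAlg g) (n := n) ⟨_, sTheta_mem hθ⟩

theorem Pol.aug_sTheta (n : ℤ) (θ : Module.Dual K g.carrier) :
    Pol.aug g n (Pol.ofA (freeAlg g) n (sTheta g θ)) = 0 := by
  rw [Pol.aug_ofA, freeAug_sTheta]

/-- The algebra of polyvectors on `Sym (g*[-1])`. -/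
def polModel (B : HomBasis g ι) (n : ℤ) : PolModel B n (Pol (freeAlg g) n) where
  sx x := Pol.ofT (freeAlg g) n _ (contraction g x)
  st θ := Pol.ofA (freeAlg g) n (sTheta g θ)
  dX := B.dX n
  dY := B.dY n
  aug := Pol.aug g n
  deg := Pol.deg (freeAlg g) n
  gr := Pol.gr (freeAlg g) n
  gr_le_deg := Pol.gr_le_deg (A := freeAlg g) (n := n)
  comm := Pol.comm (A := freeAlg g) (n := n)
  mul_mem_gr := Pol.mul_mem_gr (A := freeAlg g) (n := n)
  sx_mem := Pol.contraction_mem_deg n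
  st_mem := Pol.sTheta_mem_deg n
  dX_one := B.dX_one n
  dY_one := B.dY_one n
  dX_mem := B.dX_mem_deg n
  dY_mem := B.dY_mem_deg n
  dX_mem_gr := B.dX_mem_gr n
  dX_gr_zero := B.dX_gr_zero n
  dY_mem_gr := B.dY_mem_gr n
  dX_mul := B.dX_mul n
  dY_mul := B.dY_mul n
  dX_sx_mul := B.dX_contraction_mul n
  dY_sx_mul := B.dY_contraction_mul n
  dX_st_mul := B.dX_sTheta_mul n
  dY_st_mul := B.dY_sTheta_mul n
  aug_sx x := Pol.aug_ofT g n _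
  aug_st := Pol.aug_sTheta n
  aug_of_mem_deg := Pol.aug_of_mem_deg g n
  aug_of_mem_gr := Pol.aug_of_mem_gr g n
  adjoin_eq_top := B.adjoin_eq_top n
  monomial_mem := monomial_mem g n
  gr_le_span := B.gr_le_monoSpan n
  diff := Pol.diff (freeAlg g) n
  diff_mem_gr := Pol.diff_mem_gr (A := freeAlg g) (n := n)
  diff_one := Pol.diff_map_one (A := freeAlg g) n
  diff_X_mul := B.diff_X_mul n
  diff_Y_mul := B.diff_Y_mul n
  schouten P hP := Pol.schouten (A := freeAlg g) n (n + 2) ⟨P, hP⟩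
  schouten_one hP := Pol.schouten_map_one (A := freeAlg g) n ⟨_, hP⟩
  schouten_X_mul := B.schouten_X_mul n
  schouten_Y_mul := B.schouten_Y_mul n

end PolModel

/-! ### Graded commutation of partial derivatives and Taylor coefficients. -/

section PolModelCoef
variable {K : Type*} [Field K]

theorem iter_mul_comm {R : Type*} [Ring R] [Algebra K R] {N : ℕ} (D : Fin N → R) (E : R)
    (d : Fin N → ℤ) (e : ℤ) (h : ∀ k, D k * E = sgn K (e * d k) • (E * D k)) :
    iter D * E = sgn K (e * ∑ k, d k) • (E * iter D) := by
  induction N with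
  | zero => simp [iter_zero, sgn_zero]
  | succ N ih =>
    rw [iter_succ, mul_assoc, h, mul_smul_comm, ← mul_assoc,
      ih _ (fun k => d k.succ) fun k => h k.succ, smul_mul_assoc, smul_smul, mul_assoc,
      Fin.sum_univ_succ, ← sgn_add, mul_add]

/-- The induction step for graded commutation, from `P` to `u * P`. Expanding both sides, `h1`
matches the terms in `D P`, `h2` those in `E P`, and `h` handles the second order terms. -/
theorem graded_commute_mul {R : Type*} [Ring R] [Algebra K R] {D E : Module.End K R} {u P : R}
    {p q s t c : K} (hD : ∀ r, D (u * r) = p • r + s • (u * D r))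
    (hE : ∀ r, E (u * r) = q • r + t • (u * E r)) (h1 : q = c * s * q) (h2 : t * p = c * p)
    (h : (D * E) P = (c • (E * D)) P) : (D * E) (u * P) = (c • (E * D)) (u * P) := by
  rw [Module.End.mul_apply, LinearMap.smul_apply, Module.End.mul_apply] at h ⊢
  rw [hE, map_add, map_smul, map_smul, hD, h, hD, map_add, map_smul, map_smul, hE]
  simp only [smul_add, smul_smul, mul_smul_comm]
  rw [← mul_assoc c s q, ← h1, h2]
  rw [show t * (s * c) = c * (s * t) by ring]
  abel

theorem iter_induction {R : Type*} [Monoid R] {C : R → Prop} {N : ℕ} {D : Fin N → R} (h1 : C 1)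
    (hmul : ∀ k x, C x → C (D k * x)) : C (iter D) := by
  induction N with
  | zero => rwa [iter_zero]
  | succ N ih =>
    rw [iter_succ_last]
    exact hmul _ _ (ih fun k x hx => hmul _ x hx)

variable {g : Cochain K} [Module.Finite K g.carrier] {ι : Type*} [Fintype ι]
  {B : HomBasis g ι} {n : ℤ} {R : Type*} [Ring R] [Algebra K R]

namespace PolModel
variable (M : PolModel B n R)

/-- The elements `s^n b_i`. -/
def X (i : ι) : R := M.sx ⟨B.b i, B.mem i⟩

/-- The elements `s θ^i`. -/
def Y (i : ι) : R := M.st (B.b.coord i)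

theorem X_mem (i : ι) : M.X i ∈ M.deg (B.dg i + n) := M.sx_mem _

theorem Y_mem (i : ι) : M.Y i ∈ M.deg (1 - B.dg i) := by
  have := M.st_mem (B.coord_mem i)
  rwa [show -B.dg i + 1 = 1 - B.dg i by ring] at this

theorem dX_X_mul [DecidableEq ι] (i j : ι) (P : R) : M.dX i (M.X j * P) = (if i = j then P else 0) +
    sgn K ((B.dg i + n) * (B.dg j + n)) • (M.X j * M.dX i P) := by
  rw [X, M.dX_sx_mul]
  congr 1
  by_cases h : i = j <;> simp [h]

theorem dX_X_mul' [DecidableEq ι] (i j : ι) (P : R) : M.dX i (M.X j * P) =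
    (if i = j then (1 : K) else 0) • P +
      sgn K ((B.dg i + n) * (B.dg j + n)) • (M.X j * M.dX i P) := by
  rw [dX_X_mul, ite_smul, one_smul, zero_smul]

theorem dX_Y_mul (i j : ι) (P : R) : M.dX i (M.Y j * P) =
    sgn K ((B.dg i + n) * (1 - B.dg j)) • (M.Y j * M.dX i P) := by
  rw [Y, M.dX_st_mul i (B.coord_mem j), show -B.dg j + 1 = 1 - B.dg j by ring]

theorem dY_X_mul (i j : ι) (P : R) : M.dY i (M.X j * P) =
    sgn K ((1 - B.dg i) * (B.dg j + n)) • (M.X j * M.dY i P) := by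
  rw [X, M.dY_sx_mul]

theorem dX_Y_mul' (i j : ι) (P : R) : M.dX i (M.Y j * P) = (0 : K) • P +
    sgn K ((B.dg i + n) * (1 - B.dg j)) • (M.Y j * M.dX i P) := by
  rw [zero_smul, zero_add, dX_Y_mul]

theorem dY_X_mul' (i j : ι) (P : R) : M.dY i (M.X j * P) = (0 : K) • P +
    sgn K ((1 - B.dg i) * (B.dg j + n)) • (M.X j * M.dY i P) := by
  rw [zero_smul, zero_add, dY_X_mul]

theorem dY_Y_mul [DecidableEq ι] (i j : ι) (P : R) : M.dY i (M.Y j * P) = (if i = j then P else 0) +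
    sgn K ((1 - B.dg i) * (1 - B.dg j)) • (M.Y j * M.dY i P) := by
  rw [Y, M.dY_st_mul i (B.coord_mem j), show -B.dg j + 1 = 1 - B.dg j by ring]
  congr 1
  by_cases h : i = j
  · simp [h]
  · simp [h]

theorem dY_Y_mul' [DecidableEq ι] (i j : ι) (P : R) : M.dY i (M.Y j * P) =
    (if i = j then (1 : K) else 0) • P +
      sgn K ((1 - B.dg i) * (1 - B.dg j)) • (M.Y j * M.dY i P) := by
  rw [dY_Y_mul, ite_smul, one_smul, zero_smul]

/-- Takes the place of a basis of the algebra: as the X and Y generate, a linear identity may be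
propagated from 1 by left multiplication with these letters. -/
theorem hom_ext {X : Type*} [AddCommGroup X] [Module K X] {f f' : R →ₗ[K] X} (h1 : f 1 = f' 1)
    (hX : ∀ i P, f P = f' P → f (M.X i * P) = f' (M.X i * P))
    (hY : ∀ i P, f P = f' P → f (M.Y i * P) = f' (M.Y i * P)) : f = f' := by
  have key : ∀ a ∈ Algebra.adjoin K (Set.range (fun i => M.sx ⟨B.b i, B.mem i⟩) ∪
      Set.range fun i => M.st (B.b.coord i)), ∀ P, f P = f' P → f (a * P) = f' (a * P) := by
    intro a ha
    induction ha using Algebra.adjoin_induction with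
    | mem a h =>
      rcases h with ⟨i, rfl⟩ | ⟨i, rfl⟩
      · exact hX i
      · exact hY i
    | algebraMap c =>
      intro P h
      rw [← Algebra.smul_def, map_smul, map_smul, h]
    | add x y _ _ hx hy =>
      intro P h
      rw [add_mul, map_add, map_add, hx P h, hy P h]
    | mul x y _ _ hx hy =>
      intro P h
      rw [mul_assoc]
      exact hx _ (hy _ h)
  refine LinearMap.ext fun a => ?_
  have := key a (by rw [M.adjoin_eq_top]; trivial) 1 h1
  rwa [mul_one] at this

/-- Both sides vanish on 1 and transform in the same way under left multiplication by a letter. The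
same argument gives `dY_dY` and `dX_dY`. -/
theorem dX_dX (i j : ι) : M.dX i * M.dX j =
    sgn K ((B.dg i + n) * (B.dg j + n)) • (M.dX j * M.dX i) := by
  classical
  refine M.hom_ext ?_ (fun k P h => ?_) fun k P h => ?_
  · simp [M.dX_one]
  · refine graded_commute_mul (M.dX_X_mul' i k) (M.dX_X_mul' j k) ?_ ?_ h
    · by_cases hj : j = k
      · rw [← hj, if_pos rfl, sgn_mul_self, one_mul]
      · simp [hj]
    · by_cases hi : i = k
      · rw [← hi, mul_comm (B.dg j + n)]
      · simp [hi]
  · exact graded_commute_mul (M.dX_Y_mul' i k) (M.dX_Y_mul' j k) (by rw [mul_zero])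
      (by rw [mul_zero, mul_zero]) h

theorem dY_dY (i j : ι) : M.dY i * M.dY j =
    sgn K ((1 - B.dg i) * (1 - B.dg j)) • (M.dY j * M.dY i) := by
  classical
  refine M.hom_ext ?_ (fun k P h => ?_) fun k P h => ?_
  · simp [M.dY_one]
  · exact graded_commute_mul (M.dY_X_mul' i k) (M.dY_X_mul' j k) (by rw [mul_zero])
      (by rw [mul_zero, mul_zero]) h
  · refine graded_commute_mul (M.dY_Y_mul' i k) (M.dY_Y_mul' j k) ?_ ?_ h
    · by_cases hj : j = k
      · rw [← hj, if_pos rfl, sgn_mul_self, one_mul]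
      · simp [hj]
    · by_cases hi : i = k
      · rw [← hi, mul_comm (1 - B.dg j)]
      · simp [hi]

theorem dX_dY (i j : ι) : M.dX i * M.dY j =
    sgn K ((1 - B.dg j) * (B.dg i + n)) • (M.dY j * M.dX i) := by
  classical
  refine M.hom_ext ?_ (fun k P h => ?_) fun k P h => ?_
  · simp [M.dX_one, M.dY_one]
  · refine graded_commute_mul (M.dX_X_mul' i k) (M.dY_X_mul' j k) (by rw [mul_zero]) ?_ h
    by_cases hi : i = k
    · rw [← hi]
    · simp [hi]
  · refine graded_commute_mul (M.dX_Y_mul' i k) (M.dY_Y_mul' j k) ?_ (by rw [mul_zero, mul_zero]) h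
    by_cases hj : j = k
    · rw [← hj, mul_comm (1 - B.dg j), sgn_mul_self, one_mul]
    · simp [hj]

/-- The Taylor coefficients of a polyvector. -/
def coef {m l : ℕ} (w : Fin m → ι) (v : Fin l → ι) : R →ₗ[K] K :=
  M.aug.toLinearMap ∘ₗ iter (fun j => M.dY (v j)) ∘ₗ iter fun k => M.dX (w k)

variable {m l : ℕ} (w : Fin m → ι) (v : Fin l → ι)

theorem coef_apply (P : R) :
    M.coef w v P = M.aug (iter (fun j => M.dY (v j)) (iter (fun k => M.dX (w k)) P)) := rfl

/-- Symmetry of mixed partial derivatives, with Koszul signs for the degrees |b| + n of the letters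
X. For the letters Y the degrees are 1 - |b| (`coef_perm_right`). -/
theorem coef_perm_left (ρ : Equiv.Perm (Fin m)) (P : R) : M.coef w v P =
    koszul K ρ (fun k => B.dg (w k) + n) * M.coef (w ∘ ρ) v P := by
  rw [coef_apply, iter_reorder ρ (fun k => M.dX (w k)) _ fun i j => M.dX_dX _ _,
    LinearMap.smul_apply, map_smul, map_smul, smul_eq_mul]
  rfl

theorem coef_perm_right (σ : Equiv.Perm (Fin l)) (P : R) : M.coef w v P =
    koszul K σ (fun j => 1 - B.dg (v j)) * M.coef w (v ∘ σ) P := by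
  rw [coef_apply, iter_reorder σ (fun j => M.dY (v j)) _ fun i j => M.dY_dY _ _,
    LinearMap.smul_apply, map_smul, smul_eq_mul]
  rfl

theorem coef_dX (i : ι) (P : R) :
    M.coef w v (M.dX i P) = M.coef (Fin.cons i w : Fin (m + 1) → ι) v P := by
  rw [coef_apply, coef_apply, iter_succ (fun k => M.dX ((Fin.cons i w : Fin (m + 1) → ι) k)),
    Module.End.mul_apply]
  rfl

/-- The inner derivative is applied first. For `dX` this is the front of the word (`coef_dX`); here
`dY i` is moved past all other derivatives, so that it ends as the last letter and hence as the last
input of a map. -/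
theorem coef_dY (i : ι) (P : R) : M.coef w v (M.dY i P) =
    sgn K ((1 - B.dg i) * (∑ k, (B.dg (w k) + n) + ∑ j, (1 - B.dg (v j)))) *
      M.coef w (Fin.snoc v i : Fin (l + 1) → ι) P := by
  have h1 := iter_mul_comm (K := K) (fun k => M.dX (w k)) (M.dY i) (fun k => B.dg (w k) + n) (1 - B.dg i)
    fun k => M.dX_dY _ _
  have h2 := iter_mul_comm (K := K) (fun j => M.dY (v j)) (M.dY i) (fun j => 1 - B.dg (v j)) (1 - B.dg i)
    fun j => by rw [M.dY_dY, mul_comm (1 - B.dg (v j))]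
  have h3 : iter (fun j => M.dY ((Fin.snoc v i : Fin (l + 1) → ι) j)) =
      M.dY i * iter fun j => M.dY (v j) := by
    rw [iter_succ_last]
    simp only [Fin.snoc_last, Fin.snoc_castSucc]
  rw [coef_apply, coef_apply, ← Module.End.mul_apply _ (M.dY i), h1, LinearMap.smul_apply,
    map_smul, Module.End.mul_apply (M.dY i), ← Module.End.mul_apply _ (M.dY i), h2,
    LinearMap.smul_apply, map_smul, map_smul, h3, smul_smul, smul_eq_mul, mul_add, sgn_add]

theorem iter_dX_mem {i : ℤ} {P : R} (hP : P ∈ M.deg i) :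
    iter (fun k => M.dX (w k)) P ∈ M.deg (i - ∑ k, (B.dg (w k) + n)) := by
  induction m generalizing i P with
  | zero => simpa [iter_zero] using hP
  | succ m ih =>
    rw [iter_succ, Module.End.mul_apply, Fin.sum_univ_succ, ← sub_sub]
    exact ih (fun k => w k.succ) (M.dX_mem _ hP)

theorem iter_dY_mem {i : ℤ} {P : R} (hP : P ∈ M.deg i) :
    iter (fun j => M.dY (v j)) P ∈ M.deg (i - ∑ j, (1 - B.dg (v j))) := by
  induction l generalizing i P with
  | zero => simpa [iter_zero] using hP
  | succ m ih =>
    rw [iter_succ, Module.End.mul_apply, Fin.sum_univ_succ, ← sub_sub]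
    exact ih (fun k => v k.succ) (M.dY_mem _ hP)

/-- The derivatives lower the degree by the total degree of the letters, and the augmentation sees
only degree 0. -/
theorem coef_eq_zero_of_deg {i : ℤ} {P : R} (hP : P ∈ M.deg i)
    (h : ∑ k, (B.dg (w k) + n) + ∑ j, (1 - B.dg (v j)) ≠ i) : M.coef w v P = 0 :=
  M.aug_of_mem_deg (by omega) (M.iter_dY_mem v (M.iter_dX_mem w hP))

theorem iter_dX_mem_gr {p : ℕ} {i : ℤ} {P : R} (hP : P ∈ M.gr (p + m) i) :
    ∃ j, iter (fun k => M.dX (w k)) P ∈ M.gr p j := by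
  induction m generalizing i P with
  | zero => exact ⟨i, by simpa [iter_zero] using hP⟩
  | succ m ih =>
    rw [iter_succ, Module.End.mul_apply]
    exact ih (fun k => w k.succ) (M.dX_mem_gr _ hP)

theorem iter_dX_eq_zero {p : ℕ} (hp : p < m) {i : ℤ} {P : R} (hP : P ∈ M.gr p i) :
    iter (fun k => M.dX (w k)) P = 0 := by
  induction m generalizing i P p with
  | zero => omega
  | succ m ih =>
    rw [iter_succ, Module.End.mul_apply]
    cases p with
    | zero => rw [M.dX_gr_zero _ hP, map_zero]
    | succ p => exact ih (fun k => w k.succ) (by omega) (M.dX_mem_gr _ hP)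

section Monomial
variable {m' l' : ℕ} {e : Fin m → ℤ} (x : ∀ k, g.gr (e k)) {f : Fin l → ℤ}
  (θ : ∀ j, g.dualGr (f j))

theorem dX_prod_st (i : ι) :
    M.dX i (List.ofFn fun j => M.st (θ j : Module.Dual K g.carrier)).prod = 0 := by
  induction l with
  | zero => simp [M.dX_one]
  | succ l ih =>
    rw [List.ofFn_succ, List.prod_cons, M.dX_st_mul i (θ 0).2, ih fun j => θ j.succ, mul_zero,
      smul_zero]

theorem iter_dX_monomial (Q : R) (hQ : ∀ i, M.dX i Q = 0) :
    iter (fun k => M.dX (w k)) ((List.ofFn fun k => M.sx (x k)).prod * Q) =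
      (∑ ρ : Equiv.Perm (Fin m), koszul K ρ (fun k => e k + n) *
        ∏ k, B.b.coord (w k) (x (ρ k))) • Q := by
  refine iter_prod _ _ (fun i j => B.b.coord (w i) (x j)) (fun k => B.dg (w k) + n) _
    (fun i j r => M.dX_sx_mul _ _ _) (fun i j h => ?_) fun i => hQ _
  have : B.dg (w i) = e j := by
    by_contra h2
    exact h (B.coord_eq_zero (x j).2 h2)
  simp [this]

/-- The derivatives along X pair with the letters s^n x and treat the s θ as constants; those along
Y then pair with the s θ. By `iter_prod` each pairing is a signed sum over permutations. -/
theorem coef_monomial : M.coef w v ((List.ofFn fun k => M.sx (x k)).prod *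
      (List.ofFn fun j => M.st (θ j : Module.Dual K g.carrier)).prod) =
    (∑ ρ : Equiv.Perm (Fin m), koszul K ρ (fun k => e k + n) * ∏ k, B.b.coord (w k) (x (ρ k))) *
      ∑ σ : Equiv.Perm (Fin l), koszul K σ (fun j => f j + 1) *
        ∏ j, (θ (σ j) : Module.Dual K g.carrier) (B.b (v j)) := by
  rw [coef_apply, iter_dX_monomial _ _ _ _ (M.dX_prod_st θ), map_smul, map_smul, smul_eq_mul]
  congr 1
  have := iter_prod (fun j => M.dY (v j)) (fun j => M.st (θ j : Module.Dual K g.carrier))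
    (fun i j => (θ j : Module.Dual K g.carrier) (B.b (v i))) (fun j => 1 - B.dg (v j))
    (fun j => f j + 1) (fun i j r => M.dY_st_mul _ (θ j).2 _) (fun i j h => ?_) (r := 1)
    fun i => M.dY_one _
  · rw [mul_one] at this
    rw [this, map_smul, map_one, smul_eq_mul, mul_one]
  · have : f j = -B.dg (v i) := by
      by_contra h2
      exact h (B.apply_eq_zero (θ j).2 h2)
    rw [this]
    exact ⟨0, by ring⟩

theorem coef_monomial_of_ne (v : Fin l' → ι) (h : l' ≠ l) :
    M.coef w v ((List.ofFn fun k => M.sx (x k)).prod *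
      (List.ofFn fun j => M.st (θ j : Module.Dual K g.carrier)).prod) = 0 := by
  rw [coef_apply, iter_dX_monomial _ _ _ _ (M.dX_prod_st θ), map_smul, map_smul]
  have := iter_prod_eq_zero (fun j => M.dY (v j)) (fun j => M.st (θ j : Module.Dual K g.carrier))
    (fun i j => (θ j : Module.Dual K g.carrier) (B.b (v i))) (fun j => 1 - B.dg (v j))
    (fun j => f j + 1) (fun i j r => M.dY_st_mul _ (θ j).2 _) (fun i => M.dY_one _)
    M.aug.toLinearMap (fun j r => ?_) h.symm
  · rw [AlgHom.toLinearMap_apply] at this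
    rw [this, smul_zero]
  · rw [AlgHom.toLinearMap_apply, map_mul, M.aug_st, zero_mul]

end Monomial

/-- The monomials in the generators attached to a basis. -/
def mono : R := (List.ofFn fun k => M.X (w k)).prod * (List.ofFn fun j => M.Y (v j)).prod

theorem mono_mem : M.mono w v ∈ M.gr m (∑ k, (B.dg (w k) + n) + ∑ j, (1 - B.dg (v j))) := by
  have := M.monomial_mem (fun k => ⟨B.b (w k), B.mem (w k)⟩)
    fun j => (⟨_, B.coord_mem (v j)⟩ : g.dualGr _)
  simp only [neg_add_eq_sub] at this
  exact this

theorem mono_perm (ρ : Equiv.Perm (Fin m)) (σ : Equiv.Perm (Fin l)) : M.mono w v =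
    (koszul K ρ (fun k => B.dg (w k) + n) * koszul K σ fun j => 1 - B.dg (v j)) •
      M.mono (w ∘ ρ) (v ∘ σ) := by
  rw [mono, prod_reorder (K := K) ρ _ _ fun i j => M.comm (M.X_mem (w i)) (M.X_mem (w j)),
    prod_reorder (K := K) σ _ _ fun i j => M.comm (M.Y_mem (v i)) (M.Y_mem (v j)),
    smul_mul_smul_comm]
  rfl

theorem prod_ite_eq [DecidableEq ι] {N : ℕ} (a b : Fin N → ι) :
    (∏ k, if a k = b k then (1 : K) else 0) = if a = b then 1 else 0 := by
  rw [Finset.prod_ite_zero]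
  simp [funext_iff]

theorem coef_mono [DecidableEq ι] (w' : Fin m → ι) (v' : Fin l → ι) :
    M.coef w v (M.mono w' v') =
      (∑ ρ : Equiv.Perm (Fin m), koszul K ρ (fun k => B.dg (w' k) + n) *
        if w = w' ∘ ρ then 1 else 0) *
      ∑ σ : Equiv.Perm (Fin l), koszul K σ (fun j => 1 - B.dg (v' j)) *
        if v = v' ∘ σ then 1 else 0 := by
  have := M.coef_monomial w v (fun k => ⟨B.b (w' k), B.mem (w' k)⟩)
    fun j => (⟨_, B.coord_mem (v' j)⟩ : g.dualGr _)
  simp only [neg_add_eq_sub] at this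
  refine this.trans ?_
  congr 1
  · refine Finset.sum_congr rfl fun ρ _ => ?_
    rw [← prod_ite_eq]
    congr 1
    refine Finset.prod_congr rfl fun k _ => ?_
    simp [Finsupp.single_apply, eq_comm]
  · refine Finset.sum_congr rfl fun ρ _ => ?_
    rw [← prod_ite_eq]
    congr 1
    refine Finset.prod_congr rfl fun k _ => ?_
    simp [Finsupp.single_apply]

theorem coef_mono_of_ne {l' : ℕ} (h : l' ≠ l) (v : Fin l' → ι) (w' : Fin m → ι) (v' : Fin l → ι) :
    M.coef w v (M.mono w' v') = 0 :=
  M.coef_monomial_of_ne w (fun k => ⟨B.b (w' k), B.mem (w' k)⟩)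
    (fun j => (⟨_, B.coord_mem (v' j)⟩ : g.dualGr _)) v h

end PolModel
end PolModelCoef

/-! ### Reconstruction from Taylor coefficients, and the coefficients of the differential. -/

section PolModelDiff
variable {K : Type*} [Field K]

/-- For each `ρ` only the word `w ∘ ρ⁻¹` contributes; by the symmetry of `G` its sign occurs twice
and cancels. So every one of the m! permutations contributes `G w`. -/
theorem sum_koszul_orbit {ι : Type*} [Fintype ι] [DecidableEq ι] {m : ℕ} (d : ι → ℤ)
    (G : (Fin m → ι) → K) (hG : ∀ (ρ : Equiv.Perm (Fin m)) w,
      G w = koszul K ρ (fun k => d (w k)) * G (w ∘ ρ)) (w : Fin m → ι) :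
    ∑ w', G w' * ∑ ρ : Equiv.Perm (Fin m), koszul K ρ (fun k => d (w' k)) *
      (if w = w' ∘ ρ then 1 else 0) = (m.factorial : K) * G w := by
  simp only [Finset.mul_sum]
  rw [Finset.sum_comm]
  have : ∀ ρ : Equiv.Perm (Fin m), ∑ w', G w' * (koszul K ρ (fun k => d (w' k)) *
      (if w = w' ∘ ρ then 1 else 0)) = G w := by
    intro ρ
    rw [Finset.sum_eq_single (w ∘ ρ.symm)]
    · have h : (w ∘ ρ.symm) ∘ ρ = w := by ext k; simp
      rw [h, if_pos rfl, mul_one, hG ρ (w ∘ ρ.symm), h, mul_right_comm, koszul_mul_self, one_mul]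
    · intro w' _ hw'
      rw [if_neg, mul_zero, mul_zero]
      rintro rfl
      exact hw' (by ext k; simp)
    · exact fun h => absurd (Finset.mem_univ _) h
  rw [Finset.sum_congr rfl fun ρ _ => this ρ, Finset.sum_const, Finset.card_univ,
    Fintype.card_perm, Fintype.card_fin, nsmul_eq_mul]

theorem exists_iter_update {R : Type*} [Monoid R] {N : ℕ} (D : Fin N → R) (j : Fin N) :
    ∃ a b : R, ∀ x, iter (Function.update D j x) = a * x * b := by
  induction N with
  | zero => exact j.elim0
  | succ N ih =>
    refine Fin.cases ?_ (fun j => ?_) j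
    · refine ⟨iter fun i => D i.succ, 1, fun x => ?_⟩
      rw [iter_succ, Function.update_self, mul_one]
      congr 1
    · obtain ⟨a, b, h⟩ := ih (fun i => D i.succ) j
      refine ⟨a, b * D 0, fun x => ?_⟩
      rw [iter_succ, Function.update_of_ne (Fin.succ_ne_zero j).symm, ← mul_assoc, ← h]
      congr 2
      ext i
      by_cases hi : i = j
      · subst hi; simp
      · rw [Function.update_of_ne hi, Function.update_of_ne (by simpa using hi)]

theorem iter_update_sum {R : Type*} [Ring R] [Algebra K R] {ι : Type*} [Fintype ι] {N : ℕ}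
    (D : Fin N → R) (j : Fin N) (c : ι → K) (E : ι → R) :
    iter (Function.update D j (∑ a, c a • E a)) =
      ∑ a, c a • iter (Function.update D j (E a)) := by
  obtain ⟨a, b, h⟩ := exists_iter_update D j
  simp only [h, Finset.mul_sum, Finset.sum_mul, mul_smul_comm, smul_mul_assoc]

/-- `Δ` travels through the word, meeting `D 0` first. At the letter `j` the commutator leaves the
word with that letter replaced by `E j`, with the signs collected from the letters already passed.
-/
theorem iter_mul_of_commutator {R : Type*} [Ring R] [Algebra K R] {N : ℕ} (D : Fin N → R) (Δ : R)
    (e : Fin N → ℤ) (E : Fin N → R) (h : ∀ j, D j * Δ = sgn K (e j) • (Δ * D j) + E j) :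
    iter D * Δ = sgn K (∑ j, e j) • (Δ * iter D) +
      ∑ j, sgn K (∑ k, if k < j then e k else 0) • iter (Function.update D j (E j)) := by
  induction N with
  | zero => simp [iter_zero, sgn_zero]
  | succ N ih =>
    have h1 : ∀ j : Fin N, iter (Function.update D j.succ (E j.succ)) =
        iter (Function.update (fun i => D i.succ) j (E j.succ)) * D 0 := by
      intro j
      rw [iter_succ, Function.update_of_ne (Fin.succ_ne_zero j).symm]
      congr 2
      ext i
      by_cases hi : i = j
      · subst hi; simp
      · rw [Function.update_of_ne hi, Function.update_of_ne (by simpa using hi)]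
    have h2 : iter (Function.update D 0 (E 0)) = iter (fun i => D i.succ) * E 0 := by
      rw [iter_succ, Function.update_self]
      congr 1
    rw [Fin.sum_univ_succ (n := N) (f := fun j => sgn K _ • iter (Function.update D j (E j))), h2,
      iter_succ, mul_assoc, h, mul_add, mul_smul_comm, ← mul_assoc,
      ih (fun i => D i.succ) (fun i => e i.succ) (fun i => E i.succ) fun j => h j.succ, add_mul,
      smul_add, smul_mul_assoc, smul_smul, ← sgn_add, Fin.sum_univ_succ, mul_assoc Δ, add_assoc,
      Finset.sum_mul, Finset.smul_sum]
    congr 1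
    rw [add_comm]
    congr 1
    · simp [sgn_zero]
    · refine Finset.sum_congr rfl fun j _ => ?_
      rw [h1, Fin.sum_univ_succ, smul_mul_assoc, smul_smul, ← sgn_add]
      simp [Fin.succ_pos]

/-- The induction step for the commutator of a partial derivative `D i` with a linear vector field
`Δ`. On `u k * P`, the hypotheses `h1` and `h2` match the terms in `Δ P` and in `P`; `h3` and `h4`
match the terms with one derivative of `P`. -/
theorem commutator_mul {ι R : Type*} [Fintype ι] [Ring R] [Algebra K R] {D : ι → Module.End K R}
    {Δ : Module.End K R} {u : ι → R} {p s c N : ι → ι → K} {t r : ι → K}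
    (hD : ∀ i k P, D i (u k * P) = p i k • P + s i k • (u k * D i P))
    (hΔ : ∀ k P, Δ (u k * P) = (∑ a, c a k • u a) * P + t k • (u k * Δ P))
    (h1 : ∀ i k, t k * p i k = r i * p i k)
    (h2 : ∀ i k, ∑ a, c a k * p i a = ∑ a, N i a * p a k)
    (h3 : ∀ i k a, c a k * s i a = r i * s i k * c a k)
    (h4 : ∀ i k a, t k * s i k * N i a = N i a * s a k) {i k : ι} {P : R}
    (h : (D i * Δ) P = (r i • (Δ * D i) + ∑ a, N i a • D a) P) :
    (D i * Δ) (u k * P) = (r i • (Δ * D i) + ∑ a, N i a • D a) (u k * P) := by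
  simp only [Module.End.mul_apply, LinearMap.add_apply, LinearMap.smul_apply,
    LinearMap.sum_apply] at h ⊢
  simp only [hD, hΔ, map_add, map_smul, map_sum, Finset.sum_mul, smul_mul_assoc, h, smul_add, mul_add,
    Finset.mul_sum, Finset.smul_sum, mul_smul_comm, smul_smul, Finset.sum_add_distrib,
    ← Finset.sum_smul, h1, h2, h3]
  rw [show r i * (s i k * t k) = t k * (s i k * r i) by ring]
  have h3' : ∀ a, r i * (s i k * c a k) = r i * s i k * c a k := fun a => by ring
  have h4' : ∀ a, t k * (s i k * N i a) = t k * s i k * N i a := fun a => by ring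
  simp only [h3', h4', h4]
  abel

variable {g : Cochain K} [Module.Finite K g.carrier] {ι : Type*} [Fintype ι]
  {B : HomBasis g ι} {n : ℤ} {R : Type*} [Ring R] [Algebra K R]

namespace PolModel
variable (M : PolModel B n R)

/-- The polyvector of weight `m` with given Taylor coefficients. -/
def recon (m l : ℕ) : ((Fin m → ι) → (Fin l → ι) → K) →ₗ[K] R where
  toFun F := ((m.factorial * l.factorial : K)⁻¹) • ∑ w, ∑ v, F w v • M.mono w v
  map_add' F G := by simp only [Pi.add_apply, add_smul, Finset.sum_add_distrib, smul_add]
  map_smul' c F := by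
    simp only [Pi.smul_apply, smul_eq_mul, mul_smul, ← Finset.smul_sum, RingHom.id_apply]
    rw [smul_comm]

theorem recon_apply (m l : ℕ) (F : (Fin m → ι) → (Fin l → ι) → K) : M.recon m l F =
    ((m.factorial * l.factorial : K)⁻¹) • ∑ w, ∑ v, F w v • M.mono w v := rfl

theorem recon_mem {m l : ℕ} {F : (Fin m → ι) → (Fin l → ι) → K} {i : ℤ}
    (hF : ∀ w v, ∑ k, (B.dg (w k) + n) + ∑ j, (1 - B.dg (v j)) ≠ i → F w v = 0) :
    M.recon m l F ∈ M.gr m i := by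
  refine Submodule.smul_mem _ _ (Submodule.sum_mem _ fun w _ => Submodule.sum_mem _ fun v _ => ?_)
  by_cases h : ∑ k, (B.dg (w k) + n) + ∑ j, (1 - B.dg (v j)) = i
  · rw [← h]
    exact Submodule.smul_mem _ _ (M.mono_mem w v)
  · rw [hF w v h, zero_smul]
    exact zero_mem _

theorem factorials_ne_zero [CharZero K] (m l : ℕ) : (m.factorial * l.factorial : K) ≠ 0 :=
  mul_ne_zero (Nat.cast_ne_zero.2 m.factorial_ne_zero) (Nat.cast_ne_zero.2 l.factorial_ne_zero)

/-- Only rearrangements of (w, v) contribute. The symmetry of `F` makes all contributions equal, so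
`sum_koszul_orbit`, applied to both words, produces the factor m! l! in the denominator. -/
theorem coef_recon [CharZero K] {m l : ℕ} {F : (Fin m → ι) → (Fin l → ι) → K}
    (hX : ∀ (ρ : Equiv.Perm (Fin m)) w v,
      F w v = koszul K ρ (fun k => B.dg (w k) + n) * F (w ∘ ρ) v)
    (hY : ∀ (σ : Equiv.Perm (Fin l)) w v,
      F w v = koszul K σ (fun j => 1 - B.dg (v j)) * F w (v ∘ σ)) (w : Fin m → ι)
    (v : Fin l → ι) : M.coef w v (M.recon m l F) = F w v := by
  classical
  rw [recon_apply]
  simp only [map_smul, map_sum, M.coef_mono, smul_eq_mul]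
  have h1 : ∀ w' : Fin m → ι, ∑ v', F w' v' * ((∑ ρ : Equiv.Perm (Fin m),
      koszul K ρ (fun k => B.dg (w' k) + n) * if w = w' ∘ ρ then 1 else 0) *
      ∑ σ : Equiv.Perm (Fin l), koszul K σ (fun j => 1 - B.dg (v' j)) *
        if v = v' ∘ σ then 1 else 0) = l.factorial * (F w' v * ∑ ρ : Equiv.Perm (Fin m),
      koszul K ρ (fun k => B.dg (w' k) + n) * if w = w' ∘ ρ then 1 else 0) := by
    intro w'
    rw [← mul_assoc, ← sum_koszul_orbit (fun i => 1 - B.dg i) (F w') (fun σ v => hY σ w' v) v,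
      Finset.sum_mul]
    exact Finset.sum_congr rfl fun v' _ => by ring
  rw [Finset.sum_congr rfl fun w' _ => h1 w', ← Finset.mul_sum,
    sum_koszul_orbit (fun i => B.dg i + n) (fun w => F w v) (fun ρ w => hX ρ w v) w]
  rw [← mul_assoc (l.factorial : K), mul_comm (l.factorial : K),
    inv_mul_cancel_left₀ (factorials_ne_zero m l)]

theorem coef_recon_of_ne {m l l' : ℕ} (h : l' ≠ l) (F : (Fin m → ι) → (Fin l → ι) → K)
    (w : Fin m → ι) (v : Fin l' → ι) : M.coef w v (M.recon m l F) = 0 := by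
  rw [recon_apply]
  simp only [map_smul, map_sum, M.coef_mono_of_ne w h, smul_zero, Finset.sum_const_zero]

/-- The coefficients of a monomial are supported on its rearrangements, and each rearranged monomial
with its sign is the original one; the m! l! equal terms cancel the denominator. -/
theorem recon_coef_mono [CharZero K] {m l : ℕ} (w : Fin m → ι) (v : Fin l → ι) :
    M.recon m l (fun w' v' => M.coef w' v' (M.mono w v)) = M.mono w v := by
  classical
  rw [recon_apply, inv_smul_eq_iff₀ (factorials_ne_zero m l)]
  have h : ∀ (ρ : Equiv.Perm (Fin m)) (σ : Equiv.Perm (Fin l)),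
      (koszul K ρ (fun k => B.dg (w k) + n) * koszul K σ fun j => 1 - B.dg (v j)) •
        M.mono (w ∘ ρ) (v ∘ σ) = M.mono w v := fun ρ σ => (M.mono_perm w v ρ σ).symm
  have h2 : ∑ w' : Fin m → ι, ∑ v' : Fin l → ι, M.coef w' v' (M.mono w v) • M.mono w' v' =
      ∑ ρ : Equiv.Perm (Fin m), ∑ σ : Equiv.Perm (Fin l),
        (koszul K ρ (fun k => B.dg (w k) + n) * koszul K σ fun j => 1 - B.dg (v j)) •
          M.mono (w ∘ ρ) (v ∘ σ) := by
    simp only [M.coef_mono, Finset.sum_mul_sum, Finset.sum_smul]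
    simp_rw [Finset.sum_comm (s := (Finset.univ : Finset (Fin l → ι)))]
    rw [Finset.sum_comm]
    refine Finset.sum_congr rfl fun ρ _ => ?_
    rw [Finset.sum_eq_single (w ∘ ρ)]
    · refine Finset.sum_congr rfl fun σ _ => ?_
      rw [Finset.sum_eq_single (v ∘ σ)]
      · simp
      · intro v' _ hv'
        simp [hv']
      · exact fun h => absurd (Finset.mem_univ _) h
    · intro w' _ hw'
      simp [hw']
    · exact fun h => absurd (Finset.mem_univ _) h
  rw [h2]
  simp only [h, Finset.sum_const, Finset.card_univ, Fintype.card_perm, Fintype.card_fin]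
  rw [← Nat.cast_smul_eq_nsmul K, ← Nat.cast_smul_eq_nsmul K, smul_smul]

/-- Taylor expansion. It extends linearly from monomials, since these span; the equality is kept for
all large `N'` so that the bounds of two summands can be merged. -/
theorem exists_sum_recon_coef [CharZero K] {m : ℕ} {i : ℤ} {P : R} (hP : P ∈ M.gr m i) :
    ∃ N, ∀ N', N ≤ N' →
      ∑ l ∈ Finset.range N', M.recon m l (fun w v => M.coef w v P) = P := by
  have h := M.gr_le_span m i hP
  clear hP
  induction h using Submodule.span_induction with
  | mem P h =>
    obtain ⟨l, w, v, -, rfl⟩ := h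
    refine ⟨l + 1, fun N' hN' => ?_⟩
    change ∑ l' ∈ _, M.recon m l' (fun w' v' => M.coef w' v' (M.mono w v)) = M.mono w v
    rw [Finset.sum_eq_single l, M.recon_coef_mono]
    · intro l' _ hl'
      have : (fun (w' : Fin m → ι) (v' : Fin l' → ι) => M.coef w' v' (M.mono w v)) = 0 := by
        ext w' v'
        exact M.coef_mono_of_ne w' hl' v' w v
      rw [this, map_zero]
    · intro h
      exact absurd (Finset.mem_range.2 (by omega)) h
  | zero => exact ⟨0, fun N' _ => Finset.sum_eq_zero fun l _ => by
      have : (fun (w : Fin m → ι) (v : Fin l → ι) => M.coef w v (0 : R)) = 0 := by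
        ext w v; exact map_zero _
      rw [this, map_zero]⟩
  | add x y _ _ hx hy =>
    obtain ⟨N₁, h₁⟩ := hx
    obtain ⟨N₂, h₂⟩ := hy
    refine ⟨max N₁ N₂, fun N' hN' => ?_⟩
    conv_rhs => rw [← h₁ N' (le_of_max_le_left hN'), ← h₂ N' (le_of_max_le_right hN')]
    rw [← Finset.sum_add_distrib]
    refine Finset.sum_congr rfl fun l _ => ?_
    rw [← map_add]
    congr 1
    ext w v
    exact map_add _ _ _
  | smul c x _ hx =>
    obtain ⟨N, h⟩ := hx
    refine ⟨N, fun N' hN' => ?_⟩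
    conv_rhs => rw [← h N' hN']
    rw [Finset.smul_sum]
    refine Finset.sum_congr rfl fun l _ => ?_
    rw [← map_smul]
    congr 1
    ext w v
    exact map_smul _ _ _

/-- The matrix of the differential of `g`. -/
def dmat (B : HomBasis g ι) (i j : ι) : K := B.b.coord i (g.d (B.b j))

theorem dmat_eq_zero (B : HomBasis g ι) {i j : ι} (h : B.dg i ≠ B.dg j + 1) : dmat B i j = 0 :=
  B.coord_eq_zero (g.d_mem (B.mem j)) h

/-- The differential is a linear vector field, so its graded commutator with a constant one is
constant, with coefficients from the matrix of `d`. A nonzero entry of that matrix fixes the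
difference of two degrees, and this makes the signs match. -/
theorem dX_diff (i : ι) : M.dX i * M.diff =
    sgn K (B.dg i + n) • (M.diff * M.dX i) + ∑ a, (sgn K n * dmat B i a) • M.dX a := by
  classical
  refine M.hom_ext ?_ (fun k P h => ?_) fun k P h => ?_
  · simp [M.dX_one, M.diff_one]
  · refine commutator_mul (r := fun i => sgn K (B.dg i + n)) (N := fun i a => sgn K n * dmat B i a)
      M.dX_X_mul' M.diff_X_mul ?_ ?_ ?_ ?_ h
    · intro i k
      by_cases h : i = k <;> simp [h]
    · intro i k
      simp [dmat]
    · intro i k a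
      change sgn K n * dmat B a k * _ = _ * (sgn K n * dmat B a k)
      by_cases h : B.dg a = B.dg k + 1
      · rw [h, ← sgn_add, mul_comm]
        congr 1
        exact sgn_eq ⟨0, by ring⟩
      · rw [dmat_eq_zero B h]; ring
    · intro i k a
      by_cases h : B.dg i = B.dg a + 1
      · rw [h, ← sgn_add, mul_comm]
        congr 1
        exact sgn_eq ⟨B.dg k + n, by ring⟩
      · rw [dmat_eq_zero B h]; ring
  · refine commutator_mul (r := fun i => sgn K (B.dg i + n)) (N := fun i a => sgn K n * dmat B i a)
      (c := fun a i => sgn K (B.dg i) * dmat B i a)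
      M.dX_Y_mul' M.diff_Y_mul ?_ ?_ ?_ ?_ h
    · intro i k
      rw [mul_zero, mul_zero]
    · intro i k
      simp
    · intro i k a
      by_cases h : B.dg k = B.dg a + 1
      · rw [h, ← sgn_add, mul_comm]
        congr 1
        exact sgn_eq ⟨-(B.dg i + n) * 0, by ring⟩
      · rw [dmat_eq_zero B h]; ring
    · intro i k a
      by_cases h : B.dg i = B.dg a + 1
      · rw [h, ← sgn_add, mul_comm]
        congr 1
        exact sgn_eq ⟨1 - B.dg k, by ring⟩
      · rw [dmat_eq_zero B h]; ring

theorem dY_diff (i : ι) : M.dY i * M.diff =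
    sgn K (1 - B.dg i) • (M.diff * M.dY i) + ∑ a, (sgn K (B.dg a) * dmat B a i) • M.dY a := by
  classical
  refine M.hom_ext ?_ (fun k P h => ?_) fun k P h => ?_
  · simp [M.dY_one, M.diff_one]
  · refine commutator_mul (r := fun i => sgn K (1 - B.dg i))
      (N := fun i a => sgn K (B.dg a) * dmat B a i)
      M.dY_X_mul' M.diff_X_mul ?_ ?_ ?_ ?_ h
    · intro i k
      rw [mul_zero, mul_zero]
    · intro i k
      simp
    · intro i k a
      change sgn K n * dmat B a k * _ = _ * (sgn K n * dmat B a k)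
      by_cases h : B.dg a = B.dg k + 1
      · rw [h, ← sgn_add, mul_comm]
        congr 1
        exact sgn_eq ⟨0, by ring⟩
      · rw [dmat_eq_zero B h]; ring
    · intro i k a
      by_cases h : B.dg a = B.dg i + 1
      · rw [h, ← sgn_add, mul_comm]
        congr 1
        exact sgn_eq ⟨B.dg k + n, by ring⟩
      · rw [dmat_eq_zero B h]; ring
  · refine commutator_mul (r := fun i => sgn K (1 - B.dg i))
      (N := fun i a => sgn K (B.dg a) * dmat B a i)
      (c := fun a i => sgn K (B.dg i) * dmat B i a)
      M.dY_Y_mul' M.diff_Y_mul ?_ ?_ ?_ ?_ h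
    · intro i k
      by_cases h : i = k <;> simp [h]
    · intro i k
      simp
    · intro i k a
      by_cases h : B.dg k = B.dg a + 1
      · rw [h, ← sgn_add, mul_comm]
        congr 1
        exact sgn_eq ⟨0, by ring⟩
      · rw [dmat_eq_zero B h]; ring
    · intro i k a
      by_cases h : B.dg a = B.dg i + 1
      · rw [h, ← sgn_add, mul_comm]
        congr 1
        exact sgn_eq ⟨1 - B.dg k, by ring⟩
      · rw [dmat_eq_zero B h]; ring

theorem aug_diff (P : R) : M.aug (M.diff P) = 0 := by
  suffices h : M.aug.toLinearMap ∘ₗ M.diff = 0 from LinearMap.congr_fun h P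
  refine M.hom_ext ?_ (fun k P h => ?_) fun k P h => ?_
  · simp [M.diff_one]
  · have := M.diff_X_mul k P
    simp only [LinearMap.comp_apply, LinearMap.zero_apply, AlgHom.toLinearMap_apply]
    rw [X, this]
    simp [M.aug_sx]
  · have := M.diff_Y_mul k P
    simp only [LinearMap.comp_apply, LinearMap.zero_apply, AlgHom.toLinearMap_apply]
    rw [Y, this]
    simp [M.aug_st]

theorem update_comp {α β : Type*} {N : ℕ} (f : α → β) (w : Fin N → α) (k : Fin N) (a : α) :
    Function.update (fun i => f (w i)) k (f a) = fun i => f (Function.update w k a i) := by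
  ext i
  by_cases h : i = k
  · subst h; simp
  · simp [h]

/-- The differential is moved through both words. Once it is outermost the augmentation kills it
(`aug_diff`), so only the words with one replaced letter survive. -/
theorem coef_diff {m l : ℕ} (w : Fin m → ι) (v : Fin l → ι) (P : R) : M.coef w v (M.diff P) =
    ∑ k, sgn K (∑ j, if j < k then B.dg (w j) + n else 0) *
        ∑ a, sgn K n * dmat B (w k) a * M.coef (Function.update w k a) v P +
      sgn K (∑ k, (B.dg (w k) + n)) * ∑ k, sgn K (∑ j, if j < k then 1 - B.dg (v j) else 0) *
        ∑ a, sgn K (B.dg a) * dmat B a (v k) * M.coef w (Function.update v k a) P := by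
  have h1 := iter_mul_of_commutator (fun k => M.dX (w k)) M.diff _ _ fun k => M.dX_diff (w k)
  have h2 := iter_mul_of_commutator (fun k => M.dY (v k)) M.diff _ _ fun k => M.dY_diff (v k)
  have e1 : ∀ j, iter (Function.update (fun k => M.dX (w k)) j
      (∑ a, (sgn K n * dmat B (w j) a) • M.dX a)) =
      ∑ a, (sgn K n * dmat B (w j) a) • iter fun i => M.dX (Function.update w j a i) := by
    intro j
    rw [iter_update_sum (fun k => M.dX (w k)) j (fun a => sgn K n * dmat B (w j) a) M.dX]
    simp only [update_comp]
  have e2 : ∀ j, iter (Function.update (fun k => M.dY (v k)) j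
      (∑ a, (sgn K (B.dg a) * dmat B a (v j)) • M.dY a)) =
      ∑ a, (sgn K (B.dg a) * dmat B a (v j)) • iter fun i => M.dY (Function.update v j a i) := by
    intro j
    rw [iter_update_sum (fun k => M.dY (v k)) j (fun a => sgn K (B.dg a) * dmat B a (v j)) M.dY]
    simp only [update_comp]
  simp only [e1] at h1
  simp only [e2] at h2
  rw [coef_apply, ← Module.End.mul_apply _ M.diff, h1, LinearMap.add_apply, map_add, map_add,
    add_comm]
  congr 1
  · simp only [LinearMap.sum_apply, LinearMap.smul_apply, map_sum, map_smul, smul_eq_mul,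
      Finset.mul_sum]
    rfl
  · rw [LinearMap.smul_apply, map_smul, map_smul, smul_eq_mul]
    congr 1
    rw [Module.End.mul_apply, ← Module.End.mul_apply _ M.diff, h2, LinearMap.add_apply, map_add,
      LinearMap.smul_apply, map_smul, Module.End.mul_apply, M.aug_diff, smul_zero, zero_add]
    simp only [LinearMap.sum_apply, LinearMap.smul_apply, map_sum, map_smul, smul_eq_mul,
      Finset.mul_sum]
    rfl

end PolModel
end PolModelDiff

/-! ### The bracket as a bidifferential operator, and Taylor coefficients of products. -/

section PolModelSchouten
variable {K : Type*} [Field K]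

/-- Sums over subsets, sorted by cardinality and expressed in terms of shuffles. -/
theorem sum_fun_bool_eq_sum_Sh {X : Type*} [AddCommMonoid X] {l : ℕ} (f : (Fin l → Bool) → X) :
    ∑ c, f c = ∑ q : Finset.HasAntidiagonal.antidiagonal l, ∑ σ ∈ Sh q.1.1 q.1.2,
      f fun i => firstBlock σ (Fin.cast (Finset.HasAntidiagonal.mem_antidiagonal.1 q.2).symm i) := by
  classical
  have h1 : ∀ q : Finset.HasAntidiagonal.antidiagonal l, ∑ σ ∈ Sh q.1.1 q.1.2,
      f (fun i => firstBlock σ (Fin.cast (Finset.HasAntidiagonal.mem_antidiagonal.1 q.2).symm i)) =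
      ∑ c : Fin l → Bool with (Finset.univ.filter fun i => c i = true).card = q.1.1, f c := by
    rintro ⟨⟨a, b⟩, h⟩
    obtain rfl : a + b = l := Finset.HasAntidiagonal.mem_antidiagonal.1 h
    exact (sum_choose_eq_sum_Sh f).symm
  rw [Finset.sum_congr rfl fun q _ => h1 q,
    Finset.sum_coe_sort (Finset.HasAntidiagonal.antidiagonal l) fun q : ℕ × ℕ => ∑ c : Fin l → Bool with
      (Finset.univ.filter fun i => c i = true).card = q.1, f c,
    Finset.Nat.sum_antidiagonal_eq_sum_range_succ fun a _ => ∑ c : Fin l → Bool with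
      (Finset.univ.filter fun i => c i = true).card = a, f c]
  refine (Finset.sum_fiberwise_of_maps_to (fun c _ => ?_) _).symm
  rw [Finset.mem_range, Nat.lt_succ_iff]
  exact (Finset.card_le_univ _).trans (Fintype.card_fin l).le

variable {g : Cochain K} [Module.Finite K g.carrier] {ι : Type*} [Fintype ι]
  {B : HomBasis g ι} {n : ℤ} {R : Type*} [Ring R] [Algebra K R]

namespace PolModel
variable (M : PolModel B n R)

/-- Both sides vanish on 1 and obey the same rule under left multiplication by a letter. -/
theorem schouten_eq {P : R} (hP : P ∈ M.deg (n + 2)) : M.schouten P hP =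
    ∑ i, ((-sgn K (n * (B.dg i - 1))) • (LinearMap.mulLeft K (M.dY i P) ∘ₗ M.dX i) +
      (-sgn K n) • (LinearMap.mulLeft K (M.dX i P) ∘ₗ M.dY i)) := by
  classical
  -- Moves the coefficient `a` past a letter `u`. The parity condition says that `a` together with
  -- the partial derivative behind it is odd, so in all four cases only the sign of the letter
  -- remains.
  have hc : ∀ {i j : ℤ} {a u : R}, a ∈ M.deg i → u ∈ M.deg j → ∀ (t : ℤ) (Q : R),
      Even (t + i - 1) → a * (sgn K (t * j) • (u * Q)) = sgn K j • (u * (a * Q)) := by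
    intro i j a u ha hu t Q h
    rw [mul_smul_comm, ← mul_assoc, M.comm ha hu, smul_mul_assoc, smul_smul, ← sgn_add, mul_assoc]
    congr 1
    refine sgn_eq ?_
    rw [show t * j + i * j - j = (t + i - 1) * j by ring]
    exact h.mul_right _
  have hma : ∀ a b c : R, a * (b + c) = a * b + a * c := mul_add
  have hX : ∀ i, M.dX i P ∈ M.deg (n + 2 - (B.dg i + n)) := fun i => M.dX_mem i hP
  have hY : ∀ i, M.dY i P ∈ M.deg (n + 2 - (1 - B.dg i)) := fun i => M.dY_mem i hP
  have hXX : ∀ i k Q, M.dX i P * (sgn K ((1 - B.dg i) * (B.dg k + n)) • (M.X k * Q)) =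
      sgn K (B.dg k + n) • (M.X k * (M.dX i P * Q)) := fun i k Q =>
    hc (hX i) (M.X_mem k) _ Q ⟨1 - B.dg i, by ring⟩
  have hYX : ∀ i k Q, M.dY i P * (sgn K ((B.dg i + n) * (B.dg k + n)) • (M.X k * Q)) =
      sgn K (B.dg k + n) • (M.X k * (M.dY i P * Q)) := fun i k Q =>
    hc (hY i) (M.X_mem k) _ Q ⟨B.dg i + n, by ring⟩
  have hXY : ∀ i k Q, M.dX i P * (sgn K ((1 - B.dg i) * (1 - B.dg k)) • (M.Y k * Q)) =
      sgn K (1 - B.dg k) • (M.Y k * (M.dX i P * Q)) := fun i k Q =>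
    hc (hX i) (M.Y_mem k) _ Q ⟨1 - B.dg i, by ring⟩
  have hYY : ∀ i k Q, M.dY i P * (sgn K ((B.dg i + n) * (1 - B.dg k)) • (M.Y k * Q)) =
      sgn K (1 - B.dg k) • (M.Y k * (M.dY i P * Q)) := fun i k Q =>
    hc (hY i) (M.Y_mem k) _ Q ⟨B.dg i + n, by ring⟩
  refine M.hom_ext ?_ (fun k Q h => ?_) fun k Q h => ?_
  · simp [M.schouten_one, M.dX_one, M.dY_one]
  · have h1 := M.schouten_X_mul hP k Q
    rw [h] at h1
    refine h1.trans ?_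
    simp only [LinearMap.sum_apply, LinearMap.add_apply, LinearMap.smul_apply,
      LinearMap.comp_apply, LinearMap.mulLeft_apply, M.dX_X_mul, M.dY_X_mul, hma]
    simp only [hXX, hYX]
    simp only [mul_ite, mul_zero, smul_add, smul_ite, smul_zero, Finset.sum_add_distrib,
      Finset.sum_ite_eq', Finset.mem_univ, if_true, Finset.mul_sum, Finset.smul_sum, hma,
      mul_smul_comm, X, smul_comm (sgn K (B.dg k + n))]
    abel
  · have h1 := M.schouten_Y_mul hP k Q
    rw [h] at h1
    refine h1.trans ?_
    simp only [LinearMap.sum_apply, LinearMap.add_apply, LinearMap.smul_apply,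
      LinearMap.comp_apply, LinearMap.mulLeft_apply, M.dX_Y_mul, M.dY_Y_mul, hma]
    simp only [hXY, hYY]
    simp only [mul_ite, mul_zero, smul_add, smul_ite, smul_zero, Finset.sum_add_distrib,
      Finset.sum_ite_eq', Finset.mem_univ, if_true, Finset.mul_sum, Finset.smul_sum, hma,
      mul_smul_comm, Y, smul_comm (sgn K (1 - B.dg k))]
    abel

/-- Graded commutativity turns the second half of the bracket into the first with the two arguments
exchanged. Over the antidiagonal both halves have the same sum, which absorbs the factor 1/2. -/
theorem half_sum_schouten [CharZero K] {P : ℕ → R} (hP : ∀ p, P p ∈ M.deg (n + 2)) (N : ℕ) :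
    (1 / 2 : K) • ∑ p ∈ Finset.HasAntidiagonal.antidiagonal N, M.schouten (P p.1) (hP p.1) (P p.2) =
      ∑ p ∈ Finset.HasAntidiagonal.antidiagonal N, ∑ i, (-sgn K (n * (B.dg i - 1))) •
        (M.dY i (P p.1) * M.dX i (P p.2)) := by
  have h1 : ∀ p : ℕ × ℕ, M.schouten (P p.1) (hP p.1) (P p.2) =
      ∑ i, (-sgn K (n * (B.dg i - 1))) • (M.dY i (P p.1) * M.dX i (P p.2)) +
      ∑ i, (-sgn K (n * (B.dg i - 1))) • (M.dY i (P p.2) * M.dX i (P p.1)) := by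
    intro p
    rw [M.schouten_eq, ← Finset.sum_add_distrib, LinearMap.sum_apply]
    refine Finset.sum_congr rfl fun i _ => ?_
    rw [LinearMap.add_apply]
    congr 1
    rw [LinearMap.smul_apply, LinearMap.comp_apply, LinearMap.mulLeft_apply,
      M.comm (M.dX_mem i (hP p.1)) (M.dY_mem i (hP p.2)), smul_smul, neg_mul, ← sgn_add]
    congr 2
    refine sgn_eq ?_
    have := Int.even_mul_succ_self (B.dg i)
    rw [show n + (n + 2 - (B.dg i + n)) * (n + 2 - (1 - B.dg i)) - n * (B.dg i - 1) =
      2 * (2 * n - n * B.dg i + 1 + B.dg i) - B.dg i * (B.dg i + 1) by ring]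
    exact (even_two_mul _).sub this
  rw [Finset.sum_congr rfl fun p _ => h1 p, Finset.sum_add_distrib]
  have h2 := Finset.Nat.sum_antidiagonal_swap (n := N) (f := fun p : ℕ × ℕ =>
    ∑ i, (-sgn K (n * (B.dg i - 1))) • (M.dY i (P p.1) * M.dX i (P p.2)))
  simp only [Prod.fst_swap, Prod.snd_swap] at h2
  rw [h2, ← two_smul K, smul_smul]
  norm_num

/-- With fewer than `p` derivatives along X a positive weight is left, which the augmentation kills;
with more the result is already zero. `E` stands for the derivatives along Y still to be applied,
which preserve the weight. -/
theorem iter_filter_dX {N : ℕ} (w : Fin N → ι) (c : Fin N → Bool) {p : ℕ} {i : ℤ} {P : R}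
    (hP : P ∈ M.gr p i) (hc : (Finset.univ.filter fun k => c k = true).card ≠ p)
    {E : Module.End K R} (hE : ∀ (q : ℕ) (j : ℤ) (S : R), S ∈ M.gr q j → ∃ j', E S ∈ M.gr q j') :
    M.aug (E (iter (fun k => if c k then M.dX (w k) else 1) P)) = 0 := by
  set L := (List.finRange N).filter c with hL
  have h1 : iter (fun k => if c k then M.dX (w k) else 1) =
      iter fun k : Fin L.length => M.dX (w (L.get k)) := by
    rw [iter_eq_filter, iter, ← hL]
    congr 2
    conv_lhs => rw [← List.ofFn_get L, List.map_ofFn]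
    rfl
  have h2 : L.length ≠ p := by
    have : (Finset.univ.filter fun k => c k = true) = L.toFinset := by
      ext
      simp [hL]
    rwa [this, List.toFinset_card_of_nodup ((List.nodup_finRange N).filter _)] at hc
  rw [h1]
  rcases lt_or_gt_of_ne h2 with h | h
  · obtain ⟨q, rfl⟩ : ∃ q, p = q + 1 + L.length := ⟨p - L.length - 1, by omega⟩
    obtain ⟨j, hj⟩ := M.iter_dX_mem_gr (fun k => w (L.get k)) hP
    obtain ⟨j, hj⟩ := hE _ _ _ hj
    exact M.aug_of_mem_gr hj
  · rw [M.iter_dX_eq_zero _ h hP, map_zero, map_zero]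

theorem iter_ite_dY_mem_gr {N : ℕ} (v : Fin N → ι) (c : Fin N → Bool) (q : ℕ) (j : ℤ) (S : R)
    (hS : S ∈ M.gr q j) : ∃ j', iter (fun k => if c k then M.dY (v k) else 1) S ∈ M.gr q j' := by
  refine iter_induction (C := fun D : Module.End K R => ∃ j, D S ∈ M.gr q j) ⟨j, hS⟩ ?_
  rintro k x ⟨j, hx⟩
  cases c k
  · exact ⟨j, by simpa using hx⟩
  · exact ⟨_, by simpa using M.dY_mem_gr _ hx⟩

theorem iter_ite_dX_mem {N : ℕ} (w : Fin N → ι) (c : Fin N → Bool) {k : ℤ} {P : R}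
    (hP : P ∈ M.deg k) : ∃ k', iter (fun i => if c i then M.dX (w i) else 1) P ∈ M.deg k' := by
  refine iter_induction (C := fun D : Module.End K R => ∃ j, D P ∈ M.deg j) ⟨k, hP⟩ ?_
  rintro i x ⟨j, hx⟩
  cases c i
  · exact ⟨j, by simpa using hx⟩
  · exact ⟨_, by simpa using M.dX_mem _ hx⟩

theorem aug_iter_dY_mul {l : ℕ} {k : ℤ} {P Q : R} (hP : P ∈ M.deg k) (v : Fin l → ι) :
    M.aug (iter (fun j => M.dY (v j)) (P * Q)) = ∑ c : Fin l → Bool,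
      sgn K (k * ∑ j, if c j then 0 else 1 - B.dg (v j)) * splitSign K (fun j => 1 - B.dg (v j)) c *
        M.aug (iter (fun j => if c j then M.dY (v j) else 1) P) *
        M.aug (iter (fun j => if c j then 1 else M.dY (v j)) Q) := by
  rw [iter_mul (deg := M.deg) (fun j => M.dY (v j)) (fun j => 1 - B.dg (v j))
    (fun i k P hP => M.dY_mem _ hP) (fun i k P hP => M.dY_mul _ hP) hP Q, map_sum]
  exact Finset.sum_congr rfl fun c _ => by rw [map_smul, map_mul, smul_eq_mul, ← mul_assoc]

theorem aug_iter_dY_mul_Sh {l : ℕ} {k : ℤ} {P Q : R} (hP : P ∈ M.deg k) (v : Fin l → ι) :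
    M.aug (iter (fun j => M.dY (v j)) (P * Q)) =
      ∑ s : Finset.HasAntidiagonal.antidiagonal l, ∑ τ ∈ Sh s.1.1 s.1.2,
        (fun (v : Fin (s.1.1 + s.1.2) → ι) =>
          sgn K (k * ∑ j, (1 - B.dg (v (τ (Fin.natAdd s.1.1 j))))) *
          (koszul K τ (fun j => 1 - B.dg (v j)) *
            sgn K ((∑ j, (1 - B.dg (v (τ (Fin.castAdd s.1.2 j))))) *
              ∑ j, (1 - B.dg (v (τ (Fin.natAdd s.1.1 j)))))) *
          M.aug (iter (fun j => M.dY (v (τ (Fin.castAdd s.1.2 j)))) P) *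
          M.aug (iter (fun j => M.dY (v (τ (Fin.natAdd s.1.1 j)))) Q))
        fun j => v (Fin.cast (Finset.HasAntidiagonal.mem_antidiagonal.1 s.2) j) := by
  rw [M.aug_iter_dY_mul hP, sum_fun_bool_eq_sum_Sh]
  refine Finset.sum_congr rfl ?_
  rintro ⟨⟨a, b⟩, h⟩ -
  obtain rfl : a + b = l := Finset.HasAntidiagonal.mem_antidiagonal.1 h
  refine Finset.sum_congr rfl fun τ hτ => ?_
  simp only [Fin.cast_eq_self]
  rw [iter_firstBlock hτ fun j => M.dY (v j), iter_not_firstBlock hτ fun j => M.dY (v j),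
    sum_not_firstBlock, splitSign_firstBlock hτ]

/-- The Taylor coefficients of a product. -/
theorem coef_mul {p q l : ℕ} {k k' : ℤ} {P Q : R} (hPd : P ∈ M.deg k) (hP : P ∈ M.gr p k')
    (w : Fin (p + q) → ι) (v : Fin l → ι) :
    M.coef w v (P * Q) = ∑ σ ∈ Sh p q,
      ∑ s : Finset.HasAntidiagonal.antidiagonal l, ∑ τ ∈ Sh s.1.1 s.1.2,
      (fun (v : Fin (s.1.1 + s.1.2) → ι) =>
        koszul K σ (fun k => B.dg (w k) + n) * koszul K τ (fun j => 1 - B.dg (v j)) *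
        sgn K ((∑ j, (1 - B.dg (v (τ (Fin.castAdd s.1.2 j))))) *
          ∑ k, (B.dg (w (σ (Fin.natAdd p k))) + n)) *
        M.coef (fun k => w (σ (Fin.castAdd q k))) (fun j => v (τ (Fin.castAdd s.1.2 j))) P *
        M.coef (fun k => w (σ (Fin.natAdd p k))) (fun j => v (τ (Fin.natAdd s.1.1 j))) Q)
      fun j => v (Fin.cast (Finset.HasAntidiagonal.mem_antidiagonal.1 s.2) j) := by
  rw [coef_apply, iter_mul (deg := M.deg) (fun k => M.dX (w k)) (fun k => B.dg (w k) + n)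
    (fun i k P hP => M.dX_mem _ hP) (fun i k P hP => M.dX_mul _ hP) hPd Q, map_sum, map_sum]
  simp only [map_smul, smul_eq_mul]
  rw [← Finset.sum_filter_add_sum_filter_not Finset.univ fun c : Fin (p + q) → Bool =>
      (Finset.univ.filter fun i => c i = true).card = p, sum_choose_eq_sum_Sh,
    Finset.sum_eq_zero (s := Finset.univ.filter fun c : Fin (p + q) → Bool =>
      ¬(Finset.univ.filter fun i => c i = true).card = p), add_zero]
  · refine Finset.sum_congr rfl fun σ hσ => ?_
    rw [iter_firstBlock hσ fun k => M.dX (w k), iter_not_firstBlock hσ fun k => M.dX (w k),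
      sum_not_firstBlock, splitSign_firstBlock hσ, M.aug_iter_dY_mul_Sh (M.iter_dX_mem _ hPd),
      Finset.mul_sum]
    refine Finset.sum_congr rfl fun s _ => ?_
    rw [Finset.mul_sum]
    refine Finset.sum_congr rfl fun τ hτ => ?_
    obtain ⟨u, hu⟩ : ∃ u : Fin (s.1.1 + s.1.2) → ι, ∀ j,
      v (Fin.cast (Finset.HasAntidiagonal.mem_antidiagonal.1 s.2) j) = u j := ⟨_, fun _ => rfl⟩
    simp only [hu]
    simp only [← M.coef_apply]
    -- The signs involve the degree `k` of `P`. If it differs from the total degree of the letters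
    -- applied to `P`, the coefficient vanishes; otherwise four signs combine into the single one
    -- claimed.
    by_cases h : ∑ i, (B.dg (w (σ (Fin.castAdd q i))) + n) +
        ∑ j, (1 - B.dg (u (τ (Fin.castAdd s.1.2 j)))) = k
    · rw [← h]
      set x := ∑ i, (B.dg (w (σ (Fin.castAdd q i))) + n)
      set x' := ∑ i, (B.dg (w (σ (Fin.natAdd p i))) + n)
      set y := ∑ j, (1 - B.dg (u (τ (Fin.castAdd s.1.2 j))))
      set y' := ∑ j, (1 - B.dg (u (τ (Fin.natAdd s.1.1 j))))
      have hs : sgn K ((x + y) * x') * sgn K (x * x') * sgn K ((x + y - x) * y') * sgn K (y * y') =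
          sgn K (y * x') := by
        rw [← sgn_add, ← sgn_add, ← sgn_add]
        exact sgn_eq ⟨x * x' + y * y', by ring⟩
      rw [← hs]
      ring
    · rw [M.coef_eq_zero_of_deg _ _ hPd h]
      ring
  -- Selections of the wrong size contribute nothing, by weight.
  · intro c hc
    obtain ⟨k', hk'⟩ := M.iter_ite_dX_mem w c hPd
    rw [M.aug_iter_dY_mul hk', Finset.sum_eq_zero (s := (Finset.univ : Finset (Fin l → Bool))),
      mul_zero]
    intro c' _
    rw [M.iter_filter_dX w c hP (Finset.mem_filter.1 hc).2 fun q j S hS =>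
      M.iter_ite_dY_mem_gr v c' q j S hS, mul_zero, zero_mul]

end PolModel
end PolModelSchouten

/-! ### Matrices of maps between tensor powers. -/

section TensorCoef
variable {K : Type*} [Field K] {g : Cochain K}

/-- On a homogeneous tensor only the vector of its parities survives in the sum defining the
operator, and Koszul signs depend on parities alone. -/
theorem koszulOp_tprod {l : ℕ} (σ : Equiv.Perm (Fin l)) {e : Fin l → ℤ} {y : Fin l → g.carrier}
    (hy : ∀ j, y j ∈ g.gr (e j)) :
    koszulOp g σ (PiTensorProduct.tprod K y) = koszul K σ e • PiTensorProduct.tprod K y := by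
  have hp : ∀ (c : Fin 2) j, parityProj g.isInternal c (y j) =
      if e j % 2 = ((c : ℕ) : ℤ) then y j else 0 := by
    intro c j
    rw [parityProj, gradedMap_of_mem _ _ (hy j)]
    split_ifs <;> rfl
  let c₀ : Fin l → Fin 2 := fun j => ⟨(e j % 2).toNat, by omega⟩
  have hc₀ : ∀ j, ((c₀ j : ℕ) : ℤ) = e j % 2 := fun j => by
    simp only [c₀]
    omega
  rw [koszulOp, LinearMap.sum_apply, Finset.sum_eq_single c₀]
  · rw [LinearMap.smul_apply, PiTensorProduct.map_tprod]
    have h1 : (fun j => parityProj g.isInternal (c₀ j) (y j)) = y := by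
      ext j
      rw [hp, if_pos (hc₀ j).symm]
    rw [h1, koszul_congr σ fun j => ?_]
    rw [hc₀]
    exact ⟨-(e j / 2), by omega⟩
  · intro c _ hc
    obtain ⟨j, hj⟩ := Function.ne_iff.1 hc
    rw [LinearMap.smul_apply, PiTensorProduct.map_tprod,
      (PiTensorProduct.tprod K).map_coord_zero j, smul_zero]
    rw [hp, if_neg]
    rw [← hc₀]
    intro h
    exact hj (Fin.ext (by exact_mod_cast h.symm))
  · exact fun h => absurd (Finset.mem_univ _) h

theorem braid_tprod {l : ℕ} (σ : Equiv.Perm (Fin l)) {e : Fin l → ℤ} {y : Fin l → g.carrier}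
    (hy : ∀ j, y j ∈ g.gr (e j)) :
    braid g σ (PiTensorProduct.tprod K y) =
      koszul K σ e • PiTensorProduct.tprod K fun j => y (σ j) := by
  rw [braid, LinearMap.comp_apply, koszulOp_tprod σ hy, map_smul]
  congr 1
  exact PiTensorProduct.reindex_tprod _ _

namespace HomBasis
variable {ι : Type*} (B : HomBasis g ι)

/-- The basis of the tensor power. -/
def bT (l : ℕ) : Module.Basis (Fin l → ι) K (TPow g l) := Basis.piTensorProduct fun _ => B.b

theorem bT_apply {l : ℕ} (v : Fin l → ι) :
    B.bT l v = PiTensorProduct.tprod K fun j => B.b (v j) := Basis.piTensorProduct_apply _ _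

theorem bT_repr_tprod {l : ℕ} (y : Fin l → g.carrier) (w : Fin l → ι) :
    (B.bT l).repr (PiTensorProduct.tprod K y) w = ∏ j, B.b.coord (w j) (y j) :=
  Basis.piTensorProduct_repr_tprod_apply _ _ _

theorem bT_repr_bT [DecidableEq ι] {l : ℕ} (v w : Fin l → ι) :
    (B.bT l).repr (B.bT l v) w = if w = v then 1 else 0 := by
  rw [Module.Basis.repr_self, Finsupp.single_apply]
  simp only [eq_comm]

theorem braid_bT {l : ℕ} (σ : Equiv.Perm (Fin l)) (v : Fin l → ι) :
    braid g σ (B.bT l v) = koszul K σ (fun j => B.dg (v j)) • B.bT l (v ∘ σ) := by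
  rw [bT_apply, braid_tprod σ fun j => B.mem (v j), bT_apply]
  rfl

/-- The matrix of a map between tensor powers. -/
def mat {l m : ℕ} (w : Fin m → ι) (v : Fin l → ι) : (TPow g l →ₗ[K] TPow g m) →ₗ[K] K :=
  (B.bT m).coord w ∘ₗ LinearMap.applyₗ (B.bT l v)

theorem mat_apply {l m : ℕ} (w : Fin m → ι) (v : Fin l → ι) (L : TPow g l →ₗ[K] TPow g m) :
    B.mat w v L = (B.bT m).repr (L (B.bT l v)) w := rfl

theorem mat_ext {l m : ℕ} {L L' : TPow g l →ₗ[K] TPow g m}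
    (h : ∀ w v, B.mat w v L = B.mat w v L') : L = L' :=
  (B.bT l).ext fun v => (B.bT m).ext_elem fun w => h w v

theorem mat_comp_braid {l m : ℕ} (σ : Equiv.Perm (Fin l)) (L : TPow g l →ₗ[K] TPow g m)
    (w : Fin m → ι) (v : Fin l → ι) : B.mat w v (L ∘ₗ braid g σ) =
      koszul K σ (fun j => B.dg (v j)) * B.mat w (v ∘ σ) L := by
  rw [mat_apply, LinearMap.comp_apply, braid_bT, map_smul, map_smul, mat_apply]
  rfl

/-- Coordinates transform by the transpose of `braid_bT`; `koszul_inv` identifies the two signs. -/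
theorem repr_braid_inv {m : ℕ} (ρ : Equiv.Perm (Fin m)) (w : Fin m → ι) (t : TPow g m) :
    (B.bT m).repr (braid g ρ⁻¹ t) w =
      koszul K ρ (fun k => B.dg (w k)) * (B.bT m).repr t (w ∘ ρ) := by
  classical
  suffices h : (B.bT m).coord w ∘ₗ braid g ρ⁻¹ =
      koszul K ρ (fun k => B.dg (w k)) • (B.bT m).coord (w ∘ ρ) from LinearMap.congr_fun h t
  refine (B.bT m).ext fun v => ?_
  rw [LinearMap.comp_apply, braid_bT, map_smul, LinearMap.smul_apply, Module.Basis.coord_apply,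
    Module.Basis.coord_apply, bT_repr_bT, bT_repr_bT]
  by_cases h : v = w ∘ ρ
  · subst h
    have h2 : (w ∘ ρ) ∘ (ρ⁻¹ : Equiv.Perm (Fin m)) = w := by ext k; simp
    rw [h2, if_pos rfl, if_pos rfl, ← koszul_inv ρ]
    rfl
  · rw [if_neg (Ne.symm h), if_neg, smul_zero, smul_zero]
    rintro rfl
    exact h (by ext k; simp)

theorem mat_braid_inv_comp {l m : ℕ} (ρ : Equiv.Perm (Fin m)) (L : TPow g l →ₗ[K] TPow g m)
    (w : Fin m → ι) (v : Fin l → ι) : B.mat w v (braid g ρ⁻¹ ∘ₗ L) =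
      koszul K ρ (fun k => B.dg (w k)) * B.mat (w ∘ ρ) v L :=
  B.repr_braid_inv ρ w _

theorem coord_signOp (i : ι) (k : ℤ) (y : g.carrier) :
    B.b.coord i (signOp g.isInternal k y) = sgn K (k * B.dg i) * B.b.coord i y := by
  classical
  suffices h : B.b.coord i ∘ₗ signOp g.isInternal k = sgn K (k * B.dg i) • B.b.coord i from
    LinearMap.congr_fun h y
  refine B.b.ext fun j => ?_
  rw [LinearMap.comp_apply, signOp_of_mem _ _ (B.mem j), map_smul, LinearMap.smul_apply]
  by_cases h : i = j
  · rw [h]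
  · simp [h]

variable [Fintype ι]

theorem coord_d (i : ι) (y : g.carrier) :
    B.b.coord i (g.d y) = ∑ a, B.b.coord i (g.d (B.b a)) * B.b.coord a y := by
  conv_lhs => rw [← B.b.sum_repr y, map_sum, map_sum]
  refine Finset.sum_congr rfl fun a _ => ?_
  rw [map_smul, map_smul, smul_eq_mul, mul_comm]
  rfl

theorem repr_tensorD {m : ℕ} (w : Fin m → ι) (t : TPow g m) :
    (B.bT m).repr (tensorD g m t) w = ∑ k, sgn K (∑ j, if j < k then B.dg (w j) else 0) *
      ∑ a, B.b.coord (w k) (g.d (B.b a)) * (B.bT m).repr t (Function.update w k a) := by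
  classical
  suffices h : ∀ y : Fin m → g.carrier, (B.bT m).repr (tensorD g m (PiTensorProduct.tprod K y)) w =
      ∑ k, sgn K (∑ j, if j < k then B.dg (w j) else 0) * ∑ a, B.b.coord (w k) (g.d (B.b a)) *
        (B.bT m).repr (PiTensorProduct.tprod K y) (Function.update w k a) by
    induction t using PiTensorProduct.induction_on with
    | smul_tprod r y =>
      rw [map_smul, map_smul, Finsupp.smul_apply, h, smul_eq_mul, Finset.mul_sum]
      refine Finset.sum_congr rfl fun k _ => ?_
      rw [mul_left_comm, Finset.mul_sum]
      congr 1
      refine Finset.sum_congr rfl fun a _ => ?_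
      rw [map_smul, Finsupp.smul_apply, smul_eq_mul, mul_left_comm]
    | add x y hx hy =>
      simp only [map_add, Finsupp.add_apply, hx, hy, mul_add, Finset.sum_add_distrib]
  intro y
  simp only [tensorD, LinearMap.sum_apply, map_sum, PiTensorProduct.map_tprod,
    Finsupp.coe_finsetSum, Finset.sum_apply, bT_repr_tprod]
  refine Finset.sum_congr rfl fun k _ => ?_
  have h1 : ∀ j, B.b.coord (w j) ((if j < k then signOp g.isInternal 1 else
      if j = k then g.d else LinearMap.id) (y j)) =
      (if j < k then sgn K (B.dg (w j)) else 1) *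
        (if j = k then B.b.coord (w k) (g.d (y k)) else B.b.coord (w j) (y j)) := by
    intro j
    rcases lt_trichotomy j k with h | h | h
    · rw [if_pos h, if_pos h, if_neg h.ne, coord_signOp, one_mul]
    · subst h; simp
    · rw [if_neg h.asymm, if_neg h.ne', if_neg h.asymm, if_neg h.ne', one_mul]
      rfl
  simp only [h1]
  rw [Finset.prod_mul_distrib, sgn_sum]
  congr 1
  · refine Finset.prod_congr rfl fun j _ => ?_
    split_ifs
    · rfl
    · rw [sgn_zero]
  · rw [Finset.prod_eq_mul_prod_sdiff_singleton_of_mem (Finset.mem_univ k), if_pos rfl, coord_d,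
      Finset.sum_mul]
    refine Finset.sum_congr rfl fun a _ => ?_
    rw [Finset.prod_eq_mul_prod_sdiff_singleton_of_mem (Finset.mem_univ k), Function.update_self,
      mul_assoc]
    congr 2
    refine Finset.prod_congr rfl fun j hj => ?_
    have : j ≠ k := by simpa using hj
    rw [if_neg this, Function.update_of_ne this]

theorem tensorD_bT {l : ℕ} (v : Fin l → ι) : tensorD g l (B.bT l v) =
    ∑ k, sgn K (∑ j, if j < k then B.dg (v j) else 0) •
      ∑ a, B.b.coord a (g.d (B.b (v k))) • B.bT l (Function.update v k a) := by
  classical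
  refine (B.bT l).ext_elem fun w => ?_
  rw [repr_tensorD]
  simp only [map_sum, map_smul, Finsupp.coe_finsetSum, Finset.sum_apply, Finsupp.smul_apply,
    bT_repr_bT, smul_eq_mul]
  refine Finset.sum_congr rfl fun k _ => ?_
  -- An entry can be nonzero only if `w` and `v` agree off `k`; then each sum over `a` has one
  -- surviving term.
  by_cases h : ∀ j, j ≠ k → w j = v j
  · have hw : Function.update w k (v k) = v := by
      ext j
      by_cases hj : j = k
      · subst hj; simp
      · rw [Function.update_of_ne hj, h j hj]
    have hv : w = Function.update v k (w k) := by
      ext j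
      by_cases hj : j = k
      · subst hj; simp
      · rw [Function.update_of_ne hj, h j hj]
    rw [Finset.sum_eq_single (v k), Finset.sum_eq_single (w k), if_pos hw, if_pos hv]
    · congr 2
      refine Finset.sum_congr rfl fun j _ => ?_
      split_ifs with hj
      · rw [h j hj.ne]
      · rfl
    · intro a _ ha
      rw [if_neg, mul_zero]
      intro h
      exact ha (by rw [h, Function.update_self])
    · exact fun h => absurd (Finset.mem_univ _) h
    · intro a _ ha
      rw [if_neg, mul_zero]
      intro h
      exact ha (by rw [← h, Function.update_self])
    · exact fun h => absurd (Finset.mem_univ _) h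
  · push Not at h
    obtain ⟨j, hj, hne⟩ := h
    have hz1 : ∀ a, (if Function.update w k a = v then (1 : K) else 0) = 0 := fun a =>
      if_neg fun h => hne (by rw [← h, Function.update_of_ne hj])
    have hz2 : ∀ a, (if w = Function.update v k a then (1 : K) else 0) = 0 := fun a =>
      if_neg fun h => hne (by rw [h, Function.update_of_ne hj])
    simp only [hz1, hz2, mul_zero, Finset.sum_const_zero]

theorem mat_homDiff {l m : ℕ} (i : ℤ) (L : TPow g l →ₗ[K] TPow g m) (w : Fin m → ι)
    (v : Fin l → ι) : B.mat w v (homDiff g i L) =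
    ∑ k, sgn K (∑ j, if j < k then B.dg (w j) else 0) *
        ∑ a, B.b.coord (w k) (g.d (B.b a)) * B.mat (Function.update w k a) v L -
      sgn K i * ∑ k, sgn K (∑ j, if j < k then B.dg (v j) else 0) *
        ∑ a, B.b.coord a (g.d (B.b (v k))) * B.mat w (Function.update v k a) L := by
  rw [homDiff, map_sub, map_smul]
  congr 1
  · rw [mat_apply, LinearMap.comp_apply, repr_tensorD]
    rfl
  · rw [mat_apply, LinearMap.comp_apply, tensorD_bT]
    simp only [map_sum, map_smul, Finsupp.coe_finsetSum, Finset.sum_apply, Finsupp.smul_apply,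
      smul_eq_mul]
    rfl

omit [Fintype ι] in
theorem mulEquiv_bT {l m : ℕ} (v : Fin l → ι) (w : Fin m → ι) :
    TensorPower.mulEquiv (B.bT l v ⊗ₜ[K] B.bT m w) = B.bT (l + m) (Fin.append v w) := by
  rw [← TensorPower.gMul_def, bT_apply, bT_apply, TensorPower.tprod_mul_tprod, bT_apply]
  congr 1
  ext j
  refine Fin.addCases (fun i => ?_) (fun i => ?_) j <;> simp

omit [Fintype ι] in
theorem mulEquiv_symm_bT {l m : ℕ} (v : Fin l → ι) (w : Fin m → ι) :
    TensorPower.mulEquiv.symm (B.bT (l + m) (Fin.append v w)) = B.bT l v ⊗ₜ[K] B.bT m w := by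
  rw [LinearEquiv.symm_apply_eq, mulEquiv_bT]

/-- Composition is matrix multiplication in the single index `j`, which is the last input of `L` and
the first output of `L'`; the remaining outputs of `L'` pass through unchanged. -/
theorem mat_compMid {a l' m b : ℕ} (L : TPow g (a + 1) →ₗ[K] TPow g m)
    (L' : TPow g l' →ₗ[K] TPow g (b + 1)) (i : ℤ) (p : Fin m → ι) (q : Fin b → ι)
    (y : Fin a → ι) (z : Fin l' → ι) :
    B.mat (Fin.append p q) (Fin.append y z) (compMid g L L' i) =
      sgn K (i * ∑ j, B.dg (y j)) *
        ∑ j, B.mat p (Fin.snoc y j : Fin (a + 1) → ι) L *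
          B.mat (Fin.cons j q : Fin (b + 1) → ι) z L' := by
  classical
  have h1 : PiTensorProduct.map (fun _ => signOp g.isInternal i) (B.bT a y) =
      sgn K (i * ∑ j, B.dg (y j)) • B.bT a y := by
    rw [bT_apply, PiTensorProduct.map_tprod, Finset.mul_sum, sgn_sum,
      ← MultilinearMap.map_smul_univ]
    congr 1
    ext j
    exact signOp_of_mem _ _ (B.mem (y j))
  have h2 : L' (B.bT l' z) = ∑ j, ∑ q : Fin b → ι,
      B.mat (Fin.cons j q : Fin (b + 1) → ι) z L' • B.bT (b + 1) (Fin.cons j q : Fin (b + 1) → ι) := by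
    conv_lhs => rw [← (B.bT (b + 1)).sum_repr (L' (B.bT l' z))]
    rw [← (Fin.consEquiv fun _ : Fin (b + 1) => ι).sum_comp, Fintype.sum_prod_type]
    rfl
  have h3 : ∀ j (q : Fin b → ι), TensorPower.cast K g.carrier (show a + (b + 1) = a + 1 + b by omega)
      (B.bT _ (Fin.append y (Fin.cons j q : Fin (b + 1) → ι))) =
      B.bT _ (Fin.append (Fin.snoc y j : Fin (a + 1) → ι) q) := by
    intro j q
    rw [bT_apply, TensorPower.cast_tprod, bT_apply]
    congr 1
    ext k
    rw [Function.comp_apply]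
    congr 1
    obtain ⟨k, rfl⟩ | ⟨k, rfl⟩ : (∃ i : Fin (a + 1), k = Fin.castAdd b i) ∨
        ∃ i : Fin b, k = Fin.natAdd (a + 1) i := by
      refine Fin.addCases (fun i => Or.inl ⟨i, rfl⟩) (fun i => Or.inr ⟨i, rfl⟩) k
    · rw [Fin.append_left]
      obtain ⟨k, rfl⟩ | rfl : (∃ i : Fin a, k = i.castSucc) ∨ k = Fin.last a := by
        refine Fin.lastCases (Or.inr rfl) (fun i => Or.inl ⟨i, rfl⟩) k
      · rw [Fin.snoc_castSucc]
        exact Fin.append_left y _ k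
      · rw [Fin.snoc_last]
        exact Fin.append_right y (Fin.cons j q : Fin (b + 1) → ι) 0
    · rw [Fin.append_right]
      have : Fin.cast (by omega : a + 1 + b = a + (b + 1)) (Fin.natAdd (a + 1) k) =
          Fin.natAdd a k.succ := by
        ext
        simp
        omega
      exact (congrArg (Fin.append y (Fin.cons j q : Fin (b + 1) → ι)) this).trans
        (Fin.append_right y (Fin.cons j q : Fin (b + 1) → ι) k.succ)
  have h4 : compMid g L L' i (B.bT _ (Fin.append y z)) = sgn K (i * ∑ j, B.dg (y j)) •
      ∑ j, ∑ q : Fin b → ι, B.mat (Fin.cons j q : Fin (b + 1) → ι) z L' •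
        TensorPower.mulEquiv (L (B.bT _ (Fin.snoc y j : Fin (a + 1) → ι)) ⊗ₜ[K] B.bT b q) := by
    simp only [compMid, LinearMap.comp_apply, LinearEquiv.coe_coe, mulEquiv_symm_bT,
      TensorProduct.map_tmul, h1, h2, ← TensorProduct.smul_tmul', TensorProduct.tmul_sum,
      TensorProduct.tmul_smul, map_smul, map_sum, mulEquiv_bT, h3, LinearMap.id_apply,
      Finset.smul_sum]
    exact Finset.sum_congr rfl fun _ _ => Finset.sum_congr rfl fun _ _ => smul_comm _ _ _
  have h5 : ∀ (s : TPow g m) (q' : Fin b → ι),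
      (B.bT (m + b)).repr (TensorPower.mulEquiv (s ⊗ₜ[K] B.bT b q')) (Fin.append p q) =
        (B.bT m).repr s p * if q = q' then 1 else 0 := by
    intro s q'
    conv_lhs => rw [← (B.bT m).sum_repr s]
    simp only [TensorProduct.sum_tmul, ← TensorProduct.smul_tmul', map_sum, map_smul, mulEquiv_bT,
      Finsupp.coe_finsetSum, Finset.sum_apply, Finsupp.smul_apply, bT_repr_bT, smul_eq_mul]
    rw [Finset.sum_eq_single p]
    · congr 2
      rw [eq_iff_iff]
      refine ⟨fun h => ?_, fun h => by rw [h]⟩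
      ext k
      have := congrFun h (Fin.natAdd m k)
      simpa using this
    · intro p' _ hp'
      rw [if_neg, mul_zero]
      intro h
      refine hp' ?_
      ext k
      have := congrFun h (Fin.castAdd b k)
      simpa using this.symm
    · exact fun h => absurd (Finset.mem_univ _) h
  rw [mat_apply, h4]
  simp only [map_sum, map_smul, Finsupp.coe_finsetSum, Finset.sum_apply, Finsupp.smul_apply,
    smul_eq_mul, h5]
  congr 1
  refine Finset.sum_congr rfl fun j _ => ?_
  rw [Finset.sum_eq_single q]
  · rw [if_pos rfl, mul_one, mul_comm]
    rfl
  · intro q' _ hq'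
    rw [if_neg (Ne.symm hq'), mul_zero, mul_zero]
  · exact fun h => absurd (Finset.mem_univ _) h

omit [Fintype ι] in
theorem mat_castHom {l l' m m' : ℕ} (hl : l = l') (hm : m = m') (L : TPow g l →ₗ[K] TPow g m)
    (w : Fin m' → ι) (v : Fin l' → ι) : B.mat w v (castHom g hl hm L) =
      B.mat (fun k => w (Fin.cast hm k)) (fun j => v (Fin.cast hl j)) L := by
  subst hl hm
  simp [castHom]

/-- The map with a given matrix. -/
def ofMat {l m : ℕ} : ((Fin m → ι) → (Fin l → ι) → K) →ₗ[K] TPow g l →ₗ[K] TPow g m where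
  toFun F := (B.bT l).constr K fun v => ∑ w, F w v • B.bT m w
  map_add' F G := by
    rw [← map_add]
    congr 1
    ext v
    simp [add_smul, Finset.sum_add_distrib]
  map_smul' c F := by
    rw [RingHom.id_apply, ← map_smul]
    congr 1
    ext v
    simp [mul_smul, Finset.smul_sum]

theorem mat_ofMat {l m : ℕ} (F : (Fin m → ι) → (Fin l → ι) → K) (w : Fin m → ι) (v : Fin l → ι) :
    B.mat w v (B.ofMat F) = F w v := by
  classical
  rw [mat_apply]
  change (B.bT m).repr ((B.bT l).constr K (fun v => ∑ w, F w v • B.bT m w) (B.bT l v)) w = _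
  rw [Module.Basis.constr_basis]
  simp only [map_sum, map_smul, Finsupp.coe_finsetSum, Finset.sum_apply, Finsupp.smul_apply,
    bT_repr_bT, smul_eq_mul, mul_ite, mul_one, mul_zero, Finset.sum_ite_eq, Finset.mem_univ, if_true]

omit [Fintype ι] in
-- The reversal contributes `pairSum` by `koszul_rev`, and the double sum factors into permutation
-- sums parallel to those of `coef_monomial`, with the sign conventions of maps.
theorem mat_mapOfMonomial [Module.Finite K g.carrier] (n : ℤ) {m l : ℕ} (e : Fin m → ℤ)
    (x : Fin m → g.carrier) (f : Fin l → ℤ) (θ : Fin l → Module.Dual K g.carrier) (w : Fin m → ι)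
    (v : Fin l → ι) : B.mat w v (mapOfMonomial g n e x f θ) =
    sgn K (pairSum fun j => B.dg (v j)) *
      ((∑ ρ : Equiv.Perm (Fin m), signPow K n ρ * koszul K ρ e * ∏ k, B.b.coord (w k) (x (ρ k))) *
      ∑ σ : Equiv.Perm (Fin l), sign K σ * koszul K σ f * ∏ j, θ (σ j) (B.b (v j))) := by
  simp only [mapOfMonomial, map_sum, map_smul, mat_apply, LinearMap.smulRight_apply,
    LinearMap.comp_apply]
  simp only [bT_apply, koszulOp_tprod _ fun j => B.mem (v j), koszul_rev, map_smul,
    PiTensorProduct.lift.tprod, MultilinearMap.compLinearMap_apply,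
    MultilinearMap.mkPiAlgebra_apply, smul_eq_mul, Finsupp.smul_apply, bT_repr_tprod]
  rw [Finset.sum_mul_sum, Finset.sum_comm, Finset.mul_sum]
  refine Finset.sum_congr rfl fun ρ _ => ?_
  rw [Finset.mul_sum]
  exact Finset.sum_congr rfl fun σ _ => by ring

theorem mem_tensorGr_iff {l : ℕ} {k : ℤ} {t : TPow g l} : t ∈ tensorGr g l k ↔
    ∀ w : Fin l → ι, ∑ j, B.dg (w j) ≠ k → (B.bT l).repr t w = 0 := by
  constructor
  · intro ht w hw
    induction ht using Submodule.span_induction with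
    | mem t h =>
      obtain ⟨e, y, hy, he, rfl⟩ := h
      rw [bT_repr_tprod]
      obtain ⟨j, hj⟩ : ∃ j, B.dg (w j) ≠ e j := by
        by_contra h
        push Not at h
        exact hw (by rw [← he, Finset.sum_congr rfl fun j _ => h j])
      exact Finset.prod_eq_zero (Finset.mem_univ j) (B.coord_eq_zero (hy j) hj)
    | zero => simp
    | add x y _ _ hx hy => rw [map_add, Finsupp.add_apply, hx, hy, add_zero]
    | smul c x _ hx => rw [map_smul, Finsupp.smul_apply, hx, smul_zero]
  · intro h
    rw [← (B.bT l).sum_repr t]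
    refine Submodule.sum_mem _ fun w _ => ?_
    by_cases hw : ∑ j, B.dg (w j) = k
    · exact Submodule.smul_mem _ _ (Submodule.subset_span
        ⟨_, _, fun j => B.mem (w j), hw, B.bT_apply w⟩)
    · rw [h w hw, zero_smul]
      exact zero_mem _

/-- Turns membership into conditions on entries that can be compared with the degree and the
symmetries of Taylor coefficients. The output condition is tested on inverse permutations, because
coordinates transform by the transpose. -/
theorem mem_homAS_iff {n : ℤ} {l m : ℕ} {i : ℤ} {L : TPow g l →ₗ[K] TPow g m} :
    L ∈ homAS g n l m i ↔
      (∀ (w : Fin m → ι) (v : Fin l → ι), ∑ k, B.dg (w k) ≠ ∑ j, B.dg (v j) + i →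
        B.mat w v L = 0) ∧
      (∀ (σ : Equiv.Perm (Fin l)) (w : Fin m → ι) (v : Fin l → ι), B.mat w v L =
        sign K σ * koszul K σ (fun j => B.dg (v j)) * B.mat w (v ∘ σ) L) ∧
      ∀ (ρ : Equiv.Perm (Fin m)) (w : Fin m → ι) (v : Fin l → ι), B.mat w v L =
        signPow K n ρ * koszul K ρ (fun k => B.dg (w k)) * B.mat (w ∘ ρ) v L := by
  have hdeg : (∀ k, ∀ t ∈ tensorGr g l k, L t ∈ tensorGr g m (k + i)) ↔
      ∀ (w : Fin m → ι) (v : Fin l → ι), ∑ k, B.dg (w k) ≠ ∑ j, B.dg (v j) + i →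
        B.mat w v L = 0 := by
    constructor
    · intro h w v hwv
      have hv : B.bT l v ∈ tensorGr g l (∑ j, B.dg (v j)) :=
        Submodule.subset_span ⟨_, _, fun j => B.mem (v j), rfl, B.bT_apply v⟩
      exact (B.mem_tensorGr_iff).1 (h _ _ hv) w hwv
    · intro h k t ht
      rw [← (B.bT l).sum_repr t, map_sum]
      refine Submodule.sum_mem _ fun v _ => ?_
      rw [map_smul]
      by_cases hv : ∑ j, B.dg (v j) = k
      · refine Submodule.smul_mem _ _ ((B.mem_tensorGr_iff).2 fun w hw => ?_)
        exact h w v (by rwa [hv])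
      · rw [(B.mem_tensorGr_iff).1 ht v hv, zero_smul]
        exact zero_mem _
  have hl : ∀ σ : Equiv.Perm (Fin l), sign K σ • (L ∘ₗ braid g σ) = L ↔
      ∀ (w : Fin m → ι) (v : Fin l → ι), B.mat w v L =
        sign K σ * koszul K σ (fun j => B.dg (v j)) * B.mat w (v ∘ σ) L := by
    intro σ
    constructor
    · intro h w v
      conv_lhs => rw [← h]
      rw [map_smul, mat_comp_braid, smul_eq_mul, mul_assoc]
    · intro h
      refine B.mat_ext fun w v => ?_
      rw [map_smul, mat_comp_braid, smul_eq_mul, ← mul_assoc, ← h]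
  have hm : ∀ ρ : Equiv.Perm (Fin m), signPow K n ρ⁻¹ • (braid g ρ⁻¹ ∘ₗ L) = L ↔
      ∀ (w : Fin m → ι) (v : Fin l → ι), B.mat w v L =
        signPow K n ρ * koszul K ρ (fun k => B.dg (w k)) * B.mat (w ∘ ρ) v L := by
    intro ρ
    have hs : signPow K n ρ⁻¹ = signPow K n ρ := by simp [signPow]
    rw [hs]
    constructor
    · intro h w v
      conv_lhs => rw [← h]
      rw [map_smul, mat_braid_inv_comp, smul_eq_mul, mul_assoc]
    · intro h
      refine B.mat_ext fun w v => ?_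
      rw [map_smul, mat_braid_inv_comp, smul_eq_mul, ← mul_assoc, ← h]
  change (_ ∧ _ ∧ _) ↔ _
  rw [hdeg]
  refine and_congr Iff.rfl (and_congr (forall_congr' hl) ?_)
  refine ⟨fun h ρ => (hm ρ).1 (h ρ⁻¹), fun h ρ => ?_⟩
  have := (hm ρ⁻¹).2 (h ρ⁻¹)
  rwa [inv_inv] at this

end HomBasis
end TensorCoef

/-! ### The isomorphism between polyvectors and families of maps. -/

section Comparison
variable {K : Type*} [Field K]

/-- The exponent of the sign relating polyvectors and maps, in terms of the degrees of the outputs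
and of the inputs. -/
def phiExp (n : ℤ) {m l : ℕ} (d : Fin m → ℤ) (e : Fin l → ℤ) : ℤ :=
  n * ((m - 1) * ∑ k, d k - posSum d) + l * ∑ k, d k + ((l - 1) * ∑ j, e j - posSum e) + pairSum e

/-- Modulo 2, `phiExp` depends on the order of the outputs only through `n * posSum d`, which is
exactly the correction in `koszul_add_const`. For the inputs the same role is played by `posSum e`,
since `pairSum` is invariant (`sgn_phiExp_perm_right`). -/
theorem sgn_phiExp_perm_left (n : ℤ) {m l : ℕ} (d : Fin m → ℤ) (e : Fin l → ℤ)
    (ρ : Equiv.Perm (Fin m)) : sgn K (phiExp n d e) * (signPow K n ρ * koszul K ρ d) =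
      koszul K ρ (fun k => d k + n) * sgn K (phiExp n (d ∘ ρ) e) := by
  have h : ∑ k, (d ∘ ρ) k = ∑ k, d k := Equiv.sum_comp ρ d
  rw [koszul_add_const, phiExp, phiExp, h, mul_assoc, ← sgn_add, mul_comm, mul_comm (signPow K n ρ)]
  congr 1
  exact sgn_eq ⟨-n * posSum d, by ring⟩

theorem koszul_one_sub {l : ℕ} (e : Fin l → ℤ) (σ : Equiv.Perm (Fin l)) :
    koszul K σ (fun j => 1 - e j) =
      sign K σ * koszul K σ e * sgn K (posSum e + posSum (e ∘ σ)) := by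
  rw [koszul_congr (f := fun j => e j + 1) σ fun j => ⟨-e j, by ring⟩, koszul_add_const, one_mul,
    ← koszul_const, koszul_const_one, mul_comm (koszul K σ e)]

theorem sgn_phiExp_perm_right (n : ℤ) {m l : ℕ} (d : Fin m → ℤ) (e : Fin l → ℤ)
    (σ : Equiv.Perm (Fin l)) : sgn K (phiExp n d e) * (sign K σ * koszul K σ e) =
      koszul K σ (fun j => 1 - e j) * sgn K (phiExp n d (e ∘ σ)) := by
  have h : ∑ k, (e ∘ σ) k = ∑ k, e k := Equiv.sum_comp σ e
  rw [koszul_one_sub, phiExp, phiExp, h, pairSum_comp, mul_assoc (sign K σ * koszul K σ e),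
    ← sgn_add, mul_comm]
  congr 1
  exact sgn_eq ⟨-posSum e, by ring⟩

theorem sign_mul_koszul_mul_self {l : ℕ} (σ : Equiv.Perm (Fin l)) (e : Fin l → ℤ) :
    sign K σ * koszul K σ e * (sign K σ * koszul K σ e) = 1 := by
  rw [← koszul_const_one, mul_mul_mul_comm, koszul_mul_self, koszul_mul_self, one_mul]

theorem signPow_mul_koszul_mul_self (n : ℤ) {m : ℕ} (ρ : Equiv.Perm (Fin m)) (d : Fin m → ℤ) :
    signPow K n ρ * koszul K ρ d * (signPow K n ρ * koszul K ρ d) = 1 := by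
  rw [← koszul_const, mul_mul_mul_comm, koszul_mul_self, koszul_mul_self, one_mul]

theorem mul_eq_of_mul_self {s k x y : K} (c : K) (hs : s * s = 1) (hk : k * k = 1)
    (h : x * s = k * y) : x * (k * c) = s * (y * c) := by
  linear_combination (s * k * c) * h - x * k * c * hs + s * y * c * hk

variable {g : Cochain K} [Module.Finite K g.carrier] {ι : Type*} [Fintype ι]
  {B : HomBasis g ι} {n : ℤ} {R : Type*} [Ring R] [Algebra K R]

namespace PolModel
variable (M : PolModel B n R)

/-- The map with `l` inputs and `m` outputs attached to a polyvector. -/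
def toHom (m l : ℕ) : R →ₗ[K] TPow g l →ₗ[K] TPow g m :=
  B.ofMat ∘ₗ LinearMap.pi fun w => LinearMap.pi fun v =>
    sgn K (phiExp n (fun k => B.dg (w k)) fun j => B.dg (v j)) • M.coef w v

theorem mat_toHom {m l : ℕ} (P : R) (w : Fin m → ι) (v : Fin l → ι) :
    B.mat w v (M.toHom m l P) =
      sgn K (phiExp n (fun k => B.dg (w k)) fun j => B.dg (v j)) * M.coef w v P :=
  B.mat_ofMat _ w v

/-- The polyvector attached to a map with `l` inputs and `m` outputs. -/
def ofHom (m l : ℕ) : (TPow g l →ₗ[K] TPow g m) →ₗ[K] R :=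
  M.recon m l ∘ₗ LinearMap.pi fun w => LinearMap.pi fun v =>
    sgn K (phiExp n (fun k => B.dg (w k)) fun j => B.dg (v j)) • B.mat w v

theorem ofHom_apply {m l : ℕ} (L : TPow g l →ₗ[K] TPow g m) : M.ofHom m l L =
    M.recon m l fun w v =>
      sgn K (phiExp n (fun k => B.dg (w k)) fun j => B.dg (v j)) * B.mat w v L := rfl

theorem degree_iff {m l : ℕ} (i : ℤ) (w : Fin m → ι) (v : Fin l → ι) :
    ∑ k, (B.dg (w k) + n) + ∑ j, (1 - B.dg (v j)) = i ↔
      ∑ k, B.dg (w k) = ∑ j, B.dg (v j) + (i - m * n - l) := by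
  simp only [Finset.sum_add_distrib, Finset.sum_sub_distrib, Finset.sum_const, Finset.card_univ,
    Fintype.card_fin, nsmul_eq_mul, mul_one]
  constructor <;> intro h <;> linarith

/-- The symmetry of mixed partial derivatives becomes the symmetry required of maps through the two
permutation rules for `phiExp`. -/
theorem toHom_mem_of_deg {m l : ℕ} {i : ℤ} {P : R} (hP : P ∈ M.deg i) :
    M.toHom m l P ∈ homAS g n l m (i - m * n - l) := by
  refine B.mem_homAS_iff.2 ⟨fun w v h => ?_, fun σ w v => ?_, fun ρ w v => ?_⟩
  · rw [mat_toHom, M.coef_eq_zero_of_deg w v hP fun h2 => h ((degree_iff i w v).1 h2), mul_zero]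
  · rw [mat_toHom, mat_toHom, M.coef_perm_right w v σ]
    exact mul_eq_of_mul_self _ (sign_mul_koszul_mul_self _ _) (koszul_mul_self _ _)
      (sgn_phiExp_perm_right n _ _ σ)
  · rw [mat_toHom, mat_toHom, M.coef_perm_left w v ρ]
    exact mul_eq_of_mul_self _ (signPow_mul_koszul_mul_self _ _ _) (koszul_mul_self _ _)
      (sgn_phiExp_perm_left n _ _ ρ)

theorem ofHom_mem {m l : ℕ} {i : ℤ} {L : TPow g l →ₗ[K] TPow g m}
    (hL : L ∈ homAS g n l m (i - m * n - l)) : M.ofHom m l L ∈ M.gr m i := by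
  refine M.recon_mem fun w v h => ?_
  change sgn K _ * B.mat w v L = 0
  rw [(B.mem_homAS_iff.1 hL).1 w v fun h2 => h ((degree_iff i w v).2 h2), mul_zero]

theorem toHom_ofHom [CharZero K] {m l : ℕ} {i : ℤ} {L : TPow g l →ₗ[K] TPow g m}
    (hL : L ∈ homAS g n l m i) : M.toHom m l (M.ofHom m l L) = L := by
  obtain ⟨-, hY, hX⟩ := B.mem_homAS_iff.1 hL
  refine B.mat_ext fun w v => ?_
  rw [mat_toHom, ofHom_apply, M.coef_recon, ← mul_assoc, sgn_mul_self, one_mul]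
  · intro ρ w v
    rw [hX ρ w v]
    have h := sgn_phiExp_perm_left (K := K) n (fun k => B.dg (w k)) (fun j => B.dg (v j)) ρ
    change _ = _ * sgn K (phiExp n (fun k => B.dg ((w ∘ ρ) k)) _) at h
    linear_combination B.mat (w ∘ ρ) v L * h
  · intro σ w v
    rw [hY σ w v]
    have h := sgn_phiExp_perm_right (K := K) n (fun k => B.dg (w k)) (fun j => B.dg (v j)) σ
    change _ = _ * sgn K (phiExp n _ fun j => B.dg ((v ∘ σ) j)) at h
    linear_combination B.mat w (v ∘ σ) L * h

theorem toHom_ofHom_of_ne {m l l' : ℕ} (h : l' ≠ l) (L : TPow g l →ₗ[K] TPow g m) :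
    M.toHom m l' (M.ofHom m l L) = 0 := by
  refine B.mat_ext fun w v => ?_
  rw [mat_toHom, ofHom_apply, M.coef_recon_of_ne h, mul_zero, map_zero]

theorem ofHom_toHom (m l : ℕ) (P : R) :
    M.ofHom m l (M.toHom m l P) = M.recon m l fun w v => M.coef w v P := by
  rw [ofHom_apply]
  congr 1
  ext w v
  rw [mat_toHom, ← mul_assoc, sgn_mul_self, one_mul]

theorem exists_sum_ofHom_toHom [CharZero K] {m : ℕ} {i : ℤ} {P : R} (hP : P ∈ M.gr m i) :
    ∃ N, ∑ l ∈ Finset.range N, M.ofHom m l (M.toHom m l P) = P := by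
  obtain ⟨N, hN⟩ := M.exists_sum_recon_coef hP
  refine ⟨N, ?_⟩
  simp only [ofHom_toHom]
  exact hN N le_rfl

theorem exists_toHom_eq_zero [CharZero K] {m : ℕ} {i : ℤ} {P : R} (hP : P ∈ M.gr m i) :
    ∃ N, ∀ l, N < l → M.toHom m l P = 0 := by
  obtain ⟨N, hN⟩ := M.exists_sum_ofHom_toHom hP
  refine ⟨N, fun l hl => ?_⟩
  rw [← hN, map_sum]
  refine Finset.sum_eq_zero fun l' hl' => M.toHom_ofHom_of_ne ?_ _
  have := Finset.mem_range.1 hl'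
  omega

/-- A polyvector of fixed weight is the finite sum of the pieces rebuilt from its maps. This is what
allows the Maurer-Cartan equation to be tested on maps. -/
theorem eq_zero_of_toHom [CharZero K] {m : ℕ} {i : ℤ} {P : R} (hP : P ∈ M.gr m i)
    (h : ∀ l, M.toHom m l P = 0) : P = 0 := by
  obtain ⟨N, hN⟩ := M.exists_sum_ofHom_toHom hP
  rw [← hN]
  exact Finset.sum_eq_zero fun l _ => by rw [h, map_zero]

theorem toHom_mem {m : ℕ} (l : ℕ) {P : R} (hP : P ∈ M.gr m (n + 2)) :
    M.toHom m l P ∈ homAS g n l m ((1 - m) * n + 2 - l) := by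
  have := M.toHom_mem_of_deg (m := m) (l := l) (M.gr_le_deg _ _ hP)
  rwa [show n + 2 - m * n - l = (1 - m) * n + 2 - l by ring] at this

theorem ofHom_mem' {m l : ℕ} {L : TPow g l →ₗ[K] TPow g m}
    (hL : L ∈ homAS g n l m ((1 - m) * n + 2 - l)) : M.ofHom m l L ∈ M.gr m (n + 2) := by
  refine M.ofHom_mem ?_
  rwa [show n + 2 - m * n - l = (1 - m) * n + 2 - l by ring]

/-- The polyvector attached to a finite family of maps. -/
def ofFamily (m : ℕ) :
    (⨁ l : ℕ, homAS g n l m ((1 - m) * n + 2 - l)) →ₗ[K] M.gr m (n + 2) :=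
  DirectSum.toModule K ℕ _ fun l =>
    (M.ofHom m l).restrict fun _ hL => M.ofHom_mem' hL

theorem toHom_ofFamily [CharZero K] (m l : ℕ)
    (z : ⨁ l : ℕ, homAS g n l m ((1 - m) * n + 2 - l)) :
    M.toHom m l (M.ofFamily m z : R) = z l := by
  classical
  induction z using DirectSum.induction_on with
  | zero => simp
  | of l' L =>
    have h : (M.ofFamily m (DirectSum.of _ l' L) : R) = M.ofHom m l' L :=
      congrArg Subtype.val (DirectSum.toModule_lof K (M := fun l : ℕ =>
        homAS g n l m ((1 - m) * n + 2 - l)) l' L)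
    rw [h]
    by_cases hl : l = l'
    · subst hl
      rw [M.toHom_ofHom L.2, DirectSum.of_eq_same]
    · rw [M.toHom_ofHom_of_ne hl, DirectSum.of_eq_of_ne _ _ _ hl]
      rfl
  | add x y hx hy =>
    rw [map_add, Submodule.coe_add, map_add, hx, hy]
    rfl

theorem ofFamily_bijective [CharZero K] (m : ℕ) : Function.Bijective (M.ofFamily m) := by
  classical
  constructor
  · intro y z h
    refine DFinsupp.ext fun l => Subtype.ext ?_
    rw [← M.toHom_ofFamily, ← M.toHom_ofFamily, h]
  · rintro ⟨P, hP⟩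
    obtain ⟨N, hN⟩ := M.exists_sum_ofHom_toHom hP
    refine ⟨∑ l ∈ Finset.range N, DirectSum.lof K ℕ
      (fun l : ℕ => homAS g n l m ((1 - m) * n + 2 - l)) l ⟨_, M.toHom_mem l hP⟩, ?_⟩
    rw [map_sum]
    refine Subtype.ext ?_
    rw [Submodule.coe_sum]
    refine Eq.trans (Finset.sum_congr rfl fun l _ => ?_) hN
    exact congrArg Subtype.val (DirectSum.toModule_lof K (M := fun l : ℕ =>
      homAS g n l m ((1 - m) * n + 2 - l)) l _)

/-- The polyvectors of weight `m` as finite families of maps. -/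
def familyEquiv [CharZero K] (m : ℕ) :
    M.gr m (n + 2) ≃ₗ[K] ⨁ l : ℕ, homAS g n l m ((1 - m) * n + 2 - l) :=
  (LinearEquiv.ofBijective (M.ofFamily m) (M.ofFamily_bijective m)).symm

theorem familyEquiv_apply [CharZero K] {m : ℕ} (l : ℕ) (P : M.gr m (n + 2)) :
    (M.familyEquiv m P l : TPow g l →ₗ[K] TPow g m) = M.toHom m l (P : R) := by
  rw [← M.toHom_ofFamily]
  congr 2
  exact (LinearEquiv.ofBijective (M.ofFamily m) (M.ofFamily_bijective m)).apply_symm_apply P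

theorem prod_coord_eq_zero {m : ℕ} {e : Fin m → ℤ} (x : ∀ k, g.gr (e k)) (w : Fin m → ι)
    (ρ : Equiv.Perm (Fin m)) (h : ¬ ∀ k, B.dg (w k) = e (ρ k)) :
    ∏ k, B.b.coord (w k) (x (ρ k)) = 0 := by
  push Not at h
  obtain ⟨k, hk⟩ := h
  exact Finset.prod_eq_zero (Finset.mem_univ k) (B.coord_eq_zero (x (ρ k)).2 hk)

theorem prod_apply_eq_zero {l : ℕ} {f : Fin l → ℤ} (θ : ∀ j, g.dualGr (f j)) (v : Fin l → ι)
    (σ : Equiv.Perm (Fin l)) (h : ¬ ∀ j, f (σ j) = -B.dg (v j)) :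
    ∏ j, (θ (σ j) : Module.Dual K g.carrier) (B.b (v j)) = 0 := by
  push Not at h
  obtain ⟨j, hj⟩ := h
  exact Finset.prod_eq_zero (Finset.mem_univ j) (B.apply_eq_zero (θ (σ j)).2 hj)

/-- Both sides are sums over pairs of permutations, compared term by term. The prescribed sign is
the part of `phiExp` for the unpermuted words without `pairSum`, which is the reversal sign on the
right; the permutations cost position sums, and `koszul_add_const` supplies the same ones. -/
theorem toHom_monomial {m l : ℕ} {e : Fin m → ℤ} (x : ∀ k, g.gr (e k)) {f : Fin l → ℤ}
    (θ : ∀ j, g.dualGr (f j)) :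
    M.toHom m l ((List.ofFn fun k => M.sx (x k)).prod *
      (List.ofFn fun j => M.st (θ j : Module.Dual K g.carrier)).prod) =
    (sgn K (∑ k : Fin m, e k * ((m - ((k : ℕ) + 1)) * n + l)) *
      sgn K (∑ j : Fin l, f j * (l - ((j : ℕ) + 1)))) •
      mapOfMonomial g n e (fun k => (x k : g.carrier)) f
        (fun j => (θ j : Module.Dual K g.carrier)) := by
  refine B.mat_ext fun w v => ?_
  rw [mat_toHom, coef_monomial, map_smul, B.mat_mapOfMonomial, smul_eq_mul, Finset.sum_mul_sum,
    Finset.sum_mul_sum, Finset.mul_sum, Finset.mul_sum, Finset.mul_sum]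
  refine Finset.sum_congr rfl fun ρ _ => ?_
  rw [Finset.mul_sum, Finset.mul_sum, Finset.mul_sum]
  refine Finset.sum_congr rfl fun σ _ => ?_
  -- Unless the degrees match, a factor of the product vanishes. When they do, the degrees of `w`
  -- and `v` are rearrangements of `e` and of `-f`.
  by_cases h1 : ∀ k, B.dg (w k) = e (ρ k)
  swap
  · rw [prod_coord_eq_zero x w ρ h1]
    ring
  by_cases h2 : ∀ j, f (σ j) = -B.dg (v j)
  swap
  · rw [prod_apply_eq_zero θ v σ h2]
    ring
  have e1 : ∑ k : Fin m, e k * ((m - ((k : ℕ) + 1)) * n + l) =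
      n * ((m - 1) * ∑ k, e k - posSum e) + l * ∑ k, e k := by
    rw [posSum, mul_sub, Finset.mul_sum, Finset.mul_sum, Finset.mul_sum, Finset.mul_sum,
      ← Finset.sum_sub_distrib, ← Finset.sum_add_distrib]
    exact Finset.sum_congr rfl fun k _ => by ring
  have e2 : ∑ j : Fin l, f j * (l - ((j : ℕ) + 1)) = (l - 1) * ∑ j, f j - posSum f := by
    rw [posSum, Finset.mul_sum, ← Finset.sum_sub_distrib]
    exact Finset.sum_congr rfl fun k _ => by ring
  have h3 : (fun k => B.dg (w k)) = e ∘ ρ := funext h1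
  have h4 : (fun j => B.dg (v j)) = fun j => -(f ∘ σ) j := by
    ext j
    rw [Function.comp_apply, h2, neg_neg]
  have h5 : ∑ k, (e ∘ ρ) k = ∑ k, e k := Equiv.sum_comp ρ e
  have h6 : ∑ k, -(f ∘ σ) k = -∑ k, f k := by
    rw [Finset.sum_neg_distrib]
    congr 1
    exact Equiv.sum_comp σ f
  have h7 : posSum (fun j => -(f ∘ σ) j) = - posSum (f ∘ σ) := by
    simp [posSum]
  have h8 : koszul K σ (fun j => f j + 1) = koszul K σ f * sign K σ *
      sgn K (1 * (posSum f + posSum (f ∘ σ))) := by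
    rw [koszul_add_const, ← koszul_const, koszul_const_one]
  rw [h3, h4, e1, e2, h8, koszul_add_const, phiExp, h5, h6, h7]
  have h9 : sgn K (n * ((m - 1) * ∑ k, e k - posSum (e ∘ ρ)) + l * ∑ k, e k +
      ((l - 1) * -∑ j, f j - -posSum (f ∘ σ)) + pairSum fun j => -(f ∘ σ) j) *
        sgn K (n * (posSum e + posSum (e ∘ ρ))) * sgn K (1 * (posSum f + posSum (f ∘ σ))) =
      sgn K (n * ((m - 1) * ∑ k, e k - posSum e) + l * ∑ k, e k) *
        sgn K ((l - 1) * ∑ j, f j - posSum f) * sgn K (pairSum fun j => -(f ∘ σ) j) := by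
    rw [← sgn_add, ← sgn_add, ← sgn_add, ← sgn_add]
    exact sgn_eq ⟨n * posSum e - (l - 1) * ∑ j, f j + posSum f + posSum (f ∘ σ), by ring⟩
  linear_combination (koszul K ρ e * signPow K n ρ * (∏ k, B.b.coord (w k) (x (ρ k))) *
    (koszul K σ f * sign K σ) * ∏ j, (θ (σ j) : Module.Dual K g.carrier) (B.b (v j))) * h9

theorem toHom_monomial_of_ne {m l l' : ℕ} (h : l' ≠ l) {e : Fin m → ℤ} (x : ∀ k, g.gr (e k))
    {f : Fin l → ℤ} (θ : ∀ j, g.dualGr (f j)) :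
    M.toHom m l' ((List.ofFn fun k => M.sx (x k)).prod *
      (List.ofFn fun j => M.st (θ j : Module.Dual K g.carrier)).prod) = 0 := by
  refine B.mat_ext fun w v => ?_
  rw [mat_toHom, coef_monomial_of_ne _ _ _ _ _ h, mul_zero, map_zero]

end PolModel
end Comparison

/-! ### The differential of polyvectors as the differential of maps. -/

section ComparisonDiff
variable {K : Type*} [Field K]

section Update
variable {l : ℕ} (e : Fin l → ℤ) (k : Fin l) (c : ℤ)

theorem sum_add_ite : ∑ j, (e j + if j = k then c else 0) = ∑ j, e j + c := by
  simp [Finset.sum_add_distrib]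

theorem posSum_add_ite : posSum (fun j => e j + if j = k then c else 0) = posSum e + c * (k : ℕ) := by
  simp [posSum, add_mul, Finset.sum_add_distrib]

theorem pairSum_add_ite :
    pairSum (fun j => e j + if j = k then c else 0) = pairSum e + c * (∑ j, e j - e k) := by
  have h1 := two_pairSum e
  have h2 := two_pairSum fun j => e j + if j = k then c else 0
  rw [sum_add_ite] at h2
  have h3 : ∑ j, (e j + if j = k then c else 0) ^ 2 = ∑ j, e j ^ 2 + (2 * c * e k + c ^ 2) := by
    have : ∀ j, (e j + if j = k then c else 0) ^ 2 =
        e j ^ 2 + if j = k then 2 * c * e k + c ^ 2 else 0 := by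
      intro j
      split_ifs with h
      · subst h; ring
      · ring
    simp only [this, Finset.sum_add_distrib, Finset.sum_ite_eq', Finset.mem_univ, if_true]
  rw [h3] at h2
  linarith

theorem sum_ite_add_const (n : ℤ) : (∑ j, if j < k then e j + n else 0) =
    (∑ j, if j < k then e j else 0) + n * (k : ℕ) := by
  have : ∀ j, (if j < k then e j + n else 0) =
      (if j < k then e j else 0) + if j < k then n else 0 := by
    intro j
    split_ifs <;> simp
  simp only [this, Finset.sum_add_distrib]
  congr 1
  rw [← Finset.sum_filter, Finset.sum_const, nsmul_eq_mul, mul_comm]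
  congr 2
  rw [show (Finset.univ.filter fun j => j < k) = Finset.Iio k by ext; simp, Fin.card_Iio]

theorem comp_update_eq {ι : Type*} (dg : ι → ℤ) (w : Fin l → ι) (a : ι)
    (h : dg a = dg (w k) + c) : (fun j => dg (Function.update w k a j)) =
      fun j => dg (w j) + if j = k then c else 0 := by
  ext j
  by_cases hj : j = k
  · subst hj; simp [h]
  · simp [hj]

end Update

variable {g : Cochain K} [Module.Finite K g.carrier] {ι : Type*} [Fintype ι]
  {B : HomBasis g ι} {n : ℤ} {R : Type*} [Ring R] [Algebra K R]

namespace PolModel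
variable (M : PolModel B n R)

/-- `coef_diff` and `mat_homDiff` are sums over the same replaced letters. A replacement changes one
degree by 1, which shifts `phiExp` by an explicit amount, and the parities agree. -/
theorem toHom_diff (m l : ℕ) {P : R} (hP : P ∈ M.deg (n + 2)) :
    sgn K (n + 1) • M.toHom m l (M.diff P) =
      sgn K ((m - 1) * n + l - 1) • homDiff g ((1 - m) * n + 2 - l) (M.toHom m l P) := by
  classical
  refine B.mat_ext fun w v => ?_
  rw [map_smul, map_smul, mat_toHom, coef_diff, B.mat_homDiff, smul_eq_mul, smul_eq_mul, mul_add,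
    mul_add, mul_sub, sub_eq_add_neg]
  congr 1
  · simp only [Finset.mul_sum]
    refine Finset.sum_congr rfl fun k _ => Finset.sum_congr rfl fun a _ => ?_
    change _ = _ * (_ * (dmat B (w k) a * _))
    by_cases h : B.dg (w k) = B.dg a + 1
    swap
    · rw [dmat_eq_zero B h]
      ring
    rw [mat_toHom, comp_update_eq k (-1) B.dg w a (by omega), sum_ite_add_const]
    have hs : sgn K (n + 1) * sgn K (phiExp n (fun k => B.dg (w k)) fun j => B.dg (v j)) *
        sgn K ((∑ j, if j < k then B.dg (w j) else 0) + n * (k : ℕ)) * sgn K n =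
        sgn K ((m - 1) * n + l - 1) * sgn K (∑ j, if j < k then B.dg (w j) else 0) *
          sgn K (phiExp n (fun j => B.dg (w j) + if j = k then -1 else 0) fun j => B.dg (v j)) := by
      simp only [← sgn_add]
      refine sgn_eq ?_
      rw [phiExp, phiExp, sum_add_ite, posSum_add_ite]
      exact ⟨n + 1, by ring⟩
    linear_combination (dmat B (w k) a * M.coef (Function.update w k a) v P) * hs
  · rw [← mul_neg, ← neg_mul]
    simp only [Finset.mul_sum]
    refine Finset.sum_congr rfl fun k _ => Finset.sum_congr rfl fun a _ => ?_
    change _ = _ * (_ * (_ * (dmat B a (v k) * _)))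
    by_cases h : B.dg a = B.dg (v k) + 1
    swap
    · rw [dmat_eq_zero B h]
      ring
    -- The signs of the input terms involve the total output degree. The degree of `P` expresses it
    -- through the inputs, and off that degree the coefficient vanishes.
    by_cases hd : ∑ k, (B.dg (w k) + n) + ∑ j, (1 - B.dg (Function.update v k a j)) = n + 2
    swap
    · rw [mat_toHom, M.coef_eq_zero_of_deg _ _ hP hd]
      ring
    rw [mat_toHom, comp_update_eq k 1 B.dg v a h]
    have hd2 := (degree_iff (n + 2) w (Function.update v k a)).1 hd
    rw [comp_update_eq k 1 B.dg v a h, sum_add_ite] at hd2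
    have h1 : (∑ j, if j < k then 1 - B.dg (v j) else 0) =
        (k : ℕ) - ∑ j, if j < k then B.dg (v j) else 0 := by
      have := sum_ite_add_const (fun j => - B.dg (v j)) k 1
      rw [one_mul] at this
      rw [sub_eq_neg_add, ← Finset.sum_neg_distrib]
      refine Eq.trans (Finset.sum_congr rfl fun j _ => ?_) (this.trans ?_)
      · split_ifs
        · ring
        · rfl
      · congr 1
        refine Finset.sum_congr rfl fun j _ => ?_
        split_ifs
        · rfl
        · rfl
    have hs : sgn K (n + 1) * sgn K (phiExp n (fun k => B.dg (w k)) fun j => B.dg (v j)) *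
        sgn K (∑ k, (B.dg (w k) + n)) *
        sgn K (∑ j, if j < k then 1 - B.dg (v j) else 0) * sgn K (B.dg a) =
        sgn K ((m - 1) * n + l - 1) * (-sgn K ((1 - m) * n + 2 - l)) *
        sgn K (∑ j, if j < k then B.dg (v j) else 0) *
          sgn K (phiExp n (fun k => B.dg (w k)) fun j => B.dg (v j) + if j = k then 1 else 0) := by
      rw [h1, ← neg_one_mul (sgn K ((1 - m) * n + 2 - l)), ← sgn_one]
      simp only [← sgn_add]
      refine sgn_eq ?_
      rw [phiExp, phiExp, sum_add_ite, posSum_add_ite, pairSum_add_ite, Finset.sum_add_distrib,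
        hd2, h, Finset.sum_const, Finset.card_univ, Fintype.card_fin, nsmul_eq_mul]
      refine ⟨n + 2 - l + (k : ℕ) - (∑ j, if j < k then B.dg (v j) else 0) + B.dg (v k), ?_⟩
      ring
    linear_combination (dmat B a (v k) * M.coef w (Function.update v k a) P) * hs

end PolModel
end ComparisonDiff

/-! ### The bracket of polyvectors as the shuffle composition of maps. -/

section ComparisonBracket
variable {K : Type*} [Field K]

section Append
variable {a b : ℕ} (e : Fin a → ℤ) (f : Fin b → ℤ) (c : ℤ)

theorem sum_append : ∑ j, Fin.append e f j = ∑ j, e j + ∑ j, f j := by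
  simp [Fin.sum_univ_add]

theorem posSum_append : posSum (Fin.append e f) = posSum e + posSum f + a * ∑ j, f j := by
  simp only [posSum, Fin.sum_univ_add, Fin.append_left, Fin.append_right, Fin.val_castAdd,
    Fin.val_natAdd, Nat.cast_add, mul_add, Finset.sum_add_distrib, Finset.mul_sum]
  rw [Finset.sum_congr rfl fun j _ => mul_comm (f j) (a : ℤ)]
  ring

theorem pairSum_append :
    pairSum (Fin.append e f) = pairSum e + pairSum f + (∑ j, e j) * ∑ j, f j := by
  have h1 := two_pairSum e
  have h2 := two_pairSum f
  have h3 := two_pairSum (Fin.append e f)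
  rw [sum_append] at h3
  simp only [Fin.sum_univ_add, Fin.append_left, Fin.append_right] at h3
  linarith

theorem posSum_snoc : posSum (Fin.snoc e c : Fin (a + 1) → ℤ) = posSum e + a * c := by
  simp only [posSum, Fin.sum_univ_castSucc, Fin.snoc_castSucc, Fin.snoc_last, Fin.val_castSucc,
    Fin.val_last]
  ring

theorem pairSum_snoc :
    pairSum (Fin.snoc e c : Fin (a + 1) → ℤ) = pairSum e + (∑ j, e j) * c := by
  have h1 := two_pairSum e
  have h3 := two_pairSum (Fin.snoc e c : Fin (a + 1) → ℤ)
  simp only [Fin.sum_univ_castSucc, Fin.snoc_castSucc, Fin.snoc_last] at h3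
  linarith

theorem posSum_cons :
    posSum (Fin.cons c e : Fin (a + 1) → ℤ) = posSum e + ∑ j, e j := by
  rw [posSum_succ]
  rfl

end Append

/-- `E` is the total degree of the uncontracted inputs of the first map, `F` that of the inputs of
the second, and `δ` the degree of the contracted letter; the output degrees have been eliminated.
Over `ZMod 2` every square equals its base, so the claim becomes an identity of reduced polynomials.
-/
theorem bracket_sign_parity (n p b a l E F δ : ℤ) :
    Even ((n * ((p + b - 1) * ((n + 2 - p * n - (a + 1) + E + δ) +
      (n + 2 - (b + 1) * n - l + F - δ)) - p * (n + 2 - (b + 1) * n - l + F - δ)) +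
      (a + l) * ((n + 2 - p * n - (a + 1) + E + δ) + (n + 2 - (b + 1) * n - l + F - δ)) +
      ((a + l - 1) * (E + F) - a * F) + E * F) +
      1 + n * (δ - 1) + (a - E) * ((n + 2 - (b + 1) * n - l + F - δ) + b * n) +
      (1 - δ) * ((n + 2 - p * n - (a + 1) + E + δ) + p * n + (a - E)) -
      (((1 - p) * n + 2 - (a + 1)) * (((b + 1) - 1) * n + l - 1) + n * ((b + 1) - 1) * ((a + 1) - 1) +
        ((1 - (b + 1)) * n + 2 - l) * E +
        (n * ((p - 1) * (n + 2 - p * n - (a + 1) + E + δ)) +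
          (a + 1) * (n + 2 - p * n - (a + 1) + E + δ) + (((a + 1) - 1) * (E + δ) - a * δ) + E * δ) +
        (n * (((b + 1) - 1) * (δ + (n + 2 - (b + 1) * n - l + F - δ)) -
            (n + 2 - (b + 1) * n - l + F - δ)) +
          l * (δ + (n + 2 - (b + 1) * n - l + F - δ)) + (l - 1) * F))) := by
  rw [← ZMod.intCast_eq_zero_iff_even]
  push_cast
  generalize (n : ZMod 2) = n, (p : ZMod 2) = p, (b : ZMod 2) = b, (a : ZMod 2) = a,
    (l : ZMod 2) = l, (E : ZMod 2) = E, (F : ZMod 2) = F, (δ : ZMod 2) = δ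
  have hs : ∀ x : ZMod 2, x ^ 2 = x := by decide
  ring_nf
  simp only [hs]
  ring_nf
  reduce_mod_char

/-- On the left stand the signs of the bracket, of the Leibniz rule and of moving the contracted
letter, with `phiExp` of the concatenated words; on the right the signs prescribed for maps, with
`phiExp` of each factor. Position and pair sums split over concatenations, and what does not cancel
depends on total degrees only. -/
theorem bracket_sign {n : ℤ} {p b a l : ℕ} (d : Fin p → ℤ) (d' : Fin b → ℤ) (e : Fin a → ℤ)
    (f : Fin l → ℤ) (δ : ℤ)
    (h1 : ∑ k, d k = ∑ j, (Fin.snoc e δ : Fin (a + 1) → ℤ) j + (n + 2 - p * n - (a + 1 : ℕ)))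
    (h2 : ∑ k, (Fin.cons δ d' : Fin (b + 1) → ℤ) k = ∑ j, f j + (n + 2 - (b + 1 : ℕ) * n - l)) :
    sgn K (phiExp n (Fin.append d d') (Fin.append e f)) * (-sgn K (n * (δ - 1))) *
      sgn K ((∑ j, (1 - e j)) * ∑ k, (d' k + n)) *
      sgn K ((1 - δ) * (∑ k, (d k + n) + ∑ j, (1 - e j))) =
    sgn K (((1 - p) * n + 2 - (a + 1 : ℕ)) * (((b + 1 : ℕ) - 1) * n + l - 1)) *
      sgn K (n * ((b + 1 : ℕ) - 1) * ((a + 1 : ℕ) - 1)) *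
      sgn K (((1 - (b + 1 : ℕ)) * n + 2 - l) * ∑ j, e j) *
      sgn K (phiExp n d (Fin.snoc e δ : Fin (a + 1) → ℤ)) *
      sgn K (phiExp n (Fin.cons δ d' : Fin (b + 1) → ℤ) f) := by
  simp only [Fin.sum_univ_castSucc, Fin.snoc_castSucc, Fin.snoc_last] at h1
  rw [Fin.sum_univ_succ] at h2
  simp only [Fin.cons_zero, Fin.cons_succ] at h2
  rw [← neg_one_mul (sgn K (n * (δ - 1))), ← sgn_one]
  simp only [← sgn_add]
  refine sgn_eq ?_
  simp only [phiExp, posSum_append, pairSum_append, sum_append, posSum_snoc, pairSum_snoc,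
    posSum_cons, Fin.sum_univ_castSucc (Fin.snoc e δ : Fin (a + 1) → ℤ), Fin.snoc_castSucc,
    Fin.snoc_last, Fin.sum_univ_succ (Fin.cons δ d' : Fin (b + 1) → ℤ), Fin.cons_zero,
    Fin.cons_succ, Finset.sum_add_distrib, Finset.sum_sub_distrib, Finset.sum_const,
    Finset.card_univ, Fintype.card_fin, nsmul_eq_mul, mul_one]
  have h2' : ∑ k, d' k = n + 2 - ((b : ℤ) + 1) * n - l + ∑ j, f j - δ := by
    push_cast at h2
    linarith
  have h1' : ∑ k, d k = n + 2 - p * n - ((a : ℤ) + 1) + ∑ j, e j + δ := by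
    push_cast at h1
    linarith
  rw [h1', h2']
  have := bracket_sign_parity n p b a l (∑ j, e j) (∑ j, f j) δ
  push_cast
  convert this using 1
  ring

variable {g : Cochain K} [Module.Finite K g.carrier] {ι : Type*} [Fintype ι]
  {B : HomBasis g ι} {n : ℤ} {R : Type*} [Ring R] [Algebra K R]

theorem append_eq_comp {α : Type*} {p q : ℕ} (w : Fin (p + q) → α) (σ : Fin (p + q) → Fin (p + q)) :
    Fin.append (fun k => w (σ (Fin.castAdd q k))) (fun k => w (σ (Fin.natAdd p k))) = w ∘ σ := by
  ext k
  refine Fin.addCases (fun k => ?_) (fun k => ?_) k <;> simp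

theorem comp_snoc {α β : Type*} {p : ℕ} (f : α → β) (w : Fin p → α) (i : α) :
    (fun k => f ((Fin.snoc w i : Fin (p + 1) → α) k)) =
      (Fin.snoc (fun k => f (w k)) (f i) : Fin (p + 1) → β) := by
  ext k
  refine Fin.lastCases ?_ (fun k => ?_) k <;> simp

theorem comp_cons {α β : Type*} {p : ℕ} (f : α → β) (w : Fin p → α) (i : α) :
    (fun k => f ((Fin.cons i w : Fin (p + 1) → α) k)) =
      (Fin.cons (f i) (fun k => f (w k)) : Fin (p + 1) → β) := by
  ext k
  refine Fin.cases ?_ (fun k => ?_) k <;> simp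

theorem HomBasis.mat_shuffleComp (B : HomBasis g ι) {a l' m b : ℕ}
    (L : TPow g (a + 1) →ₗ[K] TPow g m) (L' : TPow g l' →ₗ[K] TPow g (b + 1)) (i : ℤ)
    (w : Fin (m + b) → ι) (v : Fin (a + l') → ι) : B.mat w v (shuffleComp g n L L' i) =
    ∑ ρ ∈ Sh m b, ∑ σ ∈ Sh a l', ∑ j,
      sign K σ * koszul K σ (fun j => B.dg (v j)) *
        (signPow K n ρ * koszul K ρ (fun k => B.dg (w k))) *
      sgn K (i * ∑ j, B.dg (v (σ (Fin.castAdd l' j)))) *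
      B.mat (fun k => w (ρ (Fin.castAdd b k)))
        (Fin.snoc (fun k => v (σ (Fin.castAdd l' k))) j : Fin (a + 1) → ι) L *
      B.mat (Fin.cons j (fun k => w (ρ (Fin.natAdd m k))) : Fin (b + 1) → ι)
        (fun k => v (σ (Fin.natAdd a k))) L' := by
  rw [shuffleComp, map_sum]
  simp only [map_sum]
  rw [Finset.sum_comm]
  refine Finset.sum_congr rfl fun ρ _ => Finset.sum_congr rfl fun σ _ => ?_
  rw [map_smul, ← LinearMap.comp_assoc, mat_comp_braid, mat_braid_inv_comp, ← append_eq_comp w ρ,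
    ← append_eq_comp v σ, mat_compMid, smul_eq_mul]
  simp only [Finset.mul_sum]
  exact Finset.sum_congr rfl fun j _ => by ring

namespace PolModel
variable (M : PolModel B n R)

/-- `coef_mul` distributes the letters over `P` and `Q` by shuffles. The index of `dY i P` is the
last input of the map of `P` and that of `dX i Q` the first output of the map of `Q`, so the sum
over `i` is the contraction of `mat_compMid`. -/
theorem toHom_bracket {p b : ℕ} (l : ℕ) {P Q : R} (hP : P ∈ M.gr p (n + 2))
    (hQ : Q ∈ M.deg (n + 2)) :
    M.toHom (p + b) l (∑ i, (-sgn K (n * (B.dg i - 1))) • (M.dY i P * M.dX i Q)) =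
    ∑ q : Finset.HasAntidiagonal.antidiagonal l,
      (sgn K (((1 - p) * n + 2 - (q.1.1 + 1 : ℕ)) * (((b + 1 : ℕ) - 1) * n + q.1.2 - 1)) *
        sgn K (n * ((b + 1 : ℕ) - 1) * ((q.1.1 + 1 : ℕ) - 1))) •
      castHom g (Finset.HasAntidiagonal.mem_antidiagonal.1 q.2) rfl
        (shuffleComp g n (M.toHom p (q.1.1 + 1) P) (M.toHom (b + 1) q.1.2 Q)
          ((1 - (b + 1 : ℕ)) * n + 2 - q.1.2)) := by
  refine B.mat_ext fun w v => ?_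
  have hPd := M.gr_le_deg _ _ hP
  rw [mat_toHom, map_sum, map_sum]
  simp only [map_smul, smul_eq_mul, M.coef_mul (M.dY_mem _ hPd) (M.dY_mem_gr _ hP),
    Finset.mul_sum]
  rw [Finset.sum_comm]
  simp only [Finset.sum_comm (s := Finset.univ (α := ι))]
  rw [Finset.sum_comm]
  refine Finset.sum_congr rfl fun q _ => ?_
  rw [HomBasis.mat_castHom, HomBasis.mat_shuffleComp]
  obtain ⟨⟨a, l'⟩, h⟩ := q
  obtain rfl : a + l' = l := Finset.HasAntidiagonal.mem_antidiagonal.1 h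
  simp only [Fin.cast_eq_self, Finset.mul_sum]
  refine Finset.sum_congr rfl fun ρ _ => Finset.sum_congr rfl fun σ _ =>
    Finset.sum_congr rfl fun i _ => ?_
  rw [← Finset.mul_sum, ← Finset.mul_sum, coef_dY, coef_dX,
    mat_toHom, mat_toHom]
  -- Replacing `phiExp` of the words by `phiExp` of the shuffled words converts the Koszul signs of
  -- the shuffles for shifted degrees into those used for maps.
  have hρ := mul_eq_of_mul_self 1 (signPow_mul_koszul_mul_self (K := K) n ρ fun k => B.dg (w k))
    (koszul_mul_self ρ _) (sgn_phiExp_perm_left n (fun k => B.dg (w k)) (fun j => B.dg (v j)) ρ)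
  have hσ := mul_eq_of_mul_self 1 (sign_mul_koszul_mul_self (K := K) σ fun j => B.dg (v j))
    (koszul_mul_self σ _)
    (sgn_phiExp_perm_right n ((fun k => B.dg (w k)) ∘ ρ) (fun j => B.dg (v j)) σ)
  have hw : (fun k => B.dg (w k)) ∘ ρ = Fin.append (fun k => B.dg (w (ρ (Fin.castAdd b k))))
      (fun k => B.dg (w (ρ (Fin.natAdd p k)))) := (append_eq_comp _ ρ).symm
  have hv : (fun j => B.dg (v j)) ∘ σ = Fin.append (fun j => B.dg (v (σ (Fin.castAdd l' j))))
      (fun j => B.dg (v (σ (Fin.natAdd a j)))) := (append_eq_comp _ σ).symm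
  rw [hw] at hρ hσ
  rw [hv] at hσ
  rw [mul_one, mul_one] at hρ hσ
  -- The sign comparison needs the degree conditions of both factors. If one fails, the
  -- corresponding coefficient is zero on both sides.
  by_cases hd₁ : ∑ k, (B.dg (w (ρ (Fin.castAdd b k))) + n) +
      ∑ j, (1 - B.dg ((Fin.snoc (fun k => v (σ (Fin.castAdd l' k))) i : Fin (a + 1) → ι) j)) = n + 2
  swap
  · rw [M.coef_eq_zero_of_deg _ _ hPd hd₁]
    ring
  by_cases hd₂ : ∑ k, (B.dg ((Fin.cons i (fun k => w (ρ (Fin.natAdd p k))) : Fin (b + 1) → ι) k)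
      + n) + ∑ j, (1 - B.dg (v (σ (Fin.natAdd a j)))) = n + 2
  swap
  · rw [M.coef_eq_zero_of_deg _ _ hQ hd₂]
    ring
  have h₁ := (degree_iff (n + 2) (fun k => w (ρ (Fin.castAdd b k))) _).1 hd₁
  have h₂ := (degree_iff (n + 2) _ (fun j => v (σ (Fin.natAdd a j)))).1 hd₂
  rw [comp_snoc B.dg] at h₁ ⊢
  rw [comp_cons B.dg] at h₂ ⊢
  have hs := bracket_sign (K := K) _ _ _ _ _ h₁ h₂
  linear_combination
    (-sgn K (n * (B.dg i - 1)) * (koszul K σ fun j => 1 - B.dg (v j)) *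
      sgn K ((∑ j, (1 - B.dg (v (σ (Fin.castAdd l' j))))) *
        ∑ k, (B.dg (w (ρ (Fin.natAdd p k))) + n)) *
      sgn K ((1 - B.dg i) * (∑ k, (B.dg (w (ρ (Fin.castAdd b k))) + n) +
        ∑ j, (1 - B.dg (v (σ (Fin.castAdd l' j)))))) *
      M.coef (fun k => w (ρ (Fin.castAdd b k)))
        (Fin.snoc (fun k => v (σ (Fin.castAdd l' k))) i : Fin (a + 1) → ι) P *
      M.coef (Fin.cons i (fun k => w (ρ (Fin.natAdd p k))) : Fin (b + 1) → ι)
        (fun j => v (σ (Fin.natAdd a j))) Q) * hρ +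
    (-sgn K (n * (B.dg i - 1)) * (signPow K n ρ * koszul K ρ fun k => B.dg (w k)) *
      sgn K ((∑ j, (1 - B.dg (v (σ (Fin.castAdd l' j))))) *
        ∑ k, (B.dg (w (ρ (Fin.natAdd p k))) + n)) *
      sgn K ((1 - B.dg i) * (∑ k, (B.dg (w (ρ (Fin.castAdd b k))) + n) +
        ∑ j, (1 - B.dg (v (σ (Fin.castAdd l' j)))))) *
      M.coef (fun k => w (ρ (Fin.castAdd b k)))
        (Fin.snoc (fun k => v (σ (Fin.castAdd l' k))) i : Fin (a + 1) → ι) P *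
      M.coef (Fin.cons i (fun k => w (ρ (Fin.natAdd p k))) : Fin (b + 1) → ι)
        (fun j => v (σ (Fin.natAdd a j))) Q) * hσ +
    ((signPow K n ρ * koszul K ρ fun k => B.dg (w k)) *
      (sign K σ * koszul K σ fun j => B.dg (v j)) *
      M.coef (fun k => w (ρ (Fin.castAdd b k)))
        (Fin.snoc (fun k => v (σ (Fin.castAdd l' k))) i : Fin (a + 1) → ι) P *
      M.coef (Fin.cons i (fun k => w (ρ (Fin.natAdd p k))) : Fin (b + 1) → ι)
        (fun j => v (σ (Fin.natAdd a j))) Q) * hs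

/-- The term whose second weight is 0 drops out, because `dX` kills weight 0. The second weight can
therefore be written as b + 1 with p + b = m. -/
theorem half_sum_schouten_eq [CharZero K] {P : ℕ → R} (hP : ∀ p, P p ∈ M.gr p (n + 2)) (m : ℕ) :
    (1 / 2 : K) • ∑ p ∈ Finset.HasAntidiagonal.antidiagonal (m + 1),
        M.schouten (P p.1) (M.gr_le_deg _ _ (hP p.1)) (P p.2) =
      ∑ p : Finset.HasAntidiagonal.antidiagonal m, ∑ i, (-sgn K (n * (B.dg i - 1))) •
        (M.dY i (P p.1.1) * M.dX i (P (p.1.2 + 1))) := by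
  rw [M.half_sum_schouten fun p => M.gr_le_deg _ _ (hP p), Finset.Nat.sum_antidiagonal_succ']
  rw [Finset.sum_eq_zero (s := Finset.univ (α := ι)), zero_add]
  · exact (Finset.sum_coe_sort (Finset.HasAntidiagonal.antidiagonal m) fun p : ℕ × ℕ =>
      ∑ i, (-sgn K (n * (B.dg i - 1))) • (M.dY i (P p.1) * M.dX i (P (p.2 + 1)))).symm
  · intro i _
    rw [M.dX_gr_zero i (hP 0), mul_zero, smul_zero]

theorem toHom_half_sum_schouten [CharZero K] {P : ℕ → R} (hP : ∀ p, P p ∈ M.gr p (n + 2))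
    (m l : ℕ) :
    M.toHom m l ((1 / 2 : K) • ∑ p ∈ Finset.HasAntidiagonal.antidiagonal (m + 1),
        M.schouten (P p.1) (M.gr_le_deg _ _ (hP p.1)) (P p.2)) =
      ∑ p : Finset.HasAntidiagonal.antidiagonal m, ∑ q : Finset.HasAntidiagonal.antidiagonal l,
        (sgn K (((1 - p.1.1) * n + 2 - (q.1.1 + 1 : ℕ)) *
            (((p.1.2 + 1 : ℕ) - 1) * n + q.1.2 - 1)) *
          sgn K (n * ((p.1.2 + 1 : ℕ) - 1) * ((q.1.1 + 1 : ℕ) - 1))) •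
        castHom g (Finset.HasAntidiagonal.mem_antidiagonal.1 q.2)
          (Finset.HasAntidiagonal.mem_antidiagonal.1 p.2)
          (shuffleComp g n (M.toHom p.1.1 (q.1.1 + 1) (P p.1.1))
            (M.toHom (p.1.2 + 1) q.1.2 (P (p.1.2 + 1)))
            ((1 - (p.1.2 + 1 : ℕ)) * n + 2 - q.1.2)) := by
  rw [M.half_sum_schouten_eq hP, map_sum]
  refine Finset.sum_congr rfl fun p _ => ?_
  obtain ⟨⟨p, b⟩, h⟩ := p
  obtain rfl : p + b = m := Finset.HasAntidiagonal.mem_antidiagonal.1 h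
  exact M.toHom_bracket l (hP p) (M.gr_le_deg _ _ (hP (b + 1)))

theorem half_sum_schouten_mem [CharZero K] {P : ℕ → R} (hP : ∀ p, P p ∈ M.gr p (n + 2)) (m : ℕ) :
    (1 / 2 : K) • ∑ p ∈ Finset.HasAntidiagonal.antidiagonal (m + 1),
      M.schouten (P p.1) (M.gr_le_deg _ _ (hP p.1)) (P p.2) ∈ M.gr m (n + 2 + 1) := by
  rw [M.half_sum_schouten_eq hP]
  refine Submodule.sum_mem _ fun p _ => Submodule.sum_mem _ fun i _ => Submodule.smul_mem _ _ ?_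
  obtain ⟨⟨p, b⟩, h⟩ := p
  obtain rfl : p + b = m := Finset.HasAntidiagonal.mem_antidiagonal.1 h
  have := M.mul_mem_gr (M.dY_mem_gr i (hP p)) (M.dX_mem_gr i (hP (b + 1)))
  rwa [show n + 2 - (1 - B.dg i) + (n + 2 - (B.dg i + n)) = n + 2 + 1 by ring] at this

/-- The component of weight `m` of the Maurer-Cartan expression. -/
def mcExpr (P : ℕ → R) (hP : ∀ p, P p ∈ M.gr p (n + 2)) (m : ℕ) : R :=
  sgn K (n + 1) • M.diff (P m) +
    (1 / 2 : K) • ∑ p ∈ Finset.HasAntidiagonal.antidiagonal (m + 1),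
      M.schouten (P p.1) (M.gr_le_deg _ _ (hP p.1)) (P p.2)

/-- The Maurer-Cartan equation for polyvectors in terms of the associated maps. -/
theorem mcExpr_eq_zero_iff [CharZero K] {P : ℕ → R} (hP : ∀ p, P p ∈ M.gr p (n + 2)) (m : ℕ) :
    M.mcExpr P hP m = 0 ↔
    ∀ l : ℕ, sgn K ((m - 1) * n + l - 1) • homDiff g ((1 - m) * n + 2 - l) (M.toHom m l (P m)) +
      ∑ p : Finset.HasAntidiagonal.antidiagonal m, ∑ q : Finset.HasAntidiagonal.antidiagonal l,
        (sgn K (((1 - p.1.1) * n + 2 - (q.1.1 + 1 : ℕ)) *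
            (((p.1.2 + 1 : ℕ) - 1) * n + q.1.2 - 1)) *
          sgn K (n * ((p.1.2 + 1 : ℕ) - 1) * ((q.1.1 + 1 : ℕ) - 1))) •
        castHom g (Finset.HasAntidiagonal.mem_antidiagonal.1 q.2)
          (Finset.HasAntidiagonal.mem_antidiagonal.1 p.2)
          (shuffleComp g n (M.toHom p.1.1 (q.1.1 + 1) (P p.1.1))
            (M.toHom (p.1.2 + 1) q.1.2 (P (p.1.2 + 1)))
            ((1 - (p.1.2 + 1 : ℕ)) * n + 2 - q.1.2)) = 0 := by
  simp only [← M.toHom_diff m _ (M.gr_le_deg _ _ (hP m)), ← M.toHom_half_sum_schouten hP m,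
    ← map_smul (M.toHom m _), ← map_add]
  change _ ↔ ∀ l, M.toHom m l (M.mcExpr P hP m) = 0
  -- The expression is itself of weight `m` and degree n + 3, so it vanishes as soon as all its maps
  -- do.
  refine ⟨fun h l => ?_, fun h => M.eq_zero_of_toHom (add_mem (Submodule.smul_mem _ _
    (M.diff_mem_gr (hP m))) (M.half_sum_schouten_mem hP m)) h⟩
  rw [h, map_zero]

end PolModel
end ComparisonBracket

/-! ### Shifted Poisson structures and families of maps. -/

section Bijection
variable {K : Type*} [Field K]

/-- The component of weight `m` of the Maurer-Cartan expression. -/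
def Pol.mcExpr {A : CDGA K} {n : ℤ} (P : ℕ → Pol A n)
    (hP : ∀ m, P m ∈ Pol.gr A n m (n + 2)) (m : ℕ) : Pol A n :=
  sgn K (n + 1) • Pol.diff A n (P m) +
    (1 / 2 : K) • ∑ p ∈ Finset.HasAntidiagonal.antidiagonal (m + 1),
      Pol.schouten n (n + 2) ⟨P p.1, Pol.gr_le_deg _ _ (hP p.1)⟩ (P p.2)

theorem PoissonStructure.mcExpr_eq_zero {A : CDGA K} {n : ℤ} (π : PoissonStructure A n) (m : ℕ) :
    Pol.mcExpr π.comp π.mem m = 0 := π.maurerCartan m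

/-- A shifted Poisson structure from its components. -/
def PoissonStructure.ofMcExpr {A : CDGA K} {n : ℤ} (P : ℕ → Pol A n)
    (hP : ∀ m, P m ∈ Pol.gr A n m (n + 2)) (h0 : ∀ m : ℕ, m < 2 → P m = 0)
    (h : ∀ m, Pol.mcExpr P hP m = 0) : PoissonStructure A n where
  comp := P
  mem := hP
  zero := h0
  maurerCartan := h

theorem PoissonStructure.ext_comp {A : CDGA K} {n : ℤ} {E F : PoissonStructure A n}
    (h : E.comp = F.comp) : E = F := by
  cases E
  cases F
  cases h
  rfl

theorem MapFamily.ext_map {g : Cochain K} {n : ℤ} {E F : MapFamily g n}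
    (h : E.map = F.map) : E = F := by
  cases E
  cases F
  cases h
  rfl

variable {g : Cochain K} {n : ℤ}

theorem shuffleComp_zero_left {a l' m b : ℕ} (L' : TPow g l' →ₗ[K] TPow g (b + 1)) (i : ℤ) :
    shuffleComp g n (0 : TPow g (a + 1) →ₗ[K] TPow g m) L' i = 0 := by
  simp [shuffleComp, compMid]

theorem castHom_zero {l l' m m' : ℕ} (hl : l = l') (hm : m = m') :
    castHom g hl hm (0 : TPow g l →ₗ[K] TPow g m) = 0 := by
  simp [castHom]

/-- A family carries no condition for m < 2, but there the equation holds by itself: the first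
factor of each composition has at most `m` outputs, hence is zero. Poisson structures require the
equation in every weight. -/
theorem MapFamily.maurerCartan' (E : MapFamily g n) (m l : ℕ) :
    sgn K ((m - 1) * n + l - 1) • homDiff g ((1 - m) * n + 2 - l) (E.map m l) +
      ∑ p : Finset.HasAntidiagonal.antidiagonal m, ∑ q : Finset.HasAntidiagonal.antidiagonal l,
        (sgn K (((1 - p.1.1) * n + 2 - (q.1.1 + 1 : ℕ)) *
            (((p.1.2 + 1 : ℕ) - 1) * n + q.1.2 - 1)) *
          sgn K (n * ((p.1.2 + 1 : ℕ) - 1) * ((q.1.1 + 1 : ℕ) - 1))) •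
        castHom g (Finset.HasAntidiagonal.mem_antidiagonal.1 q.2)
          (Finset.HasAntidiagonal.mem_antidiagonal.1 p.2)
          (shuffleComp g n (E.map p.1.1 (q.1.1 + 1)) (E.map (p.1.2 + 1) q.1.2)
            ((1 - (p.1.2 + 1 : ℕ)) * n + 2 - q.1.2)) = 0 := by
  by_cases hm : 2 ≤ m
  · exact E.maurerCartan m hm l
  · have h0 : homDiff g ((1 - m) * n + 2 - l) (0 : TPow g l →ₗ[K] TPow g m) = 0 := by
      simp [homDiff]
    rw [E.zero m (by omega), h0, smul_zero, zero_add]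
    refine Finset.sum_eq_zero fun p _ => Finset.sum_eq_zero fun q _ => ?_
    have := Finset.HasAntidiagonal.mem_antidiagonal.1 p.2
    rw [E.zero p.1.1 (by omega), shuffleComp_zero_left, castHom_zero, smul_zero]

variable [Module.Finite K g.carrier] {ι : Type*} [Fintype ι]

theorem Pol.mcExpr_eq (B : HomBasis g ι) {P : ℕ → Pol (freeAlg g) n}
    (hP : ∀ m, P m ∈ Pol.gr (freeAlg g) n m (n + 2)) (m : ℕ) :
    Pol.mcExpr (A := freeAlg g) (n := n) P hP m = (polModel B n).mcExpr P hP m := by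
  rfl

theorem Pol.mcExpr_comp (B : HomBasis g ι) (π : PoissonStructure (freeAlg g) n) (m : ℕ) :
    (polModel B n).mcExpr π.comp π.mem m = 0 := by
  rw [← Pol.mcExpr_eq]
  exact PoissonStructure.mcExpr_eq_zero (A := freeAlg g) π m

theorem PoissonStructure.comp_mem_gr (π : PoissonStructure (freeAlg g) n) (m : ℕ) :
    π.comp m ∈ Pol.gr (freeAlg g) n m (n + 2) :=
  π.mem m

theorem monomial_eq (B : HomBasis g ι) {m l : ℕ} {e : Fin m → ℤ} (x : ∀ k, g.gr (e k))
    {f : Fin l → ℤ} (θ : ∀ j, g.dualGr (f j)) :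
    monomial g n x (fun j => (θ j : Module.Dual K g.carrier)) =
      (List.ofFn fun k => (polModel B n).sx (x k)).prod *
        (List.ofFn fun j => (polModel B n).st (θ j : Module.Dual K g.carrier)).prod := by
  rfl

namespace HomBasis
variable (B : HomBasis g ι)

theorem toHom_eq_zero_of_eq_zero (m l : ℕ) {P : Pol (freeAlg g) n}
    (h : P = (0 : Pol (freeAlg g) n)) : (polModel B n).toHom m l P = 0 := by
  subst h
  exact LinearMap.map_zero _

variable [CharZero K]

theorem exists_toHom_eq_zero_of_mem (m : ℕ) {P : Pol (freeAlg g) n}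
    (hP : P ∈ Pol.gr (freeAlg g) n m (n + 2)) :
    ∃ N, ∀ l, N < l → (polModel B n).toHom m l P = 0 :=
  (polModel B n).exists_toHom_eq_zero (m := m) (i := n + 2) (P := P) hP

theorem maurerCartan_of_mcExpr {P : ℕ → Pol (freeAlg g) n}
    (hP : ∀ m, P m ∈ Pol.gr (freeAlg g) n m (n + 2)) (m : ℕ)
    (h : (polModel B n).mcExpr P hP m = (0 : Pol (freeAlg g) n)) (l : ℕ) :
    sgn K ((m - 1) * n + l - 1) • homDiff g ((1 - m) * n + 2 - l) ((polModel B n).toHom m l (P m)) +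
      ∑ p : Finset.HasAntidiagonal.antidiagonal m, ∑ q : Finset.HasAntidiagonal.antidiagonal l,
        (sgn K (((1 - p.1.1) * n + 2 - (q.1.1 + 1 : ℕ)) *
            (((p.1.2 + 1 : ℕ) - 1) * n + q.1.2 - 1)) *
          sgn K (n * ((p.1.2 + 1 : ℕ) - 1) * ((q.1.1 + 1 : ℕ) - 1))) •
        castHom g (Finset.HasAntidiagonal.mem_antidiagonal.1 q.2)
          (Finset.HasAntidiagonal.mem_antidiagonal.1 p.2)
          (shuffleComp g n ((polModel B n).toHom p.1.1 (q.1.1 + 1) (P p.1.1)) 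
            ((polModel B n).toHom (p.1.2 + 1) q.1.2 (P (p.1.2 + 1)))
            ((1 - (p.1.2 + 1 : ℕ)) * n + 2 - q.1.2)) = 0 :=
  ((polModel B n).mcExpr_eq_zero_iff (P := P) hP m).1 h l

set_option maxHeartbeats 1000000 in
/-- The family of maps of a shifted Poisson structure. -/
def toMapFamily (π : PoissonStructure (freeAlg g) n) : MapFamily g n where
  map m l := (polModel B n).toHom m l (π.comp m)
  mem m l := (polModel B n).toHom_mem l (π.comp_mem_gr m)
  zero m hm l := toHom_eq_zero_of_eq_zero B m l (π.zero m hm)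
  bounded m := exists_toHom_eq_zero_of_mem B m (π.comp_mem_gr m)
  maurerCartan m _ := maurerCartan_of_mcExpr B π.comp_mem_gr m (Pol.mcExpr_comp B π m)

/-- The sum of the pieces rebuilt from the single maps. It is finite thanks to the bound `N`, and
pieces with different numbers of inputs do not interfere. -/
theorem exists_comp_of_mapFamily (E : MapFamily g n) (m : ℕ) :
    ∃ P ∈ Pol.gr (freeAlg g) n m (n + 2), ∀ l, (polModel B n).toHom m l P = E.map m l := by
  classical
  obtain ⟨N, hN⟩ := E.bounded m
  refine ⟨∑ l ∈ Finset.range (N + 1), (polModel B n).ofHom m l (E.map m l),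
    Submodule.sum_mem _ fun l _ => (polModel B n).ofHom_mem' (E.mem m l), fun l => ?_⟩
  rw [map_sum]
  by_cases hl : l ≤ N
  · rw [Finset.sum_eq_single l, (polModel B n).toHom_ofHom (E.mem m l)]
    · exact fun l' _ h => (polModel B n).toHom_ofHom_of_ne h.symm _
    · exact fun h => absurd (Finset.mem_range.2 (by omega)) h
  · rw [hN l (by omega)]
    refine Finset.sum_eq_zero fun l' hl' => (polModel B n).toHom_ofHom_of_ne ?_ _
    have := Finset.mem_range.1 hl'
    omega

/-- The component of weight `m` of the shifted Poisson structure of a family of maps. -/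
def compOfMapFamily (E : MapFamily g n) (m : ℕ) : Pol (freeAlg g) n :=
  (B.exists_comp_of_mapFamily E m).choose

theorem compOfMapFamily_mem (E : MapFamily g n) (m : ℕ) :
    B.compOfMapFamily E m ∈ Pol.gr (freeAlg g) n m (n + 2) :=
  (B.exists_comp_of_mapFamily E m).choose_spec.1

theorem toHom_compOfMapFamily (E : MapFamily g n) (m l : ℕ) :
    (polModel B n).toHom m l (B.compOfMapFamily E m) = E.map m l :=
  (B.exists_comp_of_mapFamily E m).choose_spec.2 l

theorem compOfMapFamily_eq_zero (E : MapFamily g n) {m : ℕ} (hm : m < 2) :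
    B.compOfMapFamily E m = 0 :=
  (polModel B n).eq_zero_of_toHom (B.compOfMapFamily_mem E m) fun l => by
    rw [B.toHom_compOfMapFamily, E.zero m hm]

theorem mcExpr_compOfMapFamily (E : MapFamily g n) (m : ℕ) :
    Pol.mcExpr (A := freeAlg g) (n := n) (B.compOfMapFamily E) (B.compOfMapFamily_mem E) m =
      (0 : Pol (freeAlg g) n) := by
  rw [Pol.mcExpr_eq B]
  refine ((polModel B n).mcExpr_eq_zero_iff (B.compOfMapFamily_mem E) m).2 fun l => ?_
  simp only [B.toHom_compOfMapFamily]
  exact MapFamily.maurerCartan' E m l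

/-- The shifted Poisson structure of a family of maps. -/
def ofMapFamily (E : MapFamily g n) : PoissonStructure (freeAlg g) n :=
  PoissonStructure.ofMcExpr (A := freeAlg g) (n := n) (B.compOfMapFamily E)
    (B.compOfMapFamily_mem E) (fun _ => B.compOfMapFamily_eq_zero E) (B.mcExpr_compOfMapFamily E)

theorem comp_ofMapFamily (E : MapFamily g n) (m : ℕ) :
    (B.ofMapFamily E).comp m = B.compOfMapFamily E m := rfl

/-- The components are obtained by choice, but they are unique, since the maps determine a
polyvector of given weight. -/
theorem ofMapFamily_toMapFamily (π : PoissonStructure (freeAlg g) n) :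
    B.ofMapFamily (B.toMapFamily π) = π := by
  refine PoissonStructure.ext_comp (A := freeAlg g) (n := n) (funext fun m => ?_)
  rw [comp_ofMapFamily, ← sub_eq_zero]
  refine (polModel B n).eq_zero_of_toHom
    (Submodule.sub_mem _ (B.compOfMapFamily_mem _ m) (π.mem m)) fun l => ?_
  rw [map_sub, sub_eq_zero]
  exact B.toHom_compOfMapFamily _ m l

/-- Shifted Poisson structures as families of maps. -/
def poissonEquiv : PoissonStructure (freeAlg g) n ≃ MapFamily g n where
  toFun := B.toMapFamily
  invFun := B.ofMapFamily
  left_inv := B.ofMapFamily_toMapFamily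
  right_inv E := MapFamily.ext_map (funext fun m => funext fun l => B.toHom_compOfMapFamily E m l)

/-- The polyvectors of weight `m` as finite families of maps. -/
def polEquiv (m : ℕ) : Pol.gr (freeAlg g) n m (n + 2) ≃ₗ[K]
    ⨁ l : ℕ, homAS g n l m ((1 - m) * n + 2 - l) := (polModel B n).familyEquiv m

theorem polEquiv_apply {m : ℕ} (l : ℕ) {P : Pol (freeAlg g) n}
    (hP : P ∈ Pol.gr (freeAlg g) n m (n + 2)) :
    (B.polEquiv m ⟨P, hP⟩ l : TPow g l →ₗ[K] TPow g m) = (polModel B n).toHom m l P :=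
  (polModel B n).familyEquiv_apply l ⟨P, hP⟩

theorem poissonEquiv_map (π : PoissonStructure (freeAlg g) n) (m l : ℕ) :
    (B.poissonEquiv π).map m l = (polModel B n).toHom m l (π.comp m) := rfl

theorem toHom_pol_monomial {m l : ℕ} {e : Fin m → ℤ} (x : ∀ k, g.gr (e k)) {f : Fin l → ℤ}
    (θ : ∀ j, g.dualGr (f j)) :
    (polModel B n).toHom m l (monomial g n x fun j => (θ j : Module.Dual K g.carrier)) =
    (sgn K (∑ k : Fin m, e k * ((m - ((k : ℕ) + 1)) * n + l)) *
      sgn K (∑ j : Fin l, f j * (l - ((j : ℕ) + 1)))) •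
      mapOfMonomial g n e (fun k => (x k : g.carrier)) f
        (fun j => (θ j : Module.Dual K g.carrier)) := by
  rw [monomial_eq B]
  exact (polModel B n).toHom_monomial x θ

theorem toHom_pol_monomial_of_ne {m l l' : ℕ} (h : l' ≠ l) {e : Fin m → ℤ} (x : ∀ k, g.gr (e k))
    {f : Fin l → ℤ} (θ : ∀ j, g.dualGr (f j)) :
    (polModel B n).toHom m l' (monomial g n x fun j => (θ j : Module.Dual K g.carrier)) = 0 := by
  rw [monomial_eq B]
  exact (polModel B n).toHom_monomial_of_ne h x θ

end HomBasis
end Bijection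

end
end ShiftedPoisson

/-! ### The theorem. -/

set_option maxHeartbeats 1000000 in
theorem mainTheorem2 {K : Type*} [Field K] [CharZero K] (g : ShiftedPoisson.Cochain K)
    [Module.Finite K g.carrier] (n : ℤ) :
    ∃ Φ : ∀ m : ℕ, ShiftedPoisson.Pol.gr (ShiftedPoisson.freeAlg g) n m (n + 2) ≃ₗ[K]
        ⨁ l : ℕ, ShiftedPoisson.homAS g n l m ((1 - m) * n + 2 - l),
      (∀ (m l : ℕ) (e : Fin m → ℤ) (f : Fin l → ℤ) (x : ∀ k, g.gr (e k))
        (θ : ∀ j, g.dualGr (f j)) (h : ∑ k, (e k + n) + ∑ j, (f j + 1) = n + 2),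
        (Φ m ⟨ShiftedPoisson.monomial g n x (fun j => (θ j : Module.Dual K g.carrier)),
            h ▸ ShiftedPoisson.monomial_mem g n x θ⟩ l :
              ShiftedPoisson.TPow g l →ₗ[K] ShiftedPoisson.TPow g m) =
          (ShiftedPoisson.sgn K (∑ k : Fin m, e k * ((m - ((k : ℕ) + 1)) * n + l)) *
            ShiftedPoisson.sgn K (∑ j : Fin l, f j * (l - ((j : ℕ) + 1)))) •
            ShiftedPoisson.mapOfMonomial g n e (fun k => (x k : g.carrier)) f
              (fun j => (θ j : Module.Dual K g.carrier)) ∧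
        ∀ l', l' ≠ l →
          Φ m ⟨ShiftedPoisson.monomial g n x (fun j => (θ j : Module.Dual K g.carrier)),
            h ▸ ShiftedPoisson.monomial_mem g n x θ⟩ l' = 0) ∧
      ∃ E : ShiftedPoisson.PoissonStructure (ShiftedPoisson.freeAlg g) n ≃
          ShiftedPoisson.MapFamily g n,
        ∀ (π : ShiftedPoisson.PoissonStructure (ShiftedPoisson.freeAlg g) n) (m l : ℕ),
          (E π).map m l = (Φ m ⟨π.comp m, π.mem m⟩ l :
            ShiftedPoisson.TPow g l →ₗ[K] ShiftedPoisson.TPow g m) := by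
  -- The basis only serves the construction; nothing asserted about the isomorphisms or the
  -- bijection refers to it.
  obtain ⟨r, ⟨B⟩⟩ := ShiftedPoisson.exists_homBasis g
  refine ⟨fun m => B.polEquiv (n := n) m, ?_, ?_⟩
  · intro m l e f x θ h
    constructor
    · exact (B.polEquiv_apply l _).trans (B.toHom_pol_monomial x θ)
    · intro l' hl'
      refine Subtype.ext ?_
      exact (B.polEquiv_apply l' _).trans (B.toHom_pol_monomial_of_ne hl' x θ)
  · refine ⟨B.poissonEquiv (n := n), fun π m l => ?_⟩
    exact (B.poissonEquiv_map π m l).trans (B.polEquiv_apply l (π.mem m)).symm
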